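/- **Conventions.** Let $\tau$ be a finite vocabulary; all $\tau$-models are finite and non-empty, and $\mathbf t,\mathbf t_1,\mathbf t_2:\mathbb N\to\mathbb N\cup\{\infty\}$. The elements of a model $M$ are urelements; $V_0[M]=M$, $V_{t+1}[M]=V_t[M]\cup\mathcal P(V_t[M])$. Formulas are first order in $\tau\cup\{\in\}\cup\{P_\ell:\ell<m_1\}$ ($P_\ell$ unary; atomic formulas unnested, function symbols being used through their graphs on $M$), and may use the cardinality quantifier, i.e. the formulas $|\{x:\theta(x,\bar y)\}|=z$ ($z$ a variable standing for a von Neumann numeral) and $(Q_{\mathbf t}x)\theta(x,\bar y)$, meaning $|\{x:\theta(x,\bar y)\}|>\mathbf t(\|M\|)$. An inductive scheme $\Upsilon$ consists of formulas $\psi_\ell(x;\bar y_\ell)$ $(\ell<m_0)$ and $\varphi_\ell(x)$ $(\ell<m_1)$. For $N\subseteq\bigcup_tV_t[M]$ and $\bar c=\langle c_\ell:\ell<m_1\rangle$, each $c_\ell\in N$ or undefined ($P_\ell$ is read as $\{c_\ell\}$, respectively $\emptyset$), put $\mathcal P_\ell=\{\{a\in N:(N,\bar c)\models\psi_\ell(a,\bar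 b)\}:\bar b\subseteq N\}$. The $(\Upsilon,\mathbf t)$-successor of $(N,\bar c)$ is $(N',\bar c')$, where $N'$ is the union of $N$ and those $\mathcal P_\ell$ with at most $\mathbf t(\|M\|)$ members, and $c'_\ell=\{a\in N:(N,\bar c)\models\varphi_\ell(a)\}$ if this set is in $N'$, otherwise undefined. $(N_0,\bar c_0)=(M,\text{all undefined})$, and $(N_{t+1},\bar c_{t+1})$ is the successor of $(N_t,\bar c_t)$; write $N_t[M,\Upsilon,\mathbf t]$, and $N_t[M,\Upsilon]$ for $\mathbf t=\infty$. $N_t[M,\Upsilon,\mathbf t]$ is *well defined* if at no earlier stage some $\mathcal P_\ell$ has more than $\mathbf t(\|M\|)$ members. The *stopping time* $t[M,\Upsilon,\mathbf t]$ is the least $t$ such that, for $N_t[M,\Upsilon]$, either the run has *halted* ($c_{t,0},c_{t,1}$ are defined and equal) or the resources are exhausted: $\|N_{t+1}\|+(t+1)>\mathbf t(\|M\|)$ (variant 2), or $\|N_{t+1}\|>\mathbf t(\|M\|)$ (variant 3), or some $\mathcal P_\ell$ at stage $t$ has more than $\mathbf t(\|M\|)$ members (variant 4); it is $\infty$ if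 there is no such $t$. The truth value of $\theta_{\Upsilon,\chi,\mathbf t}$ in $M$ is that of $\chi$ in $(N_t,\bar c_t)$ at the stopping time $t$ if the run has halted at $t$, and is undefined otherwise. **Systems.** For $I\subseteq\mathcal P(M)$ let $I[n]$ be the set of unions of $n$ members of $I$. A *$k$-system* $(M,I,\mathcal F)$ consists of $I$, closed under subsets and containing all singletons, and a non-empty family $\mathcal F$ of partial automorphisms of $M$, closed under inverse, composition and restriction, such that for $f\in\mathcal F$: $f''(A)\in I$ if $A\in I$, $A\subseteq\mathrm{Dom}f$; $\mathrm{Dom}f\in I[k]$; and for $B\in I[k-1]$ with $B\subseteq\mathrm{Dom} f$ and $A\in I$ some $g\in\mathcal F$ satisfies $f\restriction B\subseteq g$, $A\subseteq\mathrm{Dom}g$. For $A\subseteq M$ and $h:[m]\to M$ let $H_{A,h}=\{f\circ h:f\in\mathcal F,\ A\cup\mathrm{Rang}h\subseteq\mathrm{Dom}f,\ f\restriction A=\mathrm{id}\}$, and let $\mathcal E(A,h)$ be the set of equivalence relations $E$ on $H_{A,h}$ such that $h_1Eh_2\Leftrightarrow h_3Eh_4$ whenever $f\in\mathcal F$, $f\restriction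 A=\mathrm{id}_A$, $f\circ h_1=h_3$, $f\circ h_2=h_4$. The system is *$(\mathbf t,s)$-dichotomical* if for all $h:[m]\to M$ with range in $I[s]$ and $E\in\mathcal E(\emptyset,h)$, either there is $u\subseteq[m]$ with $h''(u)\in I$ such that $h_1\restriction u=h_2\restriction u\Rightarrow h_1Eh_2$ on $H_{\emptyset,h}$, or $E$ has more than $\mathbf t(\|M\|)$ classes. For systems $\mathcal Y_1,\mathcal Y_2$, a family $\mathcal K$ of partial maps from $M_1$ to $M_2$ *preserves the numbers of classes* if the following holds: let $A_\ell\in I_\ell[s]$, $h_\ell:[m]\to M_\ell$ with range in $I_\ell$, $E_\ell\in\mathcal E_{\mathcal Y_\ell}(A_\ell,h_\ell)$ and $g\in\mathcal K$ with $A_1\cup\mathrm{Rang}h_1\subseteq\mathrm{Dom}g$, $g''(A_1)=A_2$, $g\circ h_1=h_2$, such that $g$ maps $E_1$ to $E_2$ (whenever $g'\in\mathcal K$, $g'\restriction A_1=g\restriction A_1$, $x,y\in H_{A_1,h_1}$ and $g'\circ x,g'\circ y$ are defined and in $H_{A_2,h_2}$, then $xE_1y\Leftrightarrow(g'\circ x)E_2(g'\circ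 y)$); then $E_1$ and $E_2$ have the same number of classes. A *super $(\mathbf t,k,s)$-system* is a $(\mathbf t,s)$-dichotomical $k$-system for which $\mathcal F$ preserves the numbers of classes (with $\mathcal Y_1=\mathcal Y_2$). A *super $(k,s)$-witness* to the equivalence of $(\mathcal Y_1,\mathbf t_1)$ and $(\mathcal Y_2,\mathbf t_2)$, where $\mathcal Y_\ell=(M_\ell,I_\ell,\mathcal F_\ell)$ is a super $(\mathbf t_\ell,k,s)$-system, is a non-empty family $\mathcal H$ of partial isomorphisms from $M_1$ to $M_2$ that preserves the numbers of classes and satisfies, for $g,g'\in\mathcal H$, $f_\ell\in\mathcal F_\ell$: $\mathrm{Dom}g\in I_1[k]$, $\mathrm{Rang}g\in I_2[k]$; for $A\subseteq\mathrm{Dom}g$, $A\in I_1\Leftrightarrow g''(A)\in I_2$; $g\circ f_1\in\mathcal H$, $f_2\circ g\in\mathcal H$, $g'^{-1}\circ g\in\mathcal F_1$, $g'\circ g^{-1}\in\mathcal F_2$; if $A\in I_1[k-1]$, $A\subseteq\mathrm{Dom}g$, $B\in I_1$, then some $g_1\in\mathcal H$ has $g\restriction A\subseteq g_1$, $B\subseteq\mathrm{Dom}g_1$;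 and if $A\in I_2[k-1]$, $A\subseteq\mathrm{Rang}g$, $B\in I_2$, then some $g_1\in\mathcal H$ has $g^{-1}\restriction A\subseteq g_1^{-1}$, $B\subseteq\mathrm{Rang}g_1$. **Liftings.** A *lifting* of $(M,I,\mathcal F)$ on $(N,\bar c)$ is a pair $(G,R)$, where $N$ is transitive with $M$ as its set of urelements, the defined $c_\ell$ are in $N$, and for $f,g,f_1,f_2\in\mathcal F$: $G(f)\supseteq f$ is a partial automorphism of $N$ (for $\tau\cup\{\in\}$); $f\subseteq g\Rightarrow G(f)\subseteq G(g)$; $R\subseteq I\times N$; if $ARy$ and $A\subseteq\mathrm{Dom}f$, then $y\in\mathrm{Dom}\,G(f)$, and $f\restriction A=\mathrm{id}$ implies $G(f)(y)=y$; every $y\in N$ has some $A\in I$ with $ARy$; if $A\in I$, $A\subseteq\mathrm{Dom}f$, $y\in\mathrm{Dom}\,G(f)$, then $ARy\Leftrightarrow f''(A)\,R\,G(f)(y)$; $G(f^{-1})=G(f)^{-1}$; $G(f_2\circ f_1)\subseteq G(f_2)\circ G(f_1)$; and $G(f)(c_\ell)=c_\ell$ if $c_\ell\in\mathrm{Dom}\,G(f)$.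 **Claim.** Let $3\le k$ and $2s+1\le k$. Say that a formula *fits* $(k,s)$ if each of its subformulas has at most $k$ free variables and each subformula $|\{x:\theta(x,\bar y)\}|=z$ or $(Q_{\mathbf t}x)\theta(x,\bar y)$ has at most $s$ parameters $\bar y$. Let $\Upsilon$ be an inductive scheme, with the cardinality quantifier allowed, such that all $\psi_\ell,\varphi_\ell$ fit $(k,s)$ and each $\bar y_\ell$ has length at most $s$. 1. If $\mathcal Y=(M,I,\mathcal F)$ is a super $(\mathbf t,k,s)$-system, then for every $t$ there is a lifting of $\mathcal Y$ on $(N_t[M,\Upsilon,\mathbf t],\bar c_t[M,\Upsilon,\mathbf t])$. 2. Let $\mathcal H$ be a super $(k,s)$-witness to the equivalence of $(\mathcal Y_1,\mathbf t_1)$ and $(\mathcal Y_2,\mathbf t_2)$, and let $\chi$ be a sentence that fits $(k,s)$. Then: ($\alpha$) In each of the variants 2, 3, 4, the truth values of $\theta_{\Upsilon,\chi,\mathbf t_1}$ in $M_1$ and of $\theta_{\Upsilon,\chi,\mathbf t_2}$ in $M_2$ are equal (possibly both undefined), except possibly when for some $\ell\in\{1,2\}$ the truth value in $M_\ell$ is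 undefined, the one in $M_{3-\ell}$ is defined, and $t[M_\ell,\Upsilon,\mathbf t_\ell]<t[M_{3-\ell},\Upsilon,\mathbf t_{3-\ell}]$. ($\beta$) For every $t$, if $N_t[M_\ell,\Upsilon,\mathbf t_\ell]$ is well defined for $\ell=1,2$, or if $\mathbf t_1(\|M_1\|)=\mathbf t_2(\|M_2\|)$, then $\chi$ holds in $N_t[M_1,\Upsilon,\mathbf t_1]$ iff it holds in $N_t[M_2,\Upsilon,\mathbf t_2]$. -/

import Mathlib

namespace Choiceless

universe u v w w' w''

/-! ### Hereditarily finite sets over a set of urelements -/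

/-- Hereditarily finite sets with urelements from `M`, i.e. the union of the `V_t[M]`, where
`V_0[M] = M` and `V_{t+1}[M] = V_t[M] ∪ 𝒫(V_t[M])` (for a finite `M`). -/
abbrev HF (M : Type w) : Type w := Finsets M

namespace HF

variable {M : Type w}

/-- The urelement given by `a : M`. -/
def atom (a : M) : HF M := Quotient.mk _ (Lists.atom a)

/-- `x` is a set, i.e. not a urelement. -/
def IsSet (x : HF M) : Prop := ∀ a : M, x ≠ atom a

theorem lists_mem_congr {a a' l l' : Lists M} (ha : Lists.Equiv a a') (hl : Lists.Equiv l l') :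
    Lists.mem a l ↔ Lists.mem a' l' := by
  cases hl with
  | refl =>
    rcases l with ⟨b, l⟩
    cases b
    · exact Iff.rfl
    · exact Lists'.mem_equiv_left ha
  | antisymm h₁ h₂ =>
    exact (Lists'.mem_equiv_left ha).trans
      ⟨Lists'.mem_of_subset h₁, Lists'.mem_of_subset h₂⟩

/-- `HF.Mem a x` means `a ∈ x`; urelements have no elements. -/
def Mem (a x : HF M) : Prop :=
  Quotient.liftOn₂ a x Lists.mem fun _ _ _ _ h₁ h₂ => propext (lists_mem_congr h₁ h₂)

theorem not_mem_atom (a : HF M) (b : M) : ¬ Mem a (atom b) := by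
  induction a using Quotient.inductionOn
  exact id

theorem atom_injective : Function.Injective (atom : M → HF M) := by
  intro a b h
  have h' : Lists.Equiv (Lists.atom a) (Lists.atom b) := Quotient.exact h
  have := Lists.equiv_atom.1 h'
  simp only [Lists.atom] at this
  cases this
  rfl

theorem ext {x y : HF M} (hx : IsSet x) (hy : IsSet y) (h : ∀ a, Mem a x ↔ Mem a y) : x = y := by
  induction x using Quotient.inductionOn with | _ x
  induction y using Quotient.inductionOn with | _ y
  rcases x with ⟨_ | _, x⟩
  · cases x with | atom a => exact absurd rfl (hx a)
  rcases y with ⟨_ | _, y⟩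
  · cases y with | atom a => exact absurd rfl (hy a)
  refine Quotient.sound (Lists.Equiv.antisymm ?_ ?_)
  · refine Lists'.subset_def.2 fun a ha => ?_
    exact (h (Quotient.mk _ a)).1 ⟨a, ha, Lists.Equiv.refl a⟩
  · refine Lists'.subset_def.2 fun a ha => ?_
    exact (h (Quotient.mk _ a)).2 ⟨a, ha, Lists.Equiv.refl a⟩

/-- `x` is the set with extension `X`. -/
def IsSetOf (x : HF M) (X : Set (HF M)) : Prop := IsSet x ∧ ∀ a, Mem a x ↔ a ∈ X

/-- Every finite collection is the extension of some set. -/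
theorem exists_isSetOf {X : Set (HF M)} (hX : X.Finite) : ∃ x : HF M, IsSetOf x X := by
  refine ⟨Quotient.mk _ (Lists.ofList (hX.toFinset.toList.map Quotient.out)), ?_, ?_⟩
  · intro a h
    have h' : Lists.Equiv (Lists.ofList _) (Lists.atom a) := Quotient.exact h
    have := congrArg Sigma.fst (Lists.equiv_atom.1 h'.symm)
    exact Bool.noConfusion this
  · intro a
    induction a using Quotient.inductionOn with | _ a
    have h0 : Mem (Quotient.mk _ a) (Quotient.mk _
        (Lists.ofList (hX.toFinset.toList.map Quotient.out))) ↔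
        ∃ a' ∈ hX.toFinset.toList.map Quotient.out, Lists.Equiv a a' := by
      change (∃ a' ∈ (Lists'.ofList _).toList, Lists.Equiv a a') ↔ _
      rw [Lists'.to_ofList]
    rw [h0]
    constructor
    · rintro ⟨a', ha', e⟩
      obtain ⟨q, hq, rfl⟩ := List.mem_map.1 ha'
      have : (Quotient.mk _ a : HF M) = q := (Quotient.sound e).trans (Quotient.out_eq q)
      rw [this]
      exact hX.mem_toFinset.1 (Finset.mem_toList.1 hq)
    · intro ha
      refine ⟨Quotient.out (Quotient.mk _ a : HF M), List.mem_map.2 ⟨_, ?_, rfl⟩, ?_⟩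
      · exact Finset.mem_toList.2 (hX.mem_toFinset.2 ha)
      · exact Lists.Equiv.symm (Quotient.mk_out a)

/-- `z` is the von Neumann numeral `n = {0, …, n - 1}`. -/
def IsNumeral : ℕ → HF M → Prop
  | 0, z => IsSetOf z ∅
  | n + 1, z => ∃ p, IsNumeral n p ∧ IsSetOf z {a | Mem a p ∨ a = p}

end HF

/-! ### Formulas with the cardinality quantifier -/

/-- Formulas in the vocabulary `τ ∪ {∈} ∪ {P_ℓ : ℓ < m}`, each `P_ℓ` being a unary predicate, with
variables indexed by `ℕ`. Atomic formulas are unnested: a function symbol enters through its graph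
`F(x₁, …, xₙ) = y`, since it is interpreted by a partial function.
`cardEq x θ z` is `|{x : θ}| = z`, and `cardGT t x θ` is `(Q_t x) θ`. -/
inductive Formula (τ : FirstOrder.Language.{u, v}) (m : ℕ) : Type (max u v)
  | eq (x y : ℕ) : Formula τ m
  | mem (x y : ℕ) : Formula τ m
  | pred (i : Fin m) (x : ℕ) : Formula τ m
  | rel {n : ℕ} (R : τ.Relations n) (xs : Fin n → ℕ) : Formula τ m
  | graph {n : ℕ} (F : τ.Functions n) (xs : Fin n → ℕ) (y : ℕ) : Formula τ m
  | neg (φ : Formula τ m) : Formula τ m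
  | and (φ ψ : Formula τ m) : Formula τ m
  | ex (x : ℕ) (φ : Formula τ m) : Formula τ m
  | cardEq (x : ℕ) (θ : Formula τ m) (z : ℕ) : Formula τ m
  | cardGT (t : ℕ → ℕ∞) (x : ℕ) (θ : Formula τ m) : Formula τ m

namespace Formula

variable {τ : FirstOrder.Language.{u, v}} {m : ℕ}

def freeVars : Formula τ m → Finset ℕ
  | eq x y => {x, y}
  | mem x y => {x, y}
  | pred _ x => {x}
  | rel _ xs => Finset.univ.image xs
  | graph _ xs y => insert y (Finset.univ.image xs)
  | neg φ => φ.freeVars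
  | and φ ψ => φ.freeVars ∪ ψ.freeVars
  | ex x φ => φ.freeVars.erase x
  | cardEq x θ z => insert z (θ.freeVars.erase x)
  | cardGT _ x θ => θ.freeVars.erase x

/-- Every subformula has at most `k` free variables, and in every subformula `|{x : θ(x, ȳ)}| = z`
or `(Q_t x) θ(x, ȳ)` there are at most `s` parameters `ȳ`. -/
def Fits (k s : ℕ) : Formula τ m → Prop
  | eq x y => (eq x y : Formula τ m).freeVars.card ≤ k
  | mem x y => (mem x y : Formula τ m).freeVars.card ≤ k
  | pred i x => (pred i x : Formula τ m).freeVars.card ≤ k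
  | rel R xs => (rel R xs : Formula τ m).freeVars.card ≤ k
  | graph F xs y => (graph F xs y : Formula τ m).freeVars.card ≤ k
  | neg φ => φ.Fits k s
  | and φ ψ => φ.Fits k s ∧ ψ.Fits k s ∧ (and φ ψ).freeVars.card ≤ k
  | ex _ φ => φ.Fits k s
  | cardEq x θ z => θ.Fits k s ∧ (θ.freeVars.erase x).card ≤ s ∧ (cardEq x θ z).freeVars.card ≤ k
  | cardGT _ x θ => θ.Fits k s ∧ (θ.freeVars.erase x).card ≤ s

end Formula

/-! ### Inductive schemes and their runs -/

/-- An inductive scheme: formulas `ψ_ℓ(x; ȳ_ℓ)` for `ℓ < m₀` and `φ_ℓ(x)` for `ℓ < m₁`. The variable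
`x` is the one with index `0`, and `ȳ_ℓ` lists the other free variables of `ψ_ℓ`. -/
structure Scheme (τ : FirstOrder.Language.{u, v}) where
  m₀ : ℕ
  m₁ : ℕ
  ψ : Fin m₀ → Formula τ m₁
  φ : Fin m₁ → Formula τ m₁
  φ_freeVars : ∀ l, (φ l).freeVars ⊆ ({0} : Finset ℕ)

/-- The scheme is simple enough for systems with parameters `k` and `s`. -/
structure Scheme.Fits {τ : FirstOrder.Language.{u, v}} (Υ : Scheme τ) (k s : ℕ) : Prop where
  three_le : 3 ≤ k
  two_mul_lt : 2 * s + 1 ≤ k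
  card_params : ∀ l, ((Υ.ψ l).freeVars.erase 0).card ≤ s
  ψ_fits : ∀ l, (Υ.ψ l).Fits k s
  φ_fits : ∀ l, (Υ.φ l).Fits k s

/-- A pair `(N, c̄)`: a collection `N` of hereditarily finite sets and urelements, and `c_ℓ`, which
may be undefined, for `ℓ < m`. -/
structure State (M : Type w) (m : ℕ) where
  N : Set (HF M)
  c : Fin m → Option (HF M)

section Semantics

variable {τ : FirstOrder.Language.{u, v}} {M : Type w} [τ.Structure M] {m : ℕ}

/-- The interpretation of a relation symbol in `N`: it is the one of `M`. -/
def relHF {n : ℕ} (R : τ.Relations n) (x : Fin n → HF M) : Prop :=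
  ∃ a : Fin n → M, (∀ i, x i = HF.atom (a i)) ∧ FirstOrder.Language.Structure.RelMap R a

/-- The graph of a function symbol in `N`: it is the one of `M`. -/
def graphHF {n : ℕ} (F : τ.Functions n) (x : Fin n → HF M) (y : HF M) : Prop :=
  ∃ a : Fin n → M, (∀ i, x i = HF.atom (a i)) ∧ y = HF.atom (FirstOrder.Language.Structure.funMap F a)

/-- Satisfaction in `(N, c̄)`, where the predicate `P_ℓ` holds exactly of `c_ℓ` (if defined). -/
def State.Realize (S : State M m) : Formula τ m → (ℕ → HF M) → Prop
  | .eq x y, v => v x = v y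
  | .mem x y, v => HF.Mem (v x) (v y)
  | .pred i x, v => S.c i = some (v x)
  | .rel R xs, v => relHF R fun i => v (xs i)
  | .graph F xs y, v => graphHF F (fun i => v (xs i)) (v y)
  | .neg φ, v => ¬ S.Realize φ v
  | .and φ ψ, v => S.Realize φ v ∧ S.Realize ψ v
  | .ex x φ, v => ∃ a ∈ S.N, S.Realize φ (Function.update v x a)
  | .cardEq x θ z, v => ∃ n : ℕ,
      {a | a ∈ S.N ∧ S.Realize θ (Function.update v x a)}.encard = n ∧ HF.IsNumeral n (v z)
  | .cardGT t x θ, v =>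
      t (Nat.card M) < {a | a ∈ S.N ∧ S.Realize θ (Function.update v x a)}.encard

/-- Satisfaction of a sentence. -/
def State.Sat (S : State M m) (χ : Formula τ m) : Prop := S.Realize χ fun _ => ∅

/-- The family of all sets `{a ∈ N : (N, c̄) ⊨ ψ(a, b̄)}` with parameters `b̄` from `N`. -/
def State.family (S : State M m) (ψ : Formula τ m) : Set (HF M) :=
  {x | ∃ v : ℕ → HF M, (∀ j, v j ∈ S.N) ∧
    HF.IsSetOf x {a | a ∈ S.N ∧ S.Realize ψ (Function.update v 0 a)}}

open Classical in
/-- The successor of `(N, c̄)` with bound `b`. A family with more than `b` members is not added, and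
the new `c_ℓ` is `{a ∈ N : (N, c̄) ⊨ φ_ℓ(a)}` if this belongs to the new collection, and undefined
otherwise. -/
noncomputable def Scheme.succ (Υ : Scheme τ) (b : ℕ∞) (S : State M Υ.m₁) : State M Υ.m₁ :=
  let N' : Set (HF M) := S.N ∪ {x | ∃ l, x ∈ S.family (Υ.ψ l) ∧ (S.family (Υ.ψ l)).encard ≤ b}
  { N := N'
    c := fun l =>
      if h : ∃ x ∈ N', HF.IsSetOf x {a | a ∈ S.N ∧ S.Realize (Υ.φ l) fun _ => a}
      then some h.choose else none }

variable (M) in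
/-- `(N_t, c̄_t)` with bound `b`, beginning with `N_0 = M` and all `c_ℓ` undefined. The bound `⊤`
gives the unbounded construction `N_t[M, Υ]`, and `b = 𝐭(‖M‖)` gives `N_t[M, Υ, 𝐭]`. -/
noncomputable def Scheme.run (Υ : Scheme τ) (b : ℕ∞) : ℕ → State M Υ.m₁
  | 0 => { N := Set.range HF.atom, c := fun _ => none }
  | t + 1 => Υ.succ b (Scheme.run Υ b t)

variable (M) in
/-- No family has exceeded the bound `b` before stage `t`. -/
def Scheme.WellDefined (Υ : Scheme τ) (b : ℕ∞) (t : ℕ) : Prop :=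
  ∀ i < t, ∀ l, ((Υ.run M b i).family (Υ.ψ l)).encard ≤ b

/-! ### Stopping times and truth values -/

/-- The ways of measuring the resources used: size plus time, size only, or the sizes of the
families that are added. -/
inductive Clock
  | sizeTime
  | size
  | families

variable (M) in
/-- The resources are exhausted by the step from `N_t[M, Υ]` to `N_{t+1}[M, Υ]`. -/
def Scheme.Exhausted (Υ : Scheme τ) (b : ℕ∞) : Clock → ℕ → Prop
  | .sizeTime, t => b < (Υ.run M ⊤ (t + 1)).N.encard + (t + 1 : ℕ)
  | .size, t => b < (Υ.run M ⊤ (t + 1)).N.encard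
  | .families, t => ∃ l, b < ((Υ.run M ⊤ t).family (Υ.ψ l)).encard

variable (M) in
/-- The halting condition at stage `t`: `c_0` and `c_1` are defined and equal. -/
def Scheme.Halted (Υ : Scheme τ) (t : ℕ) : Prop :=
  ∃ (h₀ : 0 < Υ.m₁) (h₁ : 1 < Υ.m₁) (x : HF M),
    (Υ.run M ⊤ t).c ⟨0, h₀⟩ = some x ∧ (Υ.run M ⊤ t).c ⟨1, h₁⟩ = some x

variable (M) in
/-- The least `t` at which the run halts or exhausts its resources (`⊤` if there is none). -/
noncomputable def Scheme.stopTime (Υ : Scheme τ) (b : ℕ∞) (ι : Clock) : ℕ∞ :=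
  sInf {T : ℕ∞ | ∃ t : ℕ, T = t ∧ (Υ.Exhausted M b ι t ∨ Υ.Halted M t)}

open Classical in
variable (M) in
/-- The truth value of `θ_{Υ, χ, 𝐭}` in `M` for `b = 𝐭(‖M‖)`: that of `χ` at the stopping time if the
run has halted by then, and undefined (`none`) if it stopped for lack of resources or never. -/
noncomputable def Scheme.truthValue (Υ : Scheme τ) (χ : Formula τ Υ.m₁) (b : ℕ∞) (ι : Clock) :
    Option Prop :=
  if h : ∃ t : ℕ, Υ.stopTime M b ι = t ∧ Υ.Halted M t
  then some ((Υ.run M ⊤ h.choose).Sat χ) else none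

end Semantics

/-! ### Partial isomorphisms and systems -/

section Partial

variable {α : Type w} {β : Type w'}

def dom (f : α ≃. β) : Set α := {a | ∃ b, f a = some b}

def img (f : α ≃. β) (A : Set α) : Set β := {b | ∃ a ∈ A, f a = some b}

/-- `A ⊆ Dom(f)` and `f` is the identity on `A`. -/
def FixesOn (f : α ≃. α) (A : Set α) : Prop := ∀ a ∈ A, f a = some a

/-- Partial isomorphisms preserve relations and graphs of functions on their domain. -/
structure IsPartialIso (τ : FirstOrder.Language.{u, v}) {M : Type w} {M' : Type w'} [τ.Structure M]
    [τ.Structure M'] (f : M ≃. M') : Prop where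
  rel : ∀ {n : ℕ} (R : τ.Relations n) (x : Fin n → M) (y : Fin n → M'),
    (∀ i, f (x i) = some (y i)) →
      (FirstOrder.Language.Structure.RelMap R x ↔ FirstOrder.Language.Structure.RelMap R y)
  graph : ∀ {n : ℕ} (F : τ.Functions n) (x : Fin n → M) (y : Fin n → M') (a : M) (b : M'),
    (∀ i, f (x i) = some (y i)) → f a = some b →
      (FirstOrder.Language.Structure.funMap F x = a ↔ FirstOrder.Language.Structure.funMap F y = b)

end Partial

/-- `I[n]`: the unions of `n` members of `I`. -/
def unions {M : Type w} (I : Set (Set M)) (n : ℕ) : Set (Set M) :=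
  {B | ∃ A : Fin n → Set M, (∀ i, A i ∈ I) ∧ B = ⋃ i, A i}

/-- The data `(I, ℱ)` of a system `(M, I, ℱ)`. -/
structure Sys (M : Type w) where
  I : Set (Set M)
  F : Set (M ≃. M)

namespace Sys

variable {M : Type w} {M₁ : Type w'} {M₂ : Type w''}

/-- `(M, I, ℱ)` is a `k`-system. -/
structure IsSystem (τ : FirstOrder.Language.{u, v}) [τ.Structure M] (Y : Sys M) (k : ℕ) : Prop where
  subset_mem : ∀ A ∈ Y.I, ∀ B ⊆ A, B ∈ Y.I
  singleton_mem : ∀ a : M, {a} ∈ Y.I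
  nonempty : Y.F.Nonempty
  partialIso : ∀ f ∈ Y.F, IsPartialIso τ f
  img_mem : ∀ f ∈ Y.F, ∀ A ∈ Y.I, A ⊆ dom f → img f A ∈ Y.I
  symm_mem : ∀ f ∈ Y.F, f.symm ∈ Y.F
  trans_mem : ∀ f ∈ Y.F, ∀ g ∈ Y.F, f.trans g ∈ Y.F
  restrict_mem : ∀ f ∈ Y.F, ∀ g ≤ f, g ∈ Y.F
  dom_mem : ∀ f ∈ Y.F, dom f ∈ unions Y.I k
  extend : ∀ f ∈ Y.F, ∀ B ∈ unions Y.I (k - 1), B ⊆ dom f → ∀ A ∈ Y.I,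
    ∃ g ∈ Y.F, (∀ b ∈ B, g b = f b) ∧ A ⊆ dom g

/-- `H_{A,h}`: all `f ∘ h` with `f ∈ ℱ` defined on `A` and on the range of `h`, and the identity on
`A`. For `A = ∅` this is `H_h`. -/
def orbit (Y : Sys M) (A : Set M) {m : ℕ} (h : Fin m → M) : Set (Fin m → M) :=
  {h' | ∃ f ∈ Y.F, FixesOn f A ∧ ∀ i, f (h i) = some (h' i)}

/-- The equivalence relation `E` on `H_{A,h}` is invariant under the `f ∈ ℱ` that fix `A`
pointwise. -/
def Invariant (Y : Sys M) (A : Set M) {m : ℕ} (h : Fin m → M) (E : Setoid (Y.orbit A h)) : Prop :=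
  ∀ h₁ h₂ h₃ h₄ : Y.orbit A h, ∀ f ∈ Y.F, FixesOn f A →
    (∀ i, f (h₁.1 i) = some (h₃.1 i)) → (∀ i, f (h₂.1 i) = some (h₄.1 i)) →
    (E h₁ h₂ ↔ E h₃ h₄)

/-- `(M, I, ℱ)` is `(𝐭, s)`-dichotomical, where `b = 𝐭(‖M‖)`. -/
def IsDichotomical (Y : Sys M) (b : ℕ∞) (s : ℕ) : Prop :=
  ∀ (m : ℕ) (h : Fin m → M), Set.range h ∈ unions Y.I s →
    ∀ E : Setoid (Y.orbit ∅ h), Y.Invariant ∅ h E →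
      (∃ u : Set (Fin m), h '' u ∈ Y.I ∧
        ∀ h₁ h₂ : Y.orbit ∅ h, (∀ i ∈ u, h₁.1 i = h₂.1 i) → E h₁ h₂) ∨
      b < ENat.card (Quotient E)

/-- `g` maps `E₁` to `E₂` in the natural way: every `g' ∈ 𝒦` that agrees with `g` on `A₁` carries
`E₁` to `E₂` wherever it is defined. -/
def MapsEquiv (Y₁ : Sys M₁) (Y₂ : Sys M₂) (K : Set (M₁ ≃. M₂)) (g : M₁ ≃. M₂)
    {m : ℕ} {A₁ : Set M₁} {h₁ : Fin m → M₁} (E₁ : Setoid (Y₁.orbit A₁ h₁))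
    {A₂ : Set M₂} {h₂ : Fin m → M₂} (E₂ : Setoid (Y₂.orbit A₂ h₂)) : Prop :=
  ∀ g' ∈ K, (∀ a ∈ A₁, g' a = g a) →
    ∀ (x y : Y₁.orbit A₁ h₁) (x' y' : Y₂.orbit A₂ h₂),
      (∀ i, g' (x.1 i) = some (x'.1 i)) → (∀ i, g' (y.1 i) = some (y'.1 i)) →
      (E₁ x y ↔ E₂ x' y')

/-- Every `g ∈ 𝒦` preserves the number of classes of invariant equivalence relations. -/
def PreservesClasses (Y₁ : Sys M₁) (Y₂ : Sys M₂) (K : Set (M₁ ≃. M₂)) (s : ℕ) : Prop :=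
  ∀ (m : ℕ) (A₁ : Set M₁) (A₂ : Set M₂) (h₁ : Fin m → M₁) (h₂ : Fin m → M₂)
    (E₁ : Setoid (Y₁.orbit A₁ h₁)) (E₂ : Setoid (Y₂.orbit A₂ h₂)),
    A₁ ∈ unions Y₁.I s → A₂ ∈ unions Y₂.I s → Set.range h₁ ∈ Y₁.I → Set.range h₂ ∈ Y₂.I →
    Y₁.Invariant A₁ h₁ E₁ → Y₂.Invariant A₂ h₂ E₂ →
    ∀ g ∈ K, A₁ ⊆ dom g → img g A₁ = A₂ → (∀ i, g (h₁ i) = some (h₂ i)) →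
      MapsEquiv Y₁ Y₂ K g E₁ E₂ →
      ENat.card (Quotient E₁) = ENat.card (Quotient E₂)

/-- `(M, I, ℱ)` is a super `(𝐭, k, s)`-system. -/
structure IsSuper (τ : FirstOrder.Language.{u, v}) [τ.Structure M] (Y : Sys M) (t : ℕ → ℕ∞) (k s : ℕ) :
    Prop where
  system : Y.IsSystem τ k
  dichotomical : Y.IsDichotomical (t (Nat.card M)) s
  preserves : PreservesClasses Y Y Y.F s

/-- `ℋ` is a `k`-witness to the equivalence of the `k`-systems `Y₁` and `Y₂`: a back-and-forth family
of partial isomorphisms that, together with `ℱ₁` and `ℱ₂`, is closed under composition. -/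
structure IsWitness (τ : FirstOrder.Language.{u, v}) [τ.Structure M₁] [τ.Structure M₂]
    (Y₁ : Sys M₁) (Y₂ : Sys M₂) (H : Set (M₁ ≃. M₂)) (k : ℕ) : Prop where
  system₁ : Y₁.IsSystem τ k
  system₂ : Y₂.IsSystem τ k
  nonempty : H.Nonempty
  partialIso : ∀ g ∈ H, IsPartialIso τ g
  dom_mem : ∀ g ∈ H, dom g ∈ unions Y₁.I k
  ran_mem : ∀ g ∈ H, dom g.symm ∈ unions Y₂.I k
  img_mem : ∀ g ∈ H, ∀ A ⊆ dom g, (A ∈ Y₁.I ↔ img g A ∈ Y₂.I)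
  comp_left : ∀ g ∈ H, ∀ f ∈ Y₁.F, f.trans g ∈ H
  comp_right : ∀ g ∈ H, ∀ f ∈ Y₂.F, g.trans f ∈ H
  comp_symm : ∀ g ∈ H, ∀ g' ∈ H, g.trans g'.symm ∈ Y₁.F
  symm_comp : ∀ g ∈ H, ∀ g' ∈ H, g.symm.trans g' ∈ Y₂.F
  forth : ∀ g ∈ H, ∀ A ∈ unions Y₁.I (k - 1), A ⊆ dom g → ∀ B ∈ Y₁.I,
    ∃ g' ∈ H, (∀ a ∈ A, g' a = g a) ∧ B ⊆ dom g'
  back : ∀ g ∈ H, ∀ A ∈ unions Y₂.I (k - 1), A ⊆ dom g.symm → ∀ B ∈ Y₂.I,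
    ∃ g' ∈ H, (∀ a ∈ A, g'.symm a = g.symm a) ∧ B ⊆ dom g'.symm

/-- `ℋ` is a super `(k, s)`-witness to the equivalence of `(Y₁, 𝐭₁)` and `(Y₂, 𝐭₂)`. -/
structure IsSuperWitness (τ : FirstOrder.Language.{u, v}) [τ.Structure M₁] [τ.Structure M₂]
    (Y₁ : Sys M₁) (t₁ : ℕ → ℕ∞) (Y₂ : Sys M₂) (t₂ : ℕ → ℕ∞) (H : Set (M₁ ≃. M₂)) (k s : ℕ) :
    Prop where
  super₁ : Y₁.IsSuper τ t₁ k s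
  super₂ : Y₂.IsSuper τ t₂ k s
  witness : IsWitness τ Y₁ Y₂ H k
  preserves : PreservesClasses Y₁ Y₂ H s

end Sys

/-! ### Liftings -/

section Lifting

variable {M : Type w}

/-- `N` is transitive with `M` as its set of urelements, and each defined `c_ℓ` belongs to `N`. -/
structure State.IsCandidate {m : ℕ} (S : State M m) : Prop where
  transitive : ∀ y ∈ S.N, ∀ x, HF.Mem x y → x ∈ S.N
  atom_mem : ∀ a : M, HF.atom a ∈ S.N
  c_mem : ∀ l x, S.c l = some x → x ∈ S.N

/-- Partial automorphisms of `N` in the vocabulary `τ ∪ {∈}`. -/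
structure IsPartialAut (τ : FirstOrder.Language.{u, v}) [τ.Structure M] (N : Set (HF M))
    (f : HF M ≃. HF M) : Prop where
  maps : ∀ x y, f x = some y → x ∈ N ∧ y ∈ N
  mem : ∀ x x' y y', f x = some x' → f y = some y' → (HF.Mem x y ↔ HF.Mem x' y')
  rel : ∀ {n : ℕ} (R : τ.Relations n) (x y : Fin n → HF M),
    (∀ i, f (x i) = some (y i)) → (relHF R x ↔ relHF R y)
  graph : ∀ {n : ℕ} (F : τ.Functions n) (x y : Fin n → HF M) (a b : HF M),
    (∀ i, f (x i) = some (y i)) → f a = some b → (graphHF F x a ↔ graphHF F y b)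

/-- `(N, c̄, G, R)` is a lifting of `(M, I, ℱ)`; `R A y` says that `A` is a support of `y`. -/
structure IsLifting (τ : FirstOrder.Language.{u, v}) [τ.Structure M] (Y : Sys M) {m : ℕ} (S : State M m)
    (G : (M ≃. M) → (HF M ≃. HF M)) (R : Set M → HF M → Prop) : Prop where
  candidate : S.IsCandidate
  partialAut : ∀ f ∈ Y.F, IsPartialAut τ S.N (G f)
  extends_ : ∀ f ∈ Y.F, ∀ a b, f a = some b → G f (HF.atom a) = some (HF.atom b)
  mono : ∀ f ∈ Y.F, ∀ g ∈ Y.F, f ≤ g → G f ≤ G g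
  R_mem : ∀ A y, R A y → A ∈ Y.I ∧ y ∈ S.N
  defined : ∀ A y, R A y → ∀ f ∈ Y.F, A ⊆ dom f → y ∈ dom (G f)
  fixes : ∀ A y, R A y → ∀ f ∈ Y.F, FixesOn f A → G f y = some y
  exists_support : ∀ y ∈ S.N, ∃ A ∈ Y.I, R A y
  support_img : ∀ f ∈ Y.F, ∀ A ∈ Y.I, A ⊆ dom f → ∀ y y', G f y = some y' →
    (R A y ↔ R (img f A) y')
  symm_eq : ∀ f ∈ Y.F, G f.symm = (G f).symm
  trans_le : ∀ f₁ ∈ Y.F, ∀ f₂ ∈ Y.F, G (f₁.trans f₂) ≤ (G f₁).trans (G f₂)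
  c_fixed : ∀ f ∈ Y.F, ∀ l x y, S.c l = some x → G f x = some y → y = x

end Lifting

end Choiceless

namespace Choiceless

universe u v w w' w''

set_option linter.unusedSectionVars false

/-! ### Partial equivalences -/

section Partial

variable {α : Type w} {β : Type w'} {γ : Type w''}

theorem pequiv_ext {f g : α ≃. β} (h : ∀ a b, f a = some b ↔ g a = some b) : f = g :=
  PEquiv.ext fun a => Option.ext fun b => h a b

theorem symm_eq_some {f : α ≃. β} {a : α} {b : β} : f.symm b = some a ↔ f a = some b :=
  PEquiv.eq_some_iff f

theorem symm_le_symm {f g : α ≃. β} (h : f ≤ g) : f.symm ≤ g.symm := fun b a hb =>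
  symm_eq_some.2 (h a b (symm_eq_some.1 hb))

theorem pequiv_inj {f : α ≃. β} {a a' : α} {b : β} (h : f a = some b) (h' : f a' = some b) :
    a = a' := f.inj h h'

theorem pequiv_fun {f : α ≃. β} {a : α} {b b' : β} (h : f a = some b) (h' : f a = some b') :
    b = b' := Option.some.inj (h.symm.trans h')

theorem trans_eq_some {f : α ≃. β} {g : β ≃. γ} {a : α} {c : γ} :
    f.trans g a = some c ↔ ∃ b, f a = some b ∧ g b = some c := PEquiv.trans_eq_some f g a c

theorem trans_le_trans {f f' : α ≃. β} {g g' : β ≃. γ} (h : f ≤ f') (h' : g ≤ g') :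
    f.trans g ≤ f'.trans g' := by
  intro a c hc
  obtain ⟨b, h₁, h₂⟩ := trans_eq_some.1 hc
  exact trans_eq_some.2 ⟨b, h _ _ h₁, h' _ _ h₂⟩

open Classical in
/-- The restriction of a partial map. -/
noncomputable def res (f : α ≃. β) (A : Set α) : α ≃. β := (PEquiv.ofSet A).trans f

theorem res_eq_some {f : α ≃. β} {A : Set α} {a : α} {b : β} :
    res f A a = some b ↔ a ∈ A ∧ f a = some b := by
  classical
  rw [res, trans_eq_some]
  constructor
  · rintro ⟨c, h₁, h₂⟩
    rw [PEquiv.ofSet_eq_some_iff] at h₁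
    obtain ⟨rfl, h⟩ := h₁
    exact ⟨h, h₂⟩
  · rintro ⟨h₁, h₂⟩
    exact ⟨a, by rw [PEquiv.ofSet_eq_some_iff]; exact ⟨rfl, h₁⟩, h₂⟩

theorem res_le (f : α ≃. β) (A : Set α) : res f A ≤ f := fun _ _ h => (res_eq_some.1 h).2

theorem dom_res {f : α ≃. β} {A : Set α} (h : A ⊆ dom f) : dom (res f A) = A := by
  ext a
  constructor
  · rintro ⟨b, hb⟩
    exact (res_eq_some.1 hb).1
  · intro ha
    obtain ⟨b, hb⟩ := h ha
    exact ⟨b, res_eq_some.2 ⟨ha, hb⟩⟩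

theorem dom_mono {f g : α ≃. β} (h : f ≤ g) : dom f ⊆ dom g := fun _ ⟨b, hb⟩ => ⟨b, h _ _ hb⟩

theorem le_res {p f : α ≃. β} {A : Set α} (h : p ≤ f) (hA : dom p ⊆ A) : p ≤ res f A :=
  fun _ _ hb => res_eq_some.2 ⟨hA ⟨_, hb⟩, h _ _ hb⟩

theorem le_of_agree {p f : α ≃. β} (h : ∀ a ∈ dom p, f a = p a) : p ≤ f := fun a b hb =>
  (h a ⟨b, hb⟩).trans hb

theorem eq_of_le_of_dom {p q g : α ≃. β} (hp : p ≤ g) (hq : q ≤ g) (h : dom p = dom q) :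
    p = q := by
  refine pequiv_ext fun a b => ⟨fun hb => ?_, fun hb => ?_⟩
  · obtain ⟨b', hb'⟩ := h.subset ⟨b, hb⟩
    rw [pequiv_fun (hp _ _ hb) (hq _ _ hb'), hb']
  · obtain ⟨b', hb'⟩ := h.superset ⟨b, hb⟩
    rw [pequiv_fun (hq _ _ hb) (hp _ _ hb'), hb']

theorem img_dom (f : α ≃. β) : img f (dom f) = dom f.symm := by
  ext b
  constructor
  · rintro ⟨a, -, h⟩
    exact ⟨a, symm_eq_some.2 h⟩
  · rintro ⟨a, h⟩
    exact ⟨a, ⟨b, symm_eq_some.1 h⟩, symm_eq_some.1 h⟩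

theorem img_symm_img {f : α ≃. β} {A : Set α} (h : A ⊆ dom f) : img f.symm (img f A) = A := by
  ext a
  constructor
  · rintro ⟨b, ⟨a', ha', hb⟩, h'⟩
    rwa [pequiv_inj (symm_eq_some.1 h') hb]
  · intro ha
    obtain ⟨b, hb⟩ := h ha
    exact ⟨b, ⟨a, ha, hb⟩, symm_eq_some.2 hb⟩

theorem img_subset_dom_symm (f : α ≃. β) (A : Set α) : img f A ⊆ dom f.symm :=
  fun _ ⟨a, _, h⟩ => ⟨a, symm_eq_some.2 h⟩

theorem dom_res_symm (f : α ≃. β) (A : Set α) : dom (res f A).symm = img f A := by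
  ext b
  constructor
  · rintro ⟨a, ha⟩
    have := res_eq_some.1 (symm_eq_some.1 ha)
    exact ⟨a, this⟩
  · rintro ⟨a, ha⟩
    exact ⟨a, symm_eq_some.2 (res_eq_some.2 ha)⟩

/-- `r ∘ q⁻¹ ∘ p`. -/
def zig (p q r : α ≃. β) : α ≃. β := p.trans (q.symm.trans r)

theorem zig_eq_some {p q r : α ≃. β} {a : α} {c : β} :
    zig p q r a = some c ↔ ∃ b a', p a = some b ∧ q a' = some b ∧ r a' = some c := by
  simp only [zig, trans_eq_some, symm_eq_some]
  constructor
  · rintro ⟨b, h₁, a', h₂, h₃⟩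
    exact ⟨b, a', h₁, h₂, h₃⟩
  · rintro ⟨b, a', h₁, h₂, h₃⟩
    exact ⟨b, h₁, a', h₂, h₃⟩

theorem zig_symm (p q r : α ≃. β) : (zig p q r).symm = zig r.symm q.symm p.symm := by
  refine pequiv_ext fun b a => ?_
  rw [symm_eq_some, zig_eq_some, zig_eq_some]
  constructor
  · rintro ⟨b, a', h₁, h₂, h₃⟩
    exact ⟨a', b, symm_eq_some.2 h₃, symm_eq_some.2 h₂, symm_eq_some.2 h₁⟩
  · rintro ⟨b, a', h₁, h₂, h₃⟩
    exact ⟨a', b, symm_eq_some.1 h₃, symm_eq_some.1 h₂, symm_eq_some.1 h₁⟩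

theorem zig_mono {p q r p' q' r' : α ≃. β} (hp : p ≤ p') (hq : q ≤ q') (hr : r ≤ r') :
    zig p q r ≤ zig p' q' r' :=
  trans_le_trans hp (trans_le_trans (symm_le_symm hq) hr)

theorem dom_zig {p q r : α ≃. β} (h : dom p.symm = dom q.symm) (h' : dom q = dom r) :
    dom (zig p q r) = dom p := by
  ext a
  constructor
  · rintro ⟨c, hc⟩
    obtain ⟨b, a', h₁, -⟩ := zig_eq_some.1 hc
    exact ⟨b, h₁⟩
  · rintro ⟨b, hb⟩
    obtain ⟨a', ha'⟩ := h.subset ⟨a, symm_eq_some.2 hb⟩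
    obtain ⟨c, hc⟩ := h'.subset ⟨b, symm_eq_some.1 ha'⟩
    exact ⟨c, zig_eq_some.2 ⟨b, a', hb, symm_eq_some.1 ha', hc⟩⟩

theorem dom_zig_symm {p q r : α ≃. β} (h : dom p.symm = dom q.symm) (h' : dom q = dom r) :
    dom (zig p q r).symm = dom r.symm := by
  rw [zig_symm]
  exact dom_zig h'.symm h.symm

/-- `(p q⁻¹) (q p⁻¹) e = e`. -/
theorem zig_zig {p q e : α ≃. β} (h : dom p.symm = dom q.symm) (h' : dom e ⊆ dom p) :
    zig p q (zig q p e) = e := by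
  refine pequiv_ext fun a c => ⟨fun hc => ?_, fun hc => ?_⟩
  · obtain ⟨b, a', h₁, h₂, h₃⟩ := zig_eq_some.1 hc
    obtain ⟨b', a'', h₄, h₅, h₆⟩ := zig_eq_some.1 h₃
    obtain rfl := pequiv_fun h₂ h₄
    rwa [pequiv_inj h₁ h₅]
  · obtain ⟨b, hb⟩ := h' ⟨c, hc⟩
    obtain ⟨a', ha'⟩ := h.subset ⟨a, symm_eq_some.2 hb⟩
    exact zig_eq_some.2 ⟨b, a', hb, symm_eq_some.1 ha', zig_eq_some.2
      ⟨b, a, symm_eq_some.1 ha', hb, hc⟩⟩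

end Partial

/-! ### Unions of members of a family -/

section Unions

variable {M : Type w} {I : Set (Set M)}

theorem unions_zero : unions I 0 = {∅} := by
  ext B
  simp only [unions, Set.mem_ofPred_eq, Set.mem_singleton_iff]
  constructor
  · rintro ⟨A, -, rfl⟩
    simp
  · rintro rfl
    exact ⟨fun i => i.elim0, fun i => i.elim0, by simp⟩

theorem mem_unions_succ {n : ℕ} {B : Set M} :
    B ∈ unions I (n + 1) ↔ ∃ A ∈ unions I n, ∃ C ∈ I, B = A ∪ C := by
  constructor
  · rintro ⟨A, hA, rfl⟩
    refine ⟨⋃ i : Fin n, A i.castSucc, ⟨_, fun i => hA _, rfl⟩, A (Fin.last n), hA _, ?_⟩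
    ext a
    simp only [Set.mem_iUnion, Set.mem_union]
    constructor
    · rintro ⟨i, hi⟩
      rcases Fin.eq_castSucc_or_eq_last i with ⟨j, rfl⟩ | rfl
      · exact Or.inl ⟨j, hi⟩
      · exact Or.inr hi
    · rintro (⟨j, hj⟩ | h)
      · exact ⟨_, hj⟩
      · exact ⟨_, h⟩
  · rintro ⟨_, ⟨A, hA, rfl⟩, C, hC, rfl⟩
    refine ⟨Fin.snoc A C, fun i => ?_, ?_⟩
    · rcases Fin.eq_castSucc_or_eq_last i with ⟨j, rfl⟩ | rfl
      · simpa using hA j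
      · simpa using hC
    · ext a
      simp only [Set.mem_iUnion, Set.mem_union]
      constructor
      · rintro (⟨j, hj⟩ | h)
        · exact ⟨j.castSucc, by simpa using hj⟩
        · exact ⟨Fin.last n, by simpa using h⟩
      · rintro ⟨i, hi⟩
        rcases Fin.eq_castSucc_or_eq_last i with ⟨j, rfl⟩ | rfl
        · exact Or.inl ⟨j, by simpa using hi⟩
        · exact Or.inr (by simpa using hi)

theorem mem_unions_one {A : Set M} : A ∈ unions I 1 ↔ A ∈ I := by
  rw [mem_unions_succ, unions_zero]
  simp

theorem unions_mono (h0 : ∅ ∈ I) {m n : ℕ} (h : m ≤ n) : unions I m ⊆ unions I n := by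
  induction n, h using Nat.le_induction with
  | base => exact subset_rfl
  | succ n _ ih => exact fun A hA => mem_unions_succ.2 ⟨A, ih hA, ∅, h0, by simp⟩

theorem union_mem_unions {m n : ℕ} {A B : Set M} (hA : A ∈ unions I m) (hB : B ∈ unions I n) :
    A ∪ B ∈ unions I (m + n) := by
  induction n generalizing B with
  | zero =>
    rw [unions_zero] at hB
    obtain rfl := hB
    simpa using hA
  | succ n ih =>
    obtain ⟨D, hD, C, hC, rfl⟩ := mem_unions_succ.1 hB
    exact mem_unions_succ.2 ⟨_, ih hD, C, hC, by rw [Set.union_assoc]⟩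

/-- Used to combine the supports of the parameters of a formula, `n` being a bound on their number.
-/
theorem biUnion_mem_unions (h0 : ∅ ∈ I) (J : Finset ℕ) {C : ℕ → Set M} (hC : ∀ j ∈ J, C j ∈ I)
    {n : ℕ} (hn : J.card ≤ n) : (⋃ j ∈ J, C j) ∈ unions I n := by
  refine unions_mono h0 hn ?_
  clear hn
  induction J using Finset.induction_on with
  | empty => simp [unions_zero]
  | insert a J ha ih =>
    rw [Finset.card_insert_of_notMem ha, Finset.set_biUnion_insert, Set.union_comm]
    exact mem_unions_succ.2 ⟨_, ih fun j hj => hC j (Finset.mem_insert_of_mem hj), _,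
      hC a (Finset.mem_insert_self _ _), rfl⟩

end Unions

/-! ### Elements of hereditarily finite sets -/

namespace HF

variable {M : Type w}

theorem finite_mem (x : HF M) : {a | Mem a x}.Finite := by
  induction x using Quotient.inductionOn with | _ x
  rcases x with ⟨_ | _, l⟩
  · refine Set.finite_empty.subset fun a ha => ?_
    induction a using Quotient.inductionOn with | _ a
    exact ha
  · refine ((l.toList.map fun a => (Quotient.mk _ a : HF M)).finite_toSet).subset fun a ha => ?_
    induction a using Quotient.inductionOn with | _ a
    obtain ⟨a', ha', e⟩ := ha
    exact List.mem_map.2 ⟨a', ha', (Quotient.sound e).symm⟩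

theorem IsSetOf.unique {x y : HF M} {X : Set (HF M)} (hx : IsSetOf x X) (hy : IsSetOf y X) :
    x = y := HF.ext hx.1 hy.1 fun a => (hx.2 a).trans (hy.2 a).symm

theorem not_isSet_atom (a : M) : ¬ IsSet (atom a) := fun h => h a rfl

end HF

/-! ### Links between two families of supports -/

/-- A family `K` of partial maps between two sets with supports, closed under `r ∘ q⁻¹ ∘ p`, with the
back-and-forth property. -/
structure Link (M₁ : Type w) (M₂ : Type w') where
  I₁ : Set (Set M₁)
  I₂ : Set (Set M₂)
  K : Set (M₁ ≃. M₂)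
  k : ℕ
  s : ℕ
  one_le : 1 ≤ s
  two_mul_lt : 2 * s + 1 ≤ k
  down₁ : ∀ A ∈ I₁, ∀ B ⊆ A, B ∈ I₁
  down₂ : ∀ A ∈ I₂, ∀ B ⊆ A, B ∈ I₂
  empty₁ : ∅ ∈ I₁
  empty₂ : ∅ ∈ I₂
  singleton₁ : ∀ a, {a} ∈ I₁
  singleton₂ : ∀ a, {a} ∈ I₂
  nonempty : K.Nonempty
  restrict : ∀ p ∈ K, ∀ q ≤ p, q ∈ K
  zig_mem : ∀ p ∈ K, ∀ q ∈ K, ∀ r ∈ K, zig p q r ∈ K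
  img_iff : ∀ p ∈ K, ∀ A ⊆ dom p, (A ∈ I₁ ↔ img p A ∈ I₂)
  forth : ∀ p ∈ K, ∀ A ∈ unions I₁ (k - 1), A ⊆ dom p → ∀ B ∈ I₁,
    ∃ g ∈ K, (∀ a ∈ A, g a = p a) ∧ B ⊆ dom g
  back : ∀ p ∈ K, ∀ A ∈ unions I₂ (k - 1), A ⊆ dom p.symm → ∀ B ∈ I₂,
    ∃ g ∈ K, (∀ a ∈ A, g.symm a = p.symm a) ∧ B ⊆ dom g.symm

namespace Link

variable {M₁ : Type w} {M₂ : Type w'} (L : Link M₁ M₂)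

/-- The inverse link. -/
def flip : Link M₂ M₁ where
  I₁ := L.I₂
  I₂ := L.I₁
  K := {p | p.symm ∈ L.K}
  k := L.k
  s := L.s
  one_le := L.one_le
  two_mul_lt := L.two_mul_lt
  down₁ := L.down₂
  down₂ := L.down₁
  empty₁ := L.empty₂
  empty₂ := L.empty₁
  singleton₁ := L.singleton₂
  singleton₂ := L.singleton₁
  nonempty := by
    obtain ⟨p, hp⟩ := L.nonempty
    exact ⟨p.symm, by simpa using hp⟩
  restrict p hp q hq := L.restrict _ hp _ (symm_le_symm hq)
  zig_mem p hp q hq r hr := by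
    change (zig p q r).symm ∈ L.K
    rw [zig_symm]
    exact L.zig_mem _ hr _ hq _ hp
  img_iff p hp A hA := by
    rw [L.img_iff _ hp _ (img_subset_dom_symm p A), img_symm_img hA]
  forth p hp A hA h B hB := by
    obtain ⟨g, hg, h₁, h₂⟩ := L.back _ hp A hA (by simpa using h) B hB
    exact ⟨g.symm, by simpa using hg, by simpa using h₁, h₂⟩
  back p hp A hA h B hB := by
    obtain ⟨g, hg, h₁, h₂⟩ := L.forth _ hp A hA h B hB
    exact ⟨g.symm, by simpa using hg, by simpa using h₁, by simpa using h₂⟩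

@[simp] theorem flip_flip : L.flip.flip = L := by
  cases L
  simp [flip]

variable {L}

theorem symm_mem_flip {p : M₁ ≃. M₂} : p.symm ∈ L.flip.K ↔ p ∈ L.K := by
  change p.symm.symm ∈ L.K ↔ _
  rw [PEquiv.symm_symm]

variable (L) in
/-- `p` and `q` have a common extension in `K`. -/
def Comp (p q : M₁ ≃. M₂) : Prop := ∃ g ∈ L.K, p ≤ g ∧ q ≤ g

theorem Comp.symm {p q : M₁ ≃. M₂} (h : L.Comp p q) : L.Comp q p :=
  let ⟨g, hg, h₁, h₂⟩ := h
  ⟨g, hg, h₂, h₁⟩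

theorem comp_self {p : M₁ ≃. M₂} (h : p ∈ L.K) : L.Comp p p := ⟨p, h, le_rfl, le_rfl⟩

theorem comp_flip {p q : M₁ ≃. M₂} : L.flip.Comp p.symm q.symm ↔ L.Comp p q := by
  constructor
  · rintro ⟨g, hg, h₁, h₂⟩
    exact ⟨g.symm, hg, by simpa using symm_le_symm h₁, by simpa using symm_le_symm h₂⟩
  · rintro ⟨g, hg, h₁, h₂⟩
    exact ⟨g.symm, symm_mem_flip.2 hg, symm_le_symm h₁, symm_le_symm h₂⟩

theorem dom_mem_iff {p : M₁ ≃. M₂} (hp : p ∈ L.K) : dom p ∈ L.I₁ ↔ dom p.symm ∈ L.I₂ := by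
  rw [L.img_iff p hp _ subset_rfl, img_dom]

theorem dom_symm_mem_unions {p : M₁ ≃. M₂} (hp : p ∈ L.K) {n : ℕ} (h : dom p ∈ unions L.I₁ n) :
    dom p.symm ∈ unions L.I₂ n := by
  obtain ⟨A, hA, h⟩ := h
  refine ⟨fun i => img p (A i), fun i => (L.img_iff p hp _ ?_).1 (hA i), ?_⟩
  · rw [h]
    exact Set.subset_iUnion A i
  · rw [← img_dom, h]
    ext b
    simp only [img, Set.mem_iUnion, Set.mem_ofPred_eq]
    constructor
    · rintro ⟨a, ⟨i, hi⟩, hb⟩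
      exact ⟨i, a, hi, hb⟩
    · rintro ⟨i, a, hi, hb⟩
      exact ⟨a, ⟨i, hi⟩, hb⟩

theorem dom_mem_unions_iff {p : M₁ ≃. M₂} (hp : p ∈ L.K) {n : ℕ} :
    dom p.symm ∈ unions L.I₂ n ↔ dom p ∈ unions L.I₁ n := by
  refine ⟨fun h => ?_, dom_symm_mem_unions hp⟩
  exact dom_symm_mem_unions (L := L.flip) (p := p.symm) (symm_mem_flip.2 hp) h

/-- Extension of `p` to a union of `j` supports. -/
theorem exists_ext {p g : M₁ ≃. M₂} (hg : g ∈ L.K) (hpg : p ≤ g) {i j : ℕ}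
    (hp : dom p ∈ unions L.I₁ i)
    {B : Set M₁} (hB : B ∈ unions L.I₁ j) (hij : i + j ≤ L.k) :
    ∃ g ∈ L.K, p ≤ g ∧ B ⊆ dom g := by
  induction j generalizing B with
  | zero =>
    rw [unions_zero] at hB
    obtain rfl := hB
    exact ⟨g, hg, hpg, Set.empty_subset _⟩
  | succ j ih =>
    obtain ⟨C, hC, D, hD, rfl⟩ := mem_unions_succ.1 hB
    obtain ⟨g₁, hg₁, h₁, h₂⟩ := ih hC (by omega)
    -- Extension steps preserve only unions of `k - 1` supports; `dom p ∪ C` is one because the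
    -- further support `D` still fits within `k`.
    obtain ⟨g₂, hg₂, h₃, h₄⟩ := L.forth g₁ hg₁ (dom p ∪ C)
      (unions_mono L.empty₁ (by omega) (union_mem_unions hp hC))
      (Set.union_subset (dom_mono h₁) h₂) D hD
    have hle : res g₁ (dom p ∪ C) ≤ g₂ := by
      refine le_of_agree fun a ha => ?_
      rw [dom_res (Set.union_subset (dom_mono h₁) h₂)] at ha
      obtain ⟨b, hb⟩ := Set.union_subset (dom_mono h₁) h₂ ha
      rw [h₃ a ha, hb, res_eq_some.2 ⟨ha, hb⟩]
    have h₅ : dom p ∪ C ⊆ dom g₂ := by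
      rw [← dom_res (Set.union_subset (dom_mono h₁) h₂)]
      exact dom_mono hle
    exact ⟨g₂, hg₂, (le_res h₁ Set.subset_union_left).trans hle,
      Set.union_subset (Set.subset_union_right.trans h₅) h₄⟩

theorem exists_ext_symm {p g : M₁ ≃. M₂} (hg : g ∈ L.K) (hpg : p ≤ g) {i j : ℕ}
    (hp : dom p ∈ unions L.I₁ i)
    {B : Set M₂} (hB : B ∈ unions L.I₂ j) (hij : i + j ≤ L.k) :
    ∃ g ∈ L.K, p ≤ g ∧ B ⊆ dom g.symm := by
  obtain ⟨g', hg', h, h'⟩ := exists_ext (L := L.flip) (symm_mem_flip.2 hg) (symm_le_symm hpg)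
    (dom_symm_mem_unions (L.restrict g hg _ hpg) hp) hB hij
  exact ⟨g'.symm, hg', by simpa using symm_le_symm h, by simpa using h'⟩

theorem exists_dom_eq {B : Set M₁} (hB : B ∈ unions L.I₁ L.k) : ∃ p ∈ L.K, dom p = B := by
  obtain ⟨g, hg⟩ := L.nonempty
  obtain ⟨g', hg', -, h⟩ := exists_ext hg (res_le g ∅) (i := 0)
    (by rw [dom_res (Set.empty_subset _), unions_zero]; rfl) hB (by omega)
  exact ⟨res g' B, L.restrict _ hg' _ (res_le _ _), dom_res h⟩

/-- `p, q` and a new map with prescribed domain have a common extension. -/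
theorem exists_comp {p q : M₁ ≃. M₂} (h : L.Comp p q) (hp : dom p ∈ unions L.I₁ L.s)
    (hq : dom q ∈ unions L.I₁ L.s) {C : Set M₁} (hC : C ∈ L.I₁) :
    ∃ r ∈ L.K, dom r = C ∧ L.Comp p r ∧ L.Comp q r := by
  obtain ⟨g, hg, h₁, h₂⟩ := h
  have hd : dom p ∪ dom q ⊆ dom g := Set.union_subset (dom_mono h₁) (dom_mono h₂)
  -- Here `2 * s + 1 ≤ k` is used: two wide supports are kept while a narrow one is added.
  obtain ⟨g', hg', h₃, h₄⟩ := exists_ext hg (res_le g (dom p ∪ dom q)) (i := L.s + L.s)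
    (by rw [dom_res hd]; exact union_mem_unions hp hq) (mem_unions_one.2 hC)
    (by have := L.two_mul_lt; omega)
  have hp' := (le_res h₁ Set.subset_union_left).trans h₃
  have hq' := (le_res h₂ Set.subset_union_right).trans h₃
  exact ⟨res g' C, L.restrict _ hg' _ (res_le _ _), dom_res h₄, ⟨g', hg', hp', res_le _ _⟩,
    ⟨g', hg', hq', res_le _ _⟩⟩

theorem exists_comp_symm {p q : M₁ ≃. M₂} (h : L.Comp p q) (hp : dom p ∈ unions L.I₁ L.s)
    (hq : dom q ∈ unions L.I₁ L.s) {C : Set M₂} (hC : C ∈ L.I₂) :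
    ∃ r ∈ L.K, dom r.symm = C ∧ L.Comp p r ∧ L.Comp q r := by
  have hpK : p ∈ L.K := let ⟨g, hg, h₁, _⟩ := h; L.restrict g hg _ h₁
  have hqK : q ∈ L.K := let ⟨g, hg, _, h₁⟩ := h; L.restrict g hg _ h₁
  obtain ⟨r, hr, h₁, h₂, h₃⟩ := exists_comp (L := L.flip) (comp_flip.2 h)
    (dom_symm_mem_unions hpK hp) (dom_symm_mem_unions hqK hq) hC
  rw [← PEquiv.symm_symm r, comp_flip] at h₂ h₃
  exact ⟨r.symm, hr, by simpa using h₁, h₂, h₃⟩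

/-- A member of `K` whose domain is a support in the wide sense. -/
structure Wide (L : Link M₁ M₂) (p : M₁ ≃. M₂) : Prop where
  mem : p ∈ L.K
  dom_mem : dom p ∈ unions L.I₁ L.s

theorem Wide.flip {p : M₁ ≃. M₂} (h : L.Wide p) : L.flip.Wide p.symm :=
  ⟨symm_mem_flip.2 h.1, dom_symm_mem_unions h.1 h.2⟩

theorem wide_of_narrow {p : M₁ ≃. M₂} (h : p ∈ L.K) (h' : dom p ∈ L.I₁) : L.Wide p :=
  ⟨h, unions_mono L.empty₁ L.one_le (mem_unions_one.2 h')⟩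

/-! ### The action on hereditarily finite sets: uniqueness, existence and composition of images. -/

/-- The action of `K` on hereditarily finite sets: `p`, whose domain supports `x`, maps `x` to `y`;
the elements are supported by members of `I`. The number bounds the rank. -/
def Sim (L : Link M₁ M₂) : ℕ → (M₁ ≃. M₂) → HF M₁ → HF M₂ → Prop
  | 0, _, _, _ => False
  | n + 1, p, x, y => L.Wide p ∧
    ((∃ a b, x = HF.atom a ∧ y = HF.atom b ∧ p a = some b) ∨
      (HF.IsSet x ∧ HF.IsSet y ∧
        (∀ a, HF.Mem a x → ∃ C ∈ L.I₁, ∀ q ∈ L.K, dom q = C → L.Comp p q →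
          ∃ b, HF.Mem b y ∧ Sim L n q a b) ∧
        (∀ b, HF.Mem b y → ∃ C ∈ L.I₂, ∀ q ∈ L.K, dom q.symm = C → L.Comp p q →
          ∃ a, HF.Mem a x ∧ Sim L n q a b)))

theorem Sim.wide {n : ℕ} {p : M₁ ≃. M₂} {x : HF M₁} {y : HF M₂} (h : L.Sim n p x y) :
    L.Wide p := by
  cases n with
  | zero => exact h.elim
  | succ n => exact h.1

theorem Sim.flip {n : ℕ} {p : M₁ ≃. M₂} {x : HF M₁} {y : HF M₂} (h : L.Sim n p x y) :
    L.flip.Sim n p.symm y x := by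
  induction n generalizing p x y with
  | zero => exact h.elim
  | succ n ih =>
    refine ⟨h.1.flip, ?_⟩
    rcases h.2 with ⟨a, b, rfl, rfl, hab⟩ | ⟨hx, hy, h₁, h₂⟩
    · exact Or.inl ⟨b, a, rfl, rfl, symm_eq_some.2 hab⟩
    · refine Or.inr ⟨hy, hx, fun b hb => ?_, fun a ha => ?_⟩
      · obtain ⟨C, hC, h⟩ := h₂ b hb
        refine ⟨C, hC, fun q hq hqC hpq => ?_⟩
        obtain ⟨a, ha, has⟩ := h q.symm hq (by simpa using hqC)
          (comp_flip.1 (by simpa using hpq))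
        exact ⟨a, ha, by simpa using ih has⟩
      · obtain ⟨C, hC, h⟩ := h₁ a ha
        refine ⟨C, hC, fun q hq hqC hpq => ?_⟩
        obtain ⟨b, hb, has⟩ := h q.symm hq hqC (comp_flip.1 (by simpa using hpq))
        exact ⟨b, hb, by simpa using ih has⟩

theorem sim_flip {n : ℕ} {p : M₁ ≃. M₂} {x : HF M₁} {y : HF M₂} :
    L.flip.Sim n p.symm y x ↔ L.Sim n p x y :=
  ⟨fun h => by simpa using h.flip, Sim.flip⟩

theorem Sim.unflip {n : ℕ} {p : M₂ ≃. M₁} {x : HF M₁} {y : HF M₂} (h : L.flip.Sim n p y x) :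
    L.Sim n p.symm x y := by simpa using h.flip

theorem Sim.isSet_iff {n : ℕ} {p : M₁ ≃. M₂} {x : HF M₁} {y : HF M₂} (h : L.Sim n p x y) :
    HF.IsSet x ↔ HF.IsSet y := by
  cases n with
  | zero => exact h.elim
  | succ n =>
    rcases h.2 with ⟨a, b, rfl, rfl, -⟩ | ⟨hx, hy, -⟩
    · exact iff_of_false (HF.not_isSet_atom a) (HF.not_isSet_atom b)
    · exact iff_of_true hx hy

theorem Sim.exists_atom {n : ℕ} {p : M₁ ≃. M₂} {a : M₁} {y : HF M₂}
    (h : L.Sim n p (HF.atom a) y) : ∃ b, y = HF.atom b ∧ p a = some b := by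
  cases n with
  | zero => exact h.elim
  | succ n =>
    rcases h.2 with ⟨a', b, ha, rfl, hp⟩ | ⟨hx, -⟩
    · rw [HF.atom_injective ha]
      exact ⟨b, rfl, hp⟩
    · exact absurd hx (HF.not_isSet_atom a)

theorem Sim.succ {n : ℕ} {p : M₁ ≃. M₂} {x : HF M₁} {y : HF M₂} (h : L.Sim n p x y) :
    L.Sim (n + 1) p x y := by
  induction n generalizing p x y with
  | zero => exact h.elim
  | succ n ih =>
    refine ⟨h.1, ?_⟩
    rcases h.2 with h | ⟨hx, hy, h₁, h₂⟩
    · exact Or.inl h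
    · refine Or.inr ⟨hx, hy, fun a ha => ?_, fun b hb => ?_⟩
      · obtain ⟨C, hC, h⟩ := h₁ a ha
        refine ⟨C, hC, fun q hq hqC hpq => ?_⟩
        obtain ⟨b, hb, has⟩ := h q hq hqC hpq
        exact ⟨b, hb, ih has⟩
      · obtain ⟨C, hC, h⟩ := h₂ b hb
        refine ⟨C, hC, fun q hq hqC hpq => ?_⟩
        obtain ⟨a, ha, has⟩ := h q hq hqC hpq
        exact ⟨a, ha, ih has⟩

/-- Uniqueness of images at level `n`. -/
def Uniq (L : Link M₁ M₂) (n : ℕ) : Prop := ∀ {p q x y y'}, L.Sim n p x y → L.Sim n q x y' →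
  L.Comp p q → y = y'

/-- The support that `x` offers for `a` need not be related to `q`. A third map `r` with this
domain, compatible with both `p` and `q`, sends `a` into `y`, and uniqueness at level `n` shows that
`q` sends `a` to the same place. -/
theorem mem_of_uniq {n : ℕ} (hu : L.Uniq n) {p q : M₁ ≃. M₂} {x a : HF M₁} {y b : HF M₂}
    (h : L.Sim (n + 1) p x y) (h' : L.Sim n q a b) (hpq : L.Comp p q) (ha : HF.Mem a x) :
    HF.Mem b y := by
  rcases h.2 with ⟨c, d, rfl, rfl, -⟩ | ⟨-, -, h₁, -⟩
  · exact absurd ha (HF.not_mem_atom _ _)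
  · obtain ⟨C, hC, h₃⟩ := h₁ a ha
    obtain ⟨r, hr, hrC, hpr, hqr⟩ := exists_comp hpq h.1.2 h'.wide.2 hC
    obtain ⟨b', hb', h₄⟩ := h₃ r hr hrC hpr
    rwa [hu h' h₄ hqr]

/-- An element of `y` is pulled back into `x` by a map compatible with both `p` and `q`, and then
pushed forward along `q`. -/
theorem uniq_aux {n : ℕ} (hu : L.Uniq n) {p q : M₁ ≃. M₂} {x : HF M₁} {y y' : HF M₂}
    (h : L.Sim (n + 1) p x y) (h' : L.Sim (n + 1) q x y') (hpq : L.Comp p q) {b : HF M₂}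
    (hb : HF.Mem b y) : HF.Mem b y' := by
  rcases h.2 with ⟨c, d, rfl, rfl, -⟩ | ⟨-, -, -, h₁⟩
  · exact absurd hb (HF.not_mem_atom _ _)
  · obtain ⟨C, hC, h₃⟩ := h₁ b hb
    obtain ⟨r, hr, hrC, hpr, hqr⟩ := exists_comp_symm hpq h.1.2 h'.1.2 hC
    obtain ⟨a, ha, h₄⟩ := h₃ r hr hrC hpr
    exact mem_of_uniq hu h' h₄ hqr ha

theorem uniq (n : ℕ) : L.Uniq n := by
  induction n with
  | zero => exact fun h => h.elim
  | succ n ih =>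
    intro p q x y y' h h' hpq
    by_cases hx : HF.IsSet x
    · exact HF.ext (h.isSet_iff.1 hx) (h'.isSet_iff.1 hx) fun b =>
        ⟨uniq_aux ih h h' hpq, uniq_aux ih h' h hpq.symm⟩
    · simp only [HF.IsSet, not_forall, not_not] at hx
      obtain ⟨a, rfl⟩ := hx
      obtain ⟨b, rfl, hb⟩ := h.exists_atom
      obtain ⟨b', rfl, hb'⟩ := h'.exists_atom
      obtain ⟨g, -, h₁, h₂⟩ := hpq
      rw [pequiv_fun (h₁ _ _ hb) (h₂ _ _ hb')]

theorem Sim.unique {n : ℕ} {p q : M₁ ≃. M₂} {x : HF M₁} {y y' : HF M₂} (h : L.Sim n p x y)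
    (h' : L.Sim n q x y') (hpq : L.Comp p q) : y = y' := uniq n h h' hpq

theorem Sim.injective {n : ℕ} {p q : M₁ ≃. M₂} {x x' : HF M₁} {y : HF M₂} (h : L.Sim n p x y)
    (h' : L.Sim n q x' y) (hpq : L.Comp p q) : x = x' :=
  h.flip.unique h'.flip (comp_flip.2 hpq)

/-- The set may be one level above the element, as happens when a set at level `n + 1` is unfolded.
-/
theorem Sim.mem_iff' {n : ℕ} {p q : M₁ ≃. M₂} {x a : HF M₁} {y b : HF M₂}
    (h : L.Sim (n + 1) p x y) (h' : L.Sim n q a b) (hpq : L.Comp p q) :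
    HF.Mem a x ↔ HF.Mem b y :=
  ⟨mem_of_uniq (uniq n) h h' hpq, mem_of_uniq (uniq n) h.flip h'.flip (comp_flip.2 hpq)⟩

theorem Sim.mem_iff {n : ℕ} {p q : M₁ ≃. M₂} {x a : HF M₁} {y b : HF M₂}
    (h : L.Sim n p x y) (h' : L.Sim n q a b) (hpq : L.Comp p q) : HF.Mem a x ↔ HF.Mem b y :=
  h.succ.mem_iff' h' hpq

/-- This makes the collection of images the extension of an actual set: `x` has finitely many
elements, there are finitely many maps, and each map gives at most one image. -/
theorem finite_images [Finite M₁] [Finite M₂] (n : ℕ) (x : HF M₁) :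
    {b | ∃ a, HF.Mem a x ∧ ∃ q, L.Sim n q a b}.Finite := by
  have : Finite (M₁ ≃. M₂) := Finite.of_injective (fun f : M₁ ≃. M₂ => (f : M₁ → Option M₂))
    DFunLike.coe_injective
  have h : {b | ∃ a, HF.Mem a x ∧ ∃ q, L.Sim n q a b} =
      ⋃ a ∈ {a | HF.Mem a x}, ⋃ q, {b | L.Sim n q a b} := by
    ext b
    simp
  rw [h]
  refine (HF.finite_mem x).biUnion fun a _ => Set.finite_iUnion fun q => ?_
  exact Set.Subsingleton.finite fun b hb b' hb' =>
    Sim.unique hb hb' (comp_self (Sim.wide hb).1)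

/-- Existence of images at level `n`. -/
def Exist (L : Link M₁ M₂) (n : ℕ) : Prop := ∀ {p q x y}, L.Sim n p x y → q ∈ L.K →
  dom q = dom p → ∃ y', L.Sim n q x y'

/-- Composition at level `n`. -/
def Zigzag (L : Link M₁ M₂) (n : ℕ) : Prop := ∀ {p q r x x' y y'}, L.Sim n p x y →
  L.Sim n q x' y → L.Sim n r x' y' → dom p.symm = dom q.symm → dom q = dom r →
    L.Sim n (zig p q r) x y'

theorem exist_flip {n : ℕ} (hE : L.flip.Exist n) {p q : M₁ ≃. M₂} {x : HF M₁} {y : HF M₂}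
    (h : L.Sim n p x y) (hq : q ∈ L.K) (hd : dom q.symm = dom p.symm) :
    ∃ x', L.Sim n q x' y := by
  obtain ⟨x', h'⟩ := hE h.flip (symm_mem_flip.2 hq) hd
  exact ⟨x', sim_flip.1 h'⟩

theorem Zigzag.flip {n : ℕ} (hZ : L.Zigzag n) : L.flip.Zigzag n := by
  intro p q r x x' y y' hp hq hr h h'
  have := hZ hr.unflip hq.unflip hp.unflip (by simpa using h'.symm) h.symm
  simpa [zig_symm] using this.flip

/-- If the domain of `p` supports `x`, then maps that agree on it have the same effect on the
elements of `x`. -/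
theorem exists_mem_of_agree {n : ℕ} (hE : L.Exist n) (hE' : L.flip.Exist n) (hZ : L.Zigzag n)
    {p g g' q r : M₁ ≃. M₂} {x a : HF M₁} {y b : HF M₂} (h : L.Sim (n + 1) p x y)
    (hg : g ∈ L.K) (hg' : g' ∈ L.K) (hpg : dom p ⊆ dom g) (hgg' : ∀ c ∈ dom p, g c = g' c)
    (hq : q ≤ g) (hr : r ≤ g') (hqr : dom q.symm = dom r.symm)
    (h' : L.Sim n q a b) (ha : HF.Mem a x) : ∃ a', HF.Mem a' x ∧ L.Sim n r a' b := by
  have hrK := L.restrict _ hg' _ hr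
  -- The element sought is the image of `a` under `q` followed by the inverse of `r`. To see that it
  -- lies in `x`, both elements are sent to the same `b' ∈ y`: `a` by an extension `f` of `p`, and
  -- the new one by `r`, `q⁻¹`, `f` in succession.
  obtain ⟨f, hf, hpf, hqf⟩ := exists_ext h.1.1 le_rfl h.1.2 h'.wide.2
    (by have := L.two_mul_lt; omega)
  obtain ⟨b', hb'⟩ := hE h' (L.restrict f hf _ (res_le f (dom q))) (dom_res hqf)
  have hqd : dom (res f (dom q)) = dom q := dom_res hqf
  have hf' : zig r q (res f (dom q)) ≤ zig g' g f := zig_mono hr hq (res_le _ _)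
  -- Here the agreement on `dom p` is used: on it, `g'` followed by `g⁻¹` is the identity.
  have hpf' : p ≤ zig g' g f := by
    intro c d hcd
    obtain ⟨e, he⟩ := hpg ⟨d, hcd⟩
    exact zig_eq_some.2 ⟨e, c, by rw [← hgg' c ⟨d, hcd⟩, he], he, hpf _ _ hcd⟩
  have hZK := L.zig_mem g' hg' g hg f hf
  have hran : dom (zig r q (res f (dom q))).symm = dom (res f (dom q)).symm :=
    dom_zig_symm hqr.symm hqd.symm
  obtain ⟨a', ha'⟩ := exist_flip hE' hb' (L.restrict _ hZK _ hf') hran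
  have hb'y : HF.Mem b' y := (h.mem_iff' hb' ⟨f, hf, hpf, res_le _ _⟩).1 ha
  refine ⟨a', (h.mem_iff' ha' ⟨_, hZK, hpf', hf'⟩).2 hb'y, ?_⟩
  -- The detour through `b'` cancels, and the composite is `r`.
  have := hZ ha' hb' h' hran hqd
  have e : zig (zig r q (res f (dom q))) (res f (dom q)) q = r := by
    refine pequiv_ext fun c d => ?_
    rw [zig_eq_some]
    constructor
    · rintro ⟨d', c', h₁, h₂, h₃⟩
      obtain ⟨d'', c'', h₄, h₅, h₆⟩ := zig_eq_some.1 h₁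
      obtain rfl := pequiv_inj h₂ h₆
      rwa [pequiv_fun h₃ h₅]
    · intro hcd
      obtain ⟨c', hc'⟩ := hqr.superset ⟨c, symm_eq_some.2 hcd⟩
      have hc' := symm_eq_some.1 hc'
      obtain ⟨d', hd'⟩ := hqd.superset ⟨d, hc'⟩
      exact ⟨d', c', zig_eq_some.2 ⟨d, c', hcd, hc', hd'⟩, hd', hc'⟩
  rwa [e] at this

/-- The image under `q` has to consist of all images of elements of `x` under narrow maps compatible
with `q`. The forward condition holds because the support of an element, once it works for one map,
works for all maps with that domain. The backward condition is `exists_mem_of_agree`. -/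
theorem exist_succ [Finite M₁] [Finite M₂] {n : ℕ} (hE : L.Exist n) (hE' : L.flip.Exist n)
    (hZ : L.Zigzag n) : L.Exist (n + 1) := by
  intro p q x y h hq hqp
  have hqw : L.Wide q := ⟨hq, hqp ▸ h.1.2⟩
  have hsim := h
  rcases h.2 with ⟨a, b, rfl, rfl, hab⟩ | ⟨hx, hy, h₁, h₂⟩
  · obtain ⟨c, hc⟩ := hqp.superset ⟨b, hab⟩
    exact ⟨HF.atom c, hqw, Or.inl ⟨a, c, rfl, rfl, hc⟩⟩
  · obtain ⟨z, hz⟩ := HF.exists_isSetOf (X := {b | ∃ a, HF.Mem a x ∧ ∃ r, dom r ∈ L.I₁ ∧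
      L.Comp q r ∧ L.Sim n r a b}) ((finite_images (L := L) n x).subset
        fun b ⟨a, ha, r, _, _, h⟩ => ⟨a, ha, r, h⟩)
    refine ⟨z, hqw, Or.inr ⟨hx, hz.1, fun a ha => ?_, fun b hb => ?_⟩⟩
    · obtain ⟨C, hC, h₃⟩ := h₁ a ha
      refine ⟨C, hC, fun r hr hrC hqr => ?_⟩
      obtain ⟨r', hr', hrC', hpr', -⟩ := exists_comp (comp_self hsim.1.1) hsim.1.2 hsim.1.2 hC
      obtain ⟨b', -, hb'⟩ := h₃ r' hr' hrC' hpr'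
      obtain ⟨b, hb⟩ := hE hb' hr (hrC.trans hrC'.symm)
      exact ⟨b, (hz.2 b).2 ⟨a, ha, r, hrC ▸ hC, hqr, hb⟩, hb⟩
    · obtain ⟨a, ha, r, hrI, ⟨g, hg, hqg, hrg⟩, hab⟩ := (hz.2 b).1 hb
      -- The range of the map that produced `b` serves as the support of `b`.
      refine ⟨dom r.symm, (dom_mem_iff hab.wide.1).1 hrI, ?_⟩
      rintro r' - hrr' ⟨g', hg', hqg', hrg'⟩
      refine exists_mem_of_agree hE hE' hZ hsim hg hg' (hqp ▸ dom_mono hqg) ?_ hrg hrg' hrr'.symm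
        hab ha
      rintro c hc
      obtain ⟨d, hd⟩ := hqp.superset hc
      rw [hqg _ _ hd, hqg' _ _ hd]

/-- An element `a` is followed through `p` and `q⁻¹` to some `a' ∈ x'` by auxiliary maps `p'` and
`q'`. The given `e` dictates how `a'` must be sent on: by `q'`, `p'⁻¹`, `e` in succession. This map
is compatible with `r`, so the result lies in `y'`. -/
theorem zigzag_aux {n : ℕ} (hE : L.Exist n) (hE' : L.flip.Exist n) (hZ : L.Zigzag n)
    {p q r : M₁ ≃. M₂} {x x' : HF M₁} {y y' : HF M₂} (hp : L.Sim (n + 1) p x y)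
    (hq : L.Sim (n + 1) q x' y) (hr : L.Sim (n + 1) r x' y') (hpq : dom p.symm = dom q.symm)
    (hqr : dom q = dom r) (a : HF M₁) (ha : HF.Mem a x) :
    ∃ C ∈ L.I₁, ∀ e ∈ L.K, dom e = C → L.Comp (zig p q r) e → ∃ b, HF.Mem b y' ∧
      L.Sim n e a b := by
  rcases hp.2 with ⟨a, b, rfl, rfl, hab⟩ | ⟨-, -, h₁, -⟩
  · exact absurd ha (HF.not_mem_atom _ _)
  obtain ⟨C, hC, h₂⟩ := h₁ a ha
  refine ⟨C, hC, ?_⟩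
  rintro e he heC ⟨g, hg, hzg, heg⟩
  obtain ⟨p', hp', hpC', ⟨g₁, hg₁, hpg₁, hpg₁'⟩, -⟩ :=
    exists_comp (comp_self hp.1.1) hp.1.2 hp.1.2 hC
  obtain ⟨b, hb, hab⟩ := h₂ p' hp' hpC' ⟨g₁, hg₁, hpg₁, hpg₁'⟩
  obtain ⟨q', hq', hpq', ⟨g₂, hg₂, hqg₂, hqg₂'⟩, -⟩ :=
    exists_comp_symm (comp_self hq.1.1) hq.1.2 hq.1.2 ((dom_mem_iff hp').1 (hpC' ▸ hC))
  obtain ⟨a', ha'⟩ := exist_flip hE' hab hq' hpq'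
  have ha'x := (hq.mem_iff' ha' ⟨g₂, hg₂, hqg₂, hqg₂'⟩).2 hb
  have hdr : dom (zig q' p' e) = dom q' := dom_zig hpq' (hpC'.trans heC.symm)
  have hgK := L.zig_mem g₂ hg₂ g₁ hg₁ g hg
  have hle : zig q' p' e ≤ zig g₂ g₁ g := zig_mono hqg₂' hpg₁' heg
  -- The map `r` is recovered from `zig p q r` by undoing `p` and `q⁻¹`, and each factor is below
  -- the corresponding extension.
  have hrle : r ≤ zig g₂ g₁ g := by
    rw [← zig_zig hpq.symm hqr.superset]
    exact zig_mono hqg₂ hpg₁ hzg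
  obtain ⟨b', hb'⟩ := hE ha' (L.restrict _ hgK _ hle) hdr
  refine ⟨b', (hr.mem_iff' hb' ⟨_, hgK, hrle, hle⟩).1 ha'x, ?_⟩
  have := hZ hab ha' hb' hpq'.symm hdr.symm
  rwa [zig_zig hpq'.symm (heC.trans hpC'.symm).subset] at this

theorem zigzag_succ {n : ℕ} (hE : L.Exist n) (hE' : L.flip.Exist n) (hZ : L.Zigzag n) :
    L.Zigzag (n + 1) := by
  have hE'' : L.flip.flip.Exist n := by rw [flip_flip]; exact hE
  intro p q r x x' y y' hp hq hr hpq hqr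
  refine ⟨⟨L.zig_mem _ hp.1.1 _ hq.1.1 _ hr.1.1, by rw [dom_zig hpq hqr]; exact hp.1.2⟩, ?_⟩
  by_cases hx : HF.IsSet x
  · refine Or.inr ⟨hx, hr.isSet_iff.1 (hq.isSet_iff.2 (hp.isSet_iff.1 hx)),
      zigzag_aux hE hE' hZ hp hq hr hpq hqr, fun b hb => ?_⟩
    obtain ⟨C, hC, h⟩ := zigzag_aux hE' hE'' hZ.flip hr.flip hq.flip hp.flip
      (by simpa using hqr.symm) hpq.symm b hb
    refine ⟨C, hC, fun e he heC hc => ?_⟩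
    obtain ⟨a, ha, h⟩ := h e.symm (symm_mem_flip.2 he) heC
      (by rw [← zig_symm]; exact comp_flip.2 hc)
    exact ⟨a, ha, sim_flip.1 h⟩
  · simp only [HF.IsSet, not_forall, not_not] at hx
    obtain ⟨a, rfl⟩ := hx
    obtain ⟨b, rfl, hb⟩ := hp.exists_atom
    obtain ⟨a', rfl, ha'⟩ := hq.flip.exists_atom
    obtain ⟨b', rfl, hb'⟩ := hr.exists_atom
    exact Or.inl ⟨a, b', rfl, rfl, zig_eq_some.2 ⟨b, a', hb, symm_eq_some.1 ha', hb'⟩⟩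

/-- The three statements are proved together: existence at the next level uses composition and
existence in both directions, and composition uses existence in both directions. -/
theorem exist_and_zigzag [Finite M₁] [Finite M₂] (n : ℕ) :
    L.Exist n ∧ L.flip.Exist n ∧ L.Zigzag n := by
  induction n with
  | zero => exact ⟨fun h => h.elim, fun h => h.elim, fun h => h.elim⟩
  | succ n ih =>
    obtain ⟨hE, hE', hZ⟩ := ih
    have hE'' : L.flip.flip.Exist n := by rw [flip_flip]; exact hE
    exact ⟨exist_succ hE hE' hZ, exist_succ hE' hE'' hZ.flip,
      zigzag_succ hE hE' hZ⟩

section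

variable [Finite M₁] [Finite M₂] {n : ℕ}

theorem Sim.exists_image {p q : M₁ ≃. M₂} {x : HF M₁} {y : HF M₂} (h : L.Sim n p x y)
    (hq : q ∈ L.K) (hd : dom q = dom p) : ∃ y', L.Sim n q x y' :=
  (exist_and_zigzag n).1 h hq hd

theorem Sim.exists_preimage {p q : M₁ ≃. M₂} {x : HF M₁} {y : HF M₂} (h : L.Sim n p x y)
    (hq : q ∈ L.K) (hd : dom q.symm = dom p.symm) : ∃ x', L.Sim n q x' y :=
  exist_flip (exist_and_zigzag n).2.1 h hq hd

theorem Sim.zig {p q r : M₁ ≃. M₂} {x x' : HF M₁} {y y' : HF M₂} (hp : L.Sim n p x y)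
    (hq : L.Sim n q x' y) (hr : L.Sim n r x' y') (hpq : dom p.symm = dom q.symm)
    (hqr : dom q = dom r) : L.Sim n (zig p q r) x y' :=
  (exist_and_zigzag n).2.2 hp hq hr hpq hqr

end

end Link

/-! ### Counting along a relation -/

theorem nonempty_equiv_of_encard_eq {α : Type w} {β : Type w'} {S : Set α} {T : Set β}
    (hS : S.Finite) (hT : T.Finite) (h : S.encard = T.encard) : Nonempty (S ≃ T) := by
  have := hS.to_subtype
  have := hT.to_subtype
  refine Finite.card_eq.1 ?_
  change S.ncard = T.ncard
  rw [Set.ncard, Set.ncard, h]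

/-- A difunctional relation is a disjoint union of full rectangles. The sides of each rectangle are
finite of equal size, so bijections between them can be glued. -/
theorem encard_eq_of_difunctional {α : Type w} {β : Type w'} {X : Set α} {Y : Set β}
    (R : α → β → Prop) (hl : ∀ a ∈ X, ∃ b, R a b) (hr : ∀ b ∈ Y, ∃ a, R a b)
    (hXY : ∀ a b, R a b → (a ∈ X ↔ b ∈ Y))
    (hd : ∀ a b a' b', R a b → R a' b → R a' b' → R a b')
    (hf : ∀ a b, R a b → {a' | R a' b}.Finite ∧ {b' | R a b'}.Finite ∧
      {a' | R a' b}.encard = {b' | R a b'}.encard) : X.encard = Y.encard := by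
  let κ : X → Set β := fun a => {b | R a b}
  let μ : Y → Set β := fun b => {b' | ∃ a, R a b ∧ R a b'}
  have key : ∀ a b, R a b → {b' | R a b'} = {b' | ∃ a, R a b ∧ R a b'} := by
    intro a b hab
    ext b'
    exact ⟨fun h => ⟨a, hab, h⟩, fun ⟨a', h₁, h₂⟩ => hd _ _ _ _ hab h₁ h₂⟩
  -- A rectangle is named by its side `T` in `β`; `κ` and `μ` send the points of `X` and `Y` to this
  -- name.
  have fib : ∀ T : Set β, Nonempty ({a : X // κ a = T} ≃ {b : Y // μ b = T}) := by
    intro T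
    by_cases hT : ∃ a ∈ X, {b | R a b} = T
    · obtain ⟨a, ha, rfl⟩ := hT
      obtain ⟨b, hab⟩ := hl a ha
      obtain ⟨h₁, h₂, h₃⟩ := hf a b hab
      obtain ⟨e⟩ := nonempty_equiv_of_encard_eq h₁ h₂ h₃
      have e₁ : {a' : X // κ a' = {b | R a b}} ≃ {a' | R a' b} :=
        { toFun := fun a' => ⟨a'.1.1, a'.2.superset hab⟩
          invFun := fun a' => ⟨⟨a'.1, (hXY _ _ a'.2).2 ((hXY _ _ hab).1 ha)⟩, by
            have h := a'.2
            change {b' | R a'.1 b'} = _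
            rw [key _ _ h, ← key _ _ hab]⟩
          left_inv := fun _ => rfl
          right_inv := fun _ => rfl }
      have e₂ : {b' : Y // μ b' = {b | R a b}} ≃ {b' | R a b'} :=
        { toFun := fun b' => ⟨b'.1.1, by
            obtain ⟨a', h'⟩ := hr _ b'.1.2
            exact b'.2.subset ⟨a', h', h'⟩⟩
          invFun := fun b' => ⟨⟨b'.1, (hXY _ _ b'.2).1 ha⟩, (key _ _ b'.2).symm⟩
          left_inv := fun _ => rfl
          right_inv := fun _ => rfl }
      exact ⟨e₁.trans (e.trans e₂.symm)⟩
    · have h₁ : IsEmpty {a : X // κ a = T} := ⟨fun a => hT ⟨a.1.1, a.1.2, a.2⟩⟩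
      have h₂ : IsEmpty {b : Y // μ b = T} := ⟨fun b => by
        obtain ⟨a, ha⟩ := hr _ b.1.2
        exact hT ⟨a, (hXY _ _ ha).2 b.1.2, (key _ _ ha).trans b.2⟩⟩
      exact ⟨Equiv.equivOfIsEmpty _ _⟩
  have e : X ≃ Y := (Equiv.sigmaFiberEquiv κ).symm.trans
    ((Equiv.sigmaCongrRight fun T => (fib T).some).trans (Equiv.sigmaFiberEquiv μ))
  exact ENat.card_congr e

theorem encard_setOf_eq_card_quotient {α : Type w} {β : Type w'} (E : Setoid α) (R : α → β → Prop)
    (hR : ∀ a, ∃ b, R a b) (h : ∀ a b a' b', R a b → R a' b' → (E a a' ↔ b = b')) :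
    {b | ∃ a, R a b}.encard = ENat.card (Quotient E) := by
  choose f hf using hR
  have hrel : ∀ a a', E a a' ↔ f a = f a' := fun a a' => h _ _ _ _ (hf a) (hf a')
  let g : Quotient E → {b | ∃ a, R a b} :=
    Quotient.lift (fun a => ⟨f a, a, hf a⟩) fun a a' haa' => Subtype.ext ((hrel a a').1 haa')
  refine (ENat.card_congr (Equiv.ofBijective g ⟨?_, ?_⟩)).symm
  · intro q q'
    induction q using Quotient.inductionOn with | _ a
    induction q' using Quotient.inductionOn with | _ a'
    intro hq
    exact Quotient.sound ((hrel a a').2 (congrArg Subtype.val hq))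
  · rintro ⟨b, a, hab⟩
    exact ⟨Quotient.mk _ a, Subtype.ext ((h _ _ _ _ (hf a) hab).1 (Setoid.refl a))⟩

/-! ### The action of partial automorphisms on one side of a link. -/

namespace Link

variable {M₁ : Type w} {M₂ : Type w'}

/-- The families of partial automorphisms of two systems act on a link between them. -/
structure Compat (L : Link M₁ M₂) (Y₁ : Sys M₁) (Y₂ : Sys M₂) : Prop where
  I₁_eq : L.I₁ = Y₁.I
  I₂_eq : L.I₂ = Y₂.I
  comp_left : ∀ g ∈ L.K, ∀ f ∈ Y₁.F, f.trans g ∈ L.K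
  comp_right : ∀ g ∈ L.K, ∀ f ∈ Y₂.F, g.trans f ∈ L.K
  comp_symm : ∀ g ∈ L.K, ∀ g' ∈ L.K, g.trans g'.symm ∈ Y₁.F
  symm_comp : ∀ g ∈ L.K, ∀ g' ∈ L.K, g.symm.trans g' ∈ Y₂.F
  restrict₁ : ∀ f ∈ Y₁.F, ∀ g ≤ f, g ∈ Y₁.F
  restrict₂ : ∀ f ∈ Y₂.F, ∀ g ≤ f, g ∈ Y₂.F
  symm₁ : ∀ f ∈ Y₁.F, f.symm ∈ Y₁.F
  symm₂ : ∀ f ∈ Y₂.F, f.symm ∈ Y₂.F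

theorem trans_symm_eq {α : Type u} {β : Type v} {γ : Type w} (f : α ≃. β) (g : β ≃. γ) :
    (f.trans g).symm = g.symm.trans f.symm := rfl

theorem Compat.flip {L : Link M₁ M₂} {Y₁ : Sys M₁} {Y₂ : Sys M₂} (h : L.Compat Y₁ Y₂) :
    L.flip.Compat Y₂ Y₁ where
  I₁_eq := h.I₂_eq
  I₂_eq := h.I₁_eq
  comp_left _ hg f hf := h.comp_right _ hg _ (h.symm₂ f hf)
  comp_right _ hg f hf := h.comp_left _ hg _ (h.symm₁ f hf)
  comp_symm _ hg _ hg' := h.symm_comp _ hg _ hg'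
  symm_comp _ hg _ hg' := h.comp_symm _ hg _ hg'
  restrict₁ := h.restrict₂
  restrict₂ := h.restrict₁
  symm₁ := h.symm₂
  symm₂ := h.symm₁

/-- The action of partial automorphisms of the first system: `f` maps `x` to `x'`. -/
def Move (L : Link M₁ M₂) (n : ℕ) (f : M₁ ≃. M₁) (x x' : HF M₁) : Prop :=
  ∃ q ∈ L.K, dom q = dom f.symm ∧ ∃ y, L.Sim n q x' y ∧ L.Sim n (f.trans q) x y

variable {L : Link M₁ M₂} {Y₁ : Sys M₁} {Y₂ : Sys M₂}

theorem dom_trans {α : Type u} {β : Type v} {γ : Type w} {f : α ≃. β} {q : β ≃. γ}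
    (h : dom f.symm ⊆ dom q) : dom (f.trans q) = dom f := by
  ext a
  constructor
  · rintro ⟨c, hc⟩
    obtain ⟨b, hb, -⟩ := trans_eq_some.1 hc
    exact ⟨b, hb⟩
  · rintro ⟨b, hb⟩
    obtain ⟨c, hc⟩ := h ⟨a, symm_eq_some.2 hb⟩
    exact ⟨c, trans_eq_some.2 ⟨b, hb, hc⟩⟩

theorem dom_trans_symm {α : Type u} {β : Type v} {γ : Type w} {f : α ≃. β} {q : β ≃. γ}
    (h : dom q ⊆ dom f.symm) : dom (f.trans q).symm = dom q.symm := by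
  rw [trans_symm_eq]
  exact dom_trans (by simpa using h)

theorem trans_cancel {α : Type u} {β : Type v} {γ : Type w} {f : α ≃. β} {q : α ≃. γ}
    (h : dom q ⊆ dom f) : f.trans (f.symm.trans q) = q := by
  refine pequiv_ext fun a c => ⟨fun hc => ?_, fun hc => ?_⟩
  · obtain ⟨b, h₁, h₂⟩ := trans_eq_some.1 hc
    obtain ⟨a', h₃, h₄⟩ := trans_eq_some.1 h₂
    rwa [pequiv_inj h₁ (symm_eq_some.1 h₃)]
  · obtain ⟨b, hb⟩ := h ⟨c, hc⟩
    exact trans_eq_some.2 ⟨b, hb, trans_eq_some.2 ⟨a, symm_eq_some.2 hb, hc⟩⟩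

section Move

variable [Finite M₁] [Finite M₂] {n : ℕ}

/-- The map `q` chosen in the definition of `Move` is immaterial: another one with the same domain
is reached by a zigzag. -/
theorem Move.sim {f : M₁ ≃. M₁} {q : M₁ ≃. M₂} {x x' : HF M₁} {y : HF M₂} (h : L.Move n f x x')
    (hq : L.Sim n q x' y) (hd : dom q = dom f.symm) : L.Sim n (f.trans q) x y := by
  obtain ⟨q', hq', hd', y', h₁, h₂⟩ := h
  have := h₂.zig h₁ hq (dom_trans_symm hd'.subset) (hd'.trans hd.symm)
  have e : Choiceless.zig (f.trans q') q' q = f.trans q := by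
    refine pequiv_ext fun a c => ?_
    rw [zig_eq_some]
    constructor
    · rintro ⟨b, a', h₃, h₄, h₅⟩
      obtain ⟨a'', h₆, h₇⟩ := trans_eq_some.1 h₃
      rw [pequiv_inj h₇ h₄] at h₆
      exact trans_eq_some.2 ⟨a', h₆, h₅⟩
    · intro hc
      obtain ⟨a', h₃, h₄⟩ := trans_eq_some.1 hc
      obtain ⟨b, hb⟩ := hd'.superset ⟨a, symm_eq_some.2 h₃⟩
      exact ⟨b, a', trans_eq_some.2 ⟨a', h₃, hb⟩, hb, h₄⟩
  rwa [e] at this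

theorem Move.exists_sim {f : M₁ ≃. M₁} {q : M₁ ≃. M₂} {x x' : HF M₁} (h : L.Move n f x x')
    (hq : q ∈ L.K) (hd : dom q = dom f.symm) :
    ∃ y, L.Sim n q x' y ∧ L.Sim n (f.trans q) x y := by
  obtain ⟨q', hq', hd', y', h₁, h₂⟩ := id h
  obtain ⟨y, hy⟩ := h₁.exists_image hq (hd.trans hd'.symm)
  exact ⟨y, hy, h.sim hy hd⟩

theorem Move.exists_le_sim {f : M₁ ≃. M₁} {q : M₁ ≃. M₂} {x x' : HF M₁} (h : L.Move n f x x')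
    (hq : q ∈ L.K) (hd : dom f.symm ⊆ dom q) :
    ∃ y q', q' ≤ q ∧ dom q' = dom f.symm ∧ L.Sim n q' x' y ∧ L.Sim n (f.trans q') x y := by
  obtain ⟨y, h₁, h₂⟩ := h.exists_sim (L.restrict _ hq _ (res_le q _)) (dom_res hd)
  exact ⟨y, _, res_le _ _, dom_res hd, h₁, h₂⟩

/-- The image under `f` is the preimage of `y` under `f⁻¹` followed by `p`, a map with the same
range as `p`. -/
theorem Compat.exists_move (hL : L.Compat Y₁ Y₂) {f : M₁ ≃. M₁} {p : M₁ ≃. M₂} {x : HF M₁}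
    {y : HF M₂} (hf : f ∈ Y₁.F) (h : L.Sim n p x y) (hd : dom p = dom f) :
    ∃ x', L.Move n f x x' := by
  have h₁ : dom (f.symm.trans p) = dom f.symm := dom_trans hd.superset
  have h₂ : dom (f.symm.trans p).symm = dom p.symm := dom_trans_symm hd.subset
  have hK := hL.comp_left p h.wide.1 f.symm (hL.symm₁ f hf)
  obtain ⟨x', hx'⟩ := h.exists_preimage hK h₂
  refine ⟨x', _, hK, h₁, y, hx', ?_⟩
  rwa [trans_cancel hd.subset]

theorem Sim.move {p q : M₁ ≃. M₂} {x x' : HF M₁} {y : HF M₂} (h : L.Sim n p x y)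
    (h' : L.Sim n q x' y) (hd : dom p.symm = dom q.symm) : L.Move n (p.trans q.symm) x x' := by
  refine ⟨q, h'.wide.1, ?_, y, h', ?_⟩
  · rw [dom_trans_symm hd.superset, PEquiv.symm_symm]
  · convert h using 1
    refine pequiv_ext fun a c => ⟨fun hc => ?_, fun hc => ?_⟩
    · obtain ⟨b, h₁, h₂⟩ := trans_eq_some.1 hc
      obtain ⟨d, h₃, h₄⟩ := trans_eq_some.1 h₁
      rwa [← pequiv_fun (symm_eq_some.1 h₄) h₂]
    · obtain ⟨b, hb⟩ := hd.subset ⟨a, symm_eq_some.2 hc⟩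
      exact trans_eq_some.2 ⟨b, trans_eq_some.2 ⟨c, hc, hb⟩, symm_eq_some.1 hb⟩

theorem Move.dom_symm_mem {f : M₁ ≃. M₁} {x x' : HF M₁} (h : L.Move n f x x') :
    dom f.symm ∈ unions L.I₁ L.s := by
  obtain ⟨q, -, hd, y, h₁, -⟩ := h
  exact hd ▸ h₁.wide.2

/-- Both moves are compared on the other side of the link, after one `q` defined on both ranges.
Composition with `q` and with `g` followed by `q` gives the compatibility needed for uniqueness and
injectivity. -/
theorem Move.eq_iff_of_le (hL : L.Compat Y₁ Y₂) {f f' g : M₁ ≃. M₁} {x x' z z' : HF M₁}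
    (h : L.Move n f x x') (h' : L.Move n f' z z') (hg : g ∈ Y₁.F) (hf : f ≤ g) (hf' : f' ≤ g) :
    x = z ↔ x' = z' := by
  obtain ⟨q, hq, hd⟩ := exists_dom_eq (L := L) (B := dom f.symm ∪ dom f'.symm)
    (unions_mono L.empty₁ (by have := L.two_mul_lt; omega)
      (union_mem_unions h.dom_symm_mem h'.dom_symm_mem))
  obtain ⟨y, r, hr, -, h₁, h₂⟩ := h.exists_le_sim hq (hd ▸ Set.subset_union_left)
  obtain ⟨y', r', hr', -, h₃, h₄⟩ := h'.exists_le_sim hq (hd ▸ Set.subset_union_right)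
  have c₁ : L.Comp r r' := ⟨q, hq, hr, hr'⟩
  have c₂ : L.Comp (f.trans r) (f'.trans r') :=
    ⟨g.trans q, hL.comp_left q hq g hg, trans_le_trans hf hr, trans_le_trans hf' hr'⟩
  constructor
  · rintro rfl
    obtain rfl := h₂.unique h₄ c₂
    exact h₁.injective h₃ c₁
  · rintro rfl
    obtain rfl := h₁.unique h₃ c₁
    exact h₂.injective h₄ c₂

/-- A first factor can be divided out: continued to the other side, both descriptions of the
composite send `x` to the same element. -/
theorem Move.cancel {f f' : M₁ ≃. M₁} {x x₁ x₂ : HF M₁} (h : L.Move n f x x₁)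
    (h' : L.Move n (f.trans f') x x₂) (hd : dom f.symm = dom f')
    (hK : ∀ q ∈ L.K, f'.trans q ∈ L.K) : L.Move n f' x₁ x₂ := by
  obtain ⟨q, hq, hqd, y, h₁, h₂⟩ := id h'
  have hqd' : dom q = dom f'.symm := hqd.trans (dom_trans_symm hd.superset)
  obtain ⟨y', h₃, h₄⟩ := h.exists_sim (hK q hq) ((dom_trans hqd'.superset).trans hd.symm)
  rw [PEquiv.trans_assoc] at h₂
  have : y = y' := h₂.unique h₄ (comp_self h₂.wide.1)
  exact ⟨q, hq, hqd', y, h₁, this ▸ h₃⟩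

end Move

/-! ### Orbits -/

/-- `x'` is the image of `x`, which is supported by the range of `h`, under a map that takes `h` to
`h'`. -/
def Img (L : Link M₁ M₂) (Y : Sys M₁) (n : ℕ) {m : ℕ} (h : Fin m → M₁) (x : HF M₁)
    (h' : Fin m → M₁) (x' : HF M₁) : Prop :=
  ∃ f ∈ Y.F, (∀ i, f (h i) = some (h' i)) ∧ L.Move n (res f (Set.range h)) x x'

/-- Two members of the orbit of `h` are equivalent if they yield the same image of `x`. -/
def orbitSetoid (L : Link M₁ M₂) (Y : Sys M₁) (n : ℕ) (A : Set M₁) {m : ℕ} (h : Fin m → M₁)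
    (x : HF M₁) : Setoid (Y.orbit A h) := Setoid.ker fun h' => {x' | L.Img Y n h x h'.1 x'}

section Orbit

variable [Finite M₁] [Finite M₂] {n m : ℕ} {h : Fin m → M₁} {A : Set M₁} {p : M₁ ≃. M₂}
  {x : HF M₁} {y : HF M₂}

theorem range_subset_dom {f : M₁ ≃. M₁} {h h' : Fin m → M₁} (hf : ∀ i, f (h i) = some (h' i)) :
    Set.range h ⊆ dom f := by
  rintro _ ⟨i, rfl⟩
  exact ⟨_, hf i⟩

theorem dom_res_range {f : M₁ ≃. M₁} {h h' : Fin m → M₁} (hf : ∀ i, f (h i) = some (h' i)) :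
    dom (res f (Set.range h)) = Set.range h := dom_res (range_subset_dom hf)

theorem dom_res_range_symm {f : M₁ ≃. M₁} {h h' : Fin m → M₁}
    (hf : ∀ i, f (h i) = some (h' i)) :
    dom (res f (Set.range h)).symm = Set.range h' := by
  rw [dom_res_symm]
  ext b
  constructor
  · rintro ⟨_, ⟨i, rfl⟩, hb⟩
    exact ⟨i, pequiv_fun (hf i) hb⟩
  · rintro ⟨i, rfl⟩
    exact ⟨_, ⟨i, rfl⟩, hf i⟩

theorem res_range_eq {f f' : M₁ ≃. M₁} {h h' : Fin m → M₁} (hf : ∀ i, f (h i) = some (h' i))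
    (hf' : ∀ i, f' (h i) = some (h' i)) : res f (Set.range h) = res f' (Set.range h) := by
  refine pequiv_ext fun a b => ?_
  rw [res_eq_some, res_eq_some]
  refine and_congr_right ?_
  rintro ⟨i, rfl⟩
  rw [hf, hf']

theorem Compat.exists_img (hL : L.Compat Y₁ Y₂) (hp : L.Sim n p x y) (hd : dom p = Set.range h)
    (h' : Y₁.orbit A h) : ∃ x', L.Img Y₁ n h x h'.1 x' := by
  obtain ⟨h', f, hf, -, hfh⟩ := h'
  obtain ⟨x', hx'⟩ := hL.exists_move (hL.restrict₁ f hf _ (res_le f (Set.range h))) hp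
    (hd.trans (dom_res_range hfh).symm)
  exact ⟨x', f, hf, hfh, hx'⟩

theorem Img.unique (hL : L.Compat Y₁ Y₂) {h' : Fin m → M₁} {x₁ x₂ : HF M₁}
    (h₁ : L.Img Y₁ n h x h' x₁) (h₂ : L.Img Y₁ n h x h' x₂) : x₁ = x₂ := by
  obtain ⟨f, hf, hfh, h₁⟩ := h₁
  obtain ⟨f', hf', hfh', h₂⟩ := h₂
  rw [← res_range_eq hfh hfh'] at h₂
  exact (h₁.eq_iff_of_le hL h₂ hf (res_le _ _) (res_le _ _)).1 rfl

theorem orbitSetoid_iff (hL : L.Compat Y₁ Y₂) {h₁ h₂ : Y₁.orbit A h} {x₁ x₂ : HF M₁}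
    (hx₁ : L.Img Y₁ n h x h₁.1 x₁) (hx₂ : L.Img Y₁ n h x h₂.1 x₂) :
    L.orbitSetoid Y₁ n A h x h₁ h₂ ↔ x₁ = x₂ := by
  change {x' | L.Img Y₁ n h x h₁.1 x'} = {x' | L.Img Y₁ n h x h₂.1 x'} ↔ _
  constructor
  · intro e
    exact Img.unique hL (e.subset hx₁) hx₂
  · rintro rfl
    ext z
    exact ⟨fun hz => Img.unique hL hx₁ hz ▸ hx₂, fun hz => Img.unique hL hx₂ hz ▸ hx₁⟩

theorem Img.move (hL : L.Compat Y₁ Y₂) {h₁ h₂ : Fin m → M₁} {x₁ x₂ : HF M₁} {f : M₁ ≃. M₁}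
    (hf : f ∈ Y₁.F) (hx₁ : L.Img Y₁ n h x h₁ x₁) (hx₂ : L.Img Y₁ n h x h₂ x₂)
    (hfh : ∀ i, f (h₁ i) = some (h₂ i)) : L.Move n (res f (Set.range h₁)) x₁ x₂ := by
  obtain ⟨f₁, hf₁, hfh₁, hx₁⟩ := hx₁
  obtain ⟨f₂, hf₂, hfh₂, hx₂⟩ := hx₂
  refine hx₁.cancel ?_ ?_ fun q hq => hL.comp_left q hq _ (hL.restrict₁ f hf _ (res_le _ _))
  · convert hx₂ using 1
    refine pequiv_ext fun a b => ?_
    rw [trans_eq_some, res_eq_some]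
    constructor
    · rintro ⟨c, h₃, h₄⟩
      obtain ⟨⟨i, rfl⟩, h₃⟩ := res_eq_some.1 h₃
      obtain rfl := pequiv_fun (hfh₁ i) h₃
      rw [hfh₂, ← hfh, (res_eq_some.1 h₄).2]
      exact ⟨⟨i, rfl⟩, rfl⟩
    · rintro ⟨⟨i, rfl⟩, h₃⟩
      exact ⟨h₁ i, res_eq_some.2 ⟨⟨i, rfl⟩, hfh₁ i⟩, res_eq_some.2 ⟨⟨i, rfl⟩, by
        rw [hfh, ← hfh₂, h₃]⟩⟩
  · rw [dom_res_range_symm hfh₁, dom_res_range hfh]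

/-- A map `f` carrying `h₁` to `h₃` and `h₂` to `h₄` moves the corresponding images of `x` in the
same way, and a single `f` preserves and reflects their equality. -/
theorem invariant_orbitSetoid (hL : L.Compat Y₁ Y₂) (hp : L.Sim n p x y)
    (hd : dom p = Set.range h) : Y₁.Invariant A h (L.orbitSetoid Y₁ n A h x) := by
  intro h₁ h₂ h₃ h₄ f hf _ h₁₃ h₂₄
  obtain ⟨x₁, hx₁⟩ := hL.exists_img hp hd h₁
  obtain ⟨x₂, hx₂⟩ := hL.exists_img hp hd h₂
  obtain ⟨x₃, hx₃⟩ := hL.exists_img hp hd h₃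
  obtain ⟨x₄, hx₄⟩ := hL.exists_img hp hd h₄
  rw [orbitSetoid_iff hL hx₁ hx₂, orbitSetoid_iff hL hx₃ hx₄]
  exact (hx₁.move hL hf hx₃ h₁₃).eq_iff_of_le hL (hx₂.move hL hf hx₄ h₂₄) hf (res_le _ _)
    (res_le _ _)

/-- The images of `x` under the maps that fix `A`. -/
def orbitSet (L : Link M₁ M₂) (Y : Sys M₁) (n : ℕ) (A B : Set M₁) (x : HF M₁) : Set (HF M₁) :=
  {x' | ∃ f ∈ Y.F, FixesOn f A ∧ B ⊆ dom f ∧ L.Move n (res f B) x x'}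

theorem orbitSet_eq : L.orbitSet Y₁ n A (Set.range h) x =
    {x' | ∃ h' : Y₁.orbit A h, L.Img Y₁ n h x h'.1 x'} := by
  ext x'
  constructor
  · rintro ⟨f, hf, hfA, hfh, hx'⟩
    choose h' hh' using fun i => hfh ⟨i, rfl⟩
    exact ⟨⟨h', f, hf, hfA, hh'⟩, f, hf, hh', hx'⟩
  · rintro ⟨⟨h', f, hf, hfA, hfh⟩, f', hf', hfh', hx'⟩
    rw [res_range_eq hfh' hfh] at hx'
    exact ⟨f, hf, hfA, range_subset_dom hfh, hx'⟩

theorem encard_orbitSet (hL : L.Compat Y₁ Y₂) (hp : L.Sim n p x y) (hd : dom p = Set.range h) :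
    (L.orbitSet Y₁ n A (Set.range h) x).encard =
      ENat.card (Quotient (L.orbitSetoid Y₁ n A h x)) := by
  rw [orbitSet_eq]
  exact encard_setOf_eq_card_quotient _ _ (fun h' => hL.exists_img hp hd h')
    fun _ _ _ _ h₁ h₂ => orbitSetoid_iff hL h₁ h₂

theorem finite_orbitSet (hL : L.Compat Y₁ Y₂) (hp : L.Sim n p x y) (hd : dom p = Set.range h) :
    (L.orbitSet Y₁ n A (Set.range h) x).Finite := by
  have : Finite (Y₁.orbit A h) := Subtype.finite
  rw [← Set.encard_lt_top_iff, encard_orbitSet hL hp hd]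
  exact ENat.card_lt_top.2 inferInstance

theorem exists_range_eq (B : Set M₁) : ∃ (m : ℕ) (h : Fin m → M₁), Set.range h = B := by
  obtain ⟨m, ⟨e⟩⟩ := Finite.exists_equiv_fin B
  exact ⟨m, Subtype.val ∘ e.symm, by simp [Set.range_comp]⟩

end Orbit

/-! ### Supports of sets with few images -/

section Dichotomy

variable [Finite M₁] [Finite M₂] {n : ℕ} {p : M₁ ≃. M₂} {x : HF M₁} {y : HF M₂}

/-- Dichotomy is applied to the relation of yielding the same image of `x`. Its classes are the
images, of which there are few, so the image depends only on the values on some `C ∈ I` inside `dom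
p`. It remains to check that the restriction of `p` to `C` already acts as `p` does. -/
theorem exists_narrow (hL : L.Compat Y₁ Y₂) {b : ℕ∞} {s : ℕ} (hY : Y₁.IsDichotomical b s)
    (hp : L.Sim (n + 1) p x y) (hx : HF.IsSet x) (hs : dom p ∈ unions L.I₁ s)
    (hb : (L.orbitSet Y₁ (n + 1) ∅ (dom p) x).encard ≤ b) :
    ∃ p' ≤ p, dom p' ∈ L.I₁ ∧ L.Sim (n + 1) p' x y := by
  obtain ⟨m, h, hh⟩ := exists_range_eq (dom p)
  rw [← hh, encard_orbitSet hL hp hh.symm] at hb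
  obtain ⟨U, hU, hE⟩ := (hY m h (by rwa [hh, ← hL.I₁_eq]) _
    (invariant_orbitSetoid hL hp hh.symm)).resolve_right (not_lt.2 hb)
  have hC : h '' U ⊆ dom p := hh ▸ Set.image_subset_range h U
  set C := h '' U with hCdef
  rw [← hL.I₁_eq] at hU
  have hpC : dom (res p C) = C := dom_res hC
  -- The preimage of `y` under `q` is `x` moved by `p` followed by `q⁻¹`, which is the identity on
  -- `C`; hence it is `x` itself.
  have star₂ : ∀ q ∈ L.K, dom q.symm = dom p.symm → res p C ≤ q → L.Sim (n + 1) q x y := by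
    intro q hq hqp hle
    obtain ⟨x', hx'⟩ := hp.exists_preimage hq hqp
    have hmove := hp.move hx' hqp.symm
    have hself := hp.move hp rfl
    have hfd : dom (p.trans q.symm) = dom p := dom_trans hqp.superset
    have hsub : Set.range h ⊆ dom (p.trans q.symm) := by rw [hfd, hh]
    have hF := hL.comp_symm p hp.wide.1 q hq
    choose h' hh' using fun i => hsub ⟨i, rfl⟩
    have hid : ∀ i, (p.trans p.symm) (h i) = some (h i) := by
      intro i
      obtain ⟨c, hc⟩ := hh.subset ⟨i, rfl⟩
      exact trans_eq_some.2 ⟨c, hc, symm_eq_some.2 hc⟩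
    have hfull : ∀ f : M₁ ≃. M₁, dom f = dom p → res f (Set.range h) = f := by
      intro f hf
      refine eq_of_le_of_dom (res_le _ _) le_rfl ?_
      rw [hh, ← hf, dom_res subset_rfl]
    have h₁ : L.Img Y₁ (n + 1) h x h' x' :=
      ⟨_, hF, hh', by rwa [hfull _ hfd]⟩
    have h₂ : L.Img Y₁ (n + 1) h x h x :=
      ⟨_, hL.comp_symm p hp.wide.1 p hp.wide.1, hid, by rwa [hfull _ (dom_trans subset_rfl)]⟩
    have := hE ⟨h', _, hF, by simp [FixesOn], hh'⟩
      ⟨h, _, hL.comp_symm p hp.wide.1 p hp.wide.1, by simp [FixesOn], hid⟩ (by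
        intro i hi
        obtain ⟨c, hc⟩ := hC ⟨i, hi, rfl⟩
        have hqc := hle _ _ (res_eq_some.2 ⟨⟨i, hi, rfl⟩, hc⟩)
        exact pequiv_fun (hh' i) (trans_eq_some.2 ⟨c, hc, symm_eq_some.2 hqc⟩))
    rw [orbitSetoid_iff hL h₁ h₂] at this
    rwa [this] at hx'
  -- An extension of `q` that covers the range of `p` reduces this to `star₂`; uniqueness of images
  -- does the rest.
  have star₁ : ∀ q ∈ L.K, dom q = dom p → res p C ≤ q → L.Sim (n + 1) q x y := by
    intro q hq hqp hle
    have hqw : L.Wide q := ⟨hq, hqp ▸ hp.wide.2⟩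
    obtain ⟨g, hg, hqg, hpg⟩ := exists_ext_symm hq le_rfl hqw.2 (dom_symm_mem_unions hp.wide.1
      hp.wide.2) (by have := L.two_mul_lt; omega)
    have hrd : dom (res g.symm (dom p.symm)).symm.symm = dom p.symm := by
      rw [PEquiv.symm_symm, dom_res hpg]
    have hrg : (res g.symm (dom p.symm)).symm ≤ g := by
      have := symm_le_symm (res_le g.symm (dom p.symm))
      rwa [PEquiv.symm_symm] at this
    have h₁ := star₂ _ (L.restrict g hg _ hrg) hrd (by
      intro c d hcd
      refine symm_eq_some.2 (res_eq_some.2 ⟨⟨c, ?_⟩, symm_eq_some.2 (hqg _ _ (hle _ _ hcd))⟩)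
      exact symm_eq_some.2 (res_le _ _ _ _ hcd))
    obtain ⟨y', hy'⟩ := hp.exists_image hq hqp
    rwa [h₁.unique hy' ⟨g, hg, hrg, hqg⟩]
  have hCu : dom (res p C) ∈ unions L.I₁ 1 := by rw [hpC]; exact mem_unions_one.2 hU
  have hpI : dom (res p C) ∈ L.I₁ := by rwa [hpC]
  refine ⟨res p C, res_le _ _, hpI, wide_of_narrow (L.restrict p hp.1.1 _ (res_le _ _)) hpI, ?_⟩
  rcases hp.2 with ⟨a, b, rfl, -⟩ | ⟨hx, hy, h₁, h₂⟩
  · exact absurd hx (HF.not_isSet_atom a)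
  refine Or.inr ⟨hx, hy, fun a ha => ?_, fun b hb => ?_⟩
  · obtain ⟨D, hD, h₃⟩ := h₁ a ha
    refine ⟨D, hD, ?_⟩
    rintro r hr hrD ⟨g, hg, hpg, hrg⟩
    obtain ⟨r', hr', hrD', hpr', -⟩ := exists_comp (comp_self hp.1.1) hp.1.2 hp.1.2 hD
    obtain ⟨b', -, hb'⟩ := h₃ r' hr' hrD' hpr'
    obtain ⟨b, hb⟩ := hb'.exists_image hr (hrD.trans hrD'.symm)
    refine ⟨b, ?_, hb⟩
    have hsub : dom (res p C) ∪ dom r ⊆ dom g := Set.union_subset (dom_mono hpg) (dom_mono hrg)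
    -- The map must cover `C`, `dom r` and `dom p`, that is, `1 + 1 + s` supports. This is at most
    -- `2 * s + 1` since `1 ≤ s`.
    obtain ⟨g', hg', hgg', hpg'⟩ := exists_ext hg (res_le g (dom (res p C) ∪ dom r))
      (by rw [dom_res hsub]; exact union_mem_unions hCu (mem_unions_one.2 (hrD ▸ hD)))
      hp.1.2 (by have := L.two_mul_lt; have := L.one_le; omega)
    have hq := star₁ (res g' (dom p)) (L.restrict g' hg' _ (res_le _ _)) (dom_res hpg')
      (le_res ((le_res hpg Set.subset_union_left).trans hgg') (dom_mono (res_le _ _)))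
    exact (hq.mem_iff' hb ⟨g', hg', res_le _ _,
      (le_res hrg Set.subset_union_right).trans hgg'⟩).1 ha
  · obtain ⟨D, hD, h₃⟩ := h₂ b hb
    refine ⟨D, hD, ?_⟩
    rintro r hr hrD ⟨g, hg, hpg, hrg⟩
    have hrI : dom r ∈ L.I₁ := (dom_mem_iff hr).2 (hrD ▸ hD)
    obtain ⟨r', hr', hrD', hpr', -⟩ := exists_comp_symm (comp_self hp.1.1) hp.1.2 hp.1.2 hD
    obtain ⟨a', -, ha'⟩ := h₃ r' hr' hrD' hpr'
    obtain ⟨a, ha⟩ := ha'.exists_preimage hr (hrD.trans hrD'.symm)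
    refine ⟨a, ?_, ha⟩
    have hsub : dom (res p C) ∪ dom r ⊆ dom g := Set.union_subset (dom_mono hpg) (dom_mono hrg)
    obtain ⟨g', hg', hgg', hpg'⟩ := exists_ext_symm hg (res_le g (dom (res p C) ∪ dom r))
      (by rw [dom_res hsub]; exact union_mem_unions hCu (mem_unions_one.2 hrI))
      (dom_symm_mem_unions hp.1.1 hp.1.2) (by have := L.two_mul_lt; have := L.one_le; omega)
    have hqg : (res g'.symm (dom p.symm)).symm ≤ g' := by
      have := symm_le_symm (res_le g'.symm (dom p.symm))
      rwa [PEquiv.symm_symm] at this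
    have hq := star₂ (res g'.symm (dom p.symm)).symm (L.restrict g' hg' _ hqg)
      (by rw [PEquiv.symm_symm, dom_res hpg']) (by
        intro c d hcd
        refine symm_eq_some.2 (res_eq_some.2 ⟨⟨c, symm_eq_some.2 (res_le _ _ _ _ hcd)⟩, ?_⟩)
        exact symm_eq_some.2 (((le_res hpg Set.subset_union_left).trans hgg') _ _ hcd))
    exact (hq.mem_iff' ha ⟨g', hg', hqg,
      (le_res hrg Set.subset_union_right).trans hgg'⟩).2 hb

end Dichotomy

/-! ### Sets that correspond have the same size -/

section Count

variable [Finite M₁] [Finite M₂] {n : ℕ}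

/-- The preimage of `b'` under `g` is `a` moved by `r`, `f₂` and `g⁻¹` in succession. This composite
takes `h₁` to `h₁'`, as `f₁` does, so the preimage is `a'`. -/
theorem img_sim (hL : L.Compat Y₁ Y₂) {m : ℕ} {h₁ h₁' : Fin m → M₁} {h₂ h₂' : Fin m → M₂}
    {r g : M₁ ≃. M₂} {a a' : HF M₁} {b b' : HF M₂} (hr : L.Sim n r a b)
    (hd : dom r = Set.range h₁) (hrh : ∀ i, r (h₁ i) = some (h₂ i))
    (ha : L.Img Y₁ n h₁ a h₁' a') (hb : L.flip.Img Y₂ n h₂ b h₂' b') (hg : g ∈ L.K)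
    (hgh : ∀ i, g (h₁' i) = some (h₂' i)) : L.Sim n (res g (Set.range h₁')) a' b' := by
  obtain ⟨f₁, hf₁, hfh₁, ha⟩ := ha
  obtain ⟨f₂, hf₂, hfh₂, hb⟩ := hb
  have hgd : Set.range h₁' ⊆ dom g := by
    rintro _ ⟨i, rfl⟩
    exact ⟨_, hgh i⟩
  have hgd' : dom (res g (Set.range h₁')).symm = Set.range h₂' := by
    rw [dom_res_symm]
    ext c
    constructor
    · rintro ⟨_, ⟨i, rfl⟩, hc⟩
      exact ⟨i, pequiv_fun (hgh i) hc⟩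
    · rintro ⟨i, rfl⟩
      exact ⟨_, ⟨i, rfl⟩, hgh i⟩
  have hgK : res g (Set.range h₁') ∈ L.K := L.restrict g hg _ (res_le _ _)
  obtain ⟨z, h₃, h₄⟩ := hb.exists_sim (q := (res g (Set.range h₁')).symm)
    (symm_mem_flip.2 hgK) (hgd'.trans (dom_res_range_symm hfh₂).symm)
  have h₅ := h₄.unflip
  have hran : dom ((res f₂ (Set.range h₂)).trans (res g (Set.range h₁')).symm) =
      Set.range h₂ := by
    rw [dom_trans (by rw [hgd', dom_res_range_symm hfh₂]), dom_res_range hfh₂]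
  have hrr : dom r.symm = Set.range h₂ := by
    ext c
    constructor
    · rintro ⟨d, hc⟩
      obtain ⟨i, rfl⟩ := hd.subset ⟨c, symm_eq_some.1 hc⟩
      exact ⟨i, pequiv_fun (hrh i) (symm_eq_some.1 hc)⟩
    · rintro ⟨i, rfl⟩
      exact ⟨_, symm_eq_some.2 (hrh i)⟩
  have hmove := hr.move h₅ (hrr.trans hran.symm)
  have hza : z = a' := by
    refine (hmove.eq_iff_of_le hL ha hf₁ ?_ (res_le _ _)).1 rfl
    intro c d hcd
    obtain ⟨e, h₆, h₇⟩ := trans_eq_some.1 hcd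
    obtain ⟨i, rfl⟩ := hd.subset ⟨e, h₆⟩
    obtain rfl := pequiv_fun (hrh i) h₆
    obtain ⟨e', h₈, h₉⟩ := trans_eq_some.1 h₇
    obtain rfl := pequiv_fun (hfh₂ i) (res_eq_some.1 h₈).2
    rw [pequiv_inj (res_eq_some.1 (symm_eq_some.1 h₉)).2 (hgh i)]
    exact hfh₁ i
  rw [← hza]
  exact sim_flip.1 h₃

/-- Both orbits are counted by classes of invariant equivalence relations over the domain and the
range of `p`. By `img_sim` every map in `K` carries one relation to the other, so the hypothesis on
numbers of classes applies. -/
theorem encard_orbitSet_eq (hL : L.Compat Y₁ Y₂) {s : ℕ}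
    (hP : Sys.PreservesClasses Y₁ Y₂ L.K s) {p r : M₁ ≃. M₂} (hp : dom p ∈ unions L.I₁ s)
    {a : HF M₁} {b : HF M₂} (hr : L.Sim n r a b) (hrI : dom r ∈ L.I₁) (hpr : L.Comp p r) :
    (L.orbitSet Y₁ n (dom p) (dom r) a).encard =
      (L.flip.orbitSet Y₂ n (dom p.symm) (dom r.symm) b).encard := by
  obtain ⟨g, hg, hpg, hrg⟩ := hpr
  obtain ⟨m, h₁, hh₁⟩ := exists_range_eq (dom r)
  choose h₂ hh₂ using fun i => hh₁.subset ⟨i, rfl⟩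
  have hh₂' : Set.range h₂ = dom r.symm := by
    ext c
    constructor
    · rintro ⟨i, rfl⟩
      exact ⟨_, symm_eq_some.2 (hh₂ i)⟩
    · rintro ⟨d, hc⟩
      obtain ⟨i, rfl⟩ := hh₁.superset ⟨c, symm_eq_some.1 hc⟩
      exact ⟨i, pequiv_fun (hh₂ i) (symm_eq_some.1 hc)⟩
  rw [← hh₁, ← hh₂', encard_orbitSet hL hr hh₁.symm,
    encard_orbitSet hL.flip hr.flip hh₂'.symm]
  have hpK := L.restrict g hg _ hpg
  refine hP m (dom p) (dom p.symm) h₁ h₂ _ _ (hL.I₁_eq ▸ hp)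
    (hL.I₂_eq ▸ dom_symm_mem_unions hpK hp) (by rwa [hh₁, ← hL.I₁_eq])
    (by rw [hh₂', ← hL.I₂_eq]; exact (dom_mem_iff hr.wide.1).1 hrI)
    (invariant_orbitSetoid hL hr hh₁.symm) (invariant_orbitSetoid hL.flip hr.flip hh₂'.symm)
    g hg (dom_mono hpg) ?_ (fun i => hrg _ _ (hh₂ i)) ?_
  · rw [← img_dom]
    ext c
    constructor
    · rintro ⟨d, ⟨e, he⟩, hd⟩
      exact ⟨d, ⟨e, he⟩, pequiv_fun (hpg _ _ he) hd ▸ he⟩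
    · rintro ⟨d, hd, h⟩
      exact ⟨d, hd, hpg _ _ h⟩
  · intro g' hg' _ x x' y y' hx hy
    obtain ⟨a₁, ha₁⟩ := hL.exists_img hr hh₁.symm x
    obtain ⟨a₂, ha₂⟩ := hL.exists_img hr hh₁.symm x'
    obtain ⟨b₁, hb₁⟩ := hL.flip.exists_img hr.flip hh₂'.symm y
    obtain ⟨b₂, hb₂⟩ := hL.flip.exists_img hr.flip hh₂'.symm y'
    rw [orbitSetoid_iff hL ha₁ ha₂, orbitSetoid_iff hL.flip hb₁ hb₂]
    have h₃ := img_sim hL hr hh₁.symm hh₂ ha₁ hb₁ hg' hx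
    have h₄ := img_sim hL hr hh₁.symm hh₂ ha₂ hb₂ hg' hy
    have hc : L.Comp (res g' (Set.range x.1)) (res g' (Set.range x'.1)) :=
      ⟨g', hg', res_le _ _, res_le _ _⟩
    constructor
    · rintro rfl
      exact h₃.unique h₄ hc
    · rintro rfl
      exact h₃.injective h₄ hc

/-- `a` is mapped to `b` by an extension of `p`. -/
def Corr (L : Link M₁ M₂) (n : ℕ) (p : M₁ ≃. M₂) (a : HF M₁) (b : HF M₂) : Prop :=
  ∃ r, dom r ∈ L.I₁ ∧ L.Comp p r ∧ L.Sim n r a b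

theorem corr_flip {p : M₁ ≃. M₂} {a : HF M₁} {b : HF M₂} :
    L.flip.Corr n p.symm b a ↔ L.Corr n p a b := by
  constructor
  · rintro ⟨r, h₁, h₂, h₃⟩
    refine ⟨r.symm, (dom_mem_iff (L := L) (p := r.symm) h₃.wide.1).2 h₁, ?_, h₃.unflip⟩
    exact comp_flip.1 (by simpa using h₂)
  · rintro ⟨r, h₁, h₂, h₃⟩
    exact ⟨r.symm, (dom_mem_iff h₃.wide.1).1 h₁, comp_flip.2 h₂, h₃.flip⟩

/-- The fibre over `b` is an orbit. Two extensions of `p` taking elements to `b` differ by a partial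
automorphism that fixes `dom p`; conversely, composing with the inverse of such an automorphism
keeps the map compatible with `p`. -/
theorem corr_iff (hL : L.Compat Y₁ Y₂) {p r : M₁ ≃. M₂} (hp : dom p ∈ unions L.I₁ L.s)
    {a a' : HF M₁} {b : HF M₂} (hr : L.Sim n r a b) (hrI : dom r ∈ L.I₁) (hpr : L.Comp p r) :
    L.Corr n p a' b ↔ a' ∈ L.orbitSet Y₁ n (dom p) (dom r) a := by
  obtain ⟨g, hg, hpg, hrg⟩ := hpr
  constructor
  · rintro ⟨r₂, hrI₂, hpr₂, hr₂⟩
    -- The map `r₂` may have a range different from that of `r`; it is replaced by one with the same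
    -- range, still compatible with `p`.
    obtain ⟨r₃, hr₃, hd₃, ⟨g₃, hg₃, hpg₃, hrg₃⟩, hc₃⟩ := exists_comp_symm hpr₂ hp hr₂.wide.2
      ((dom_mem_iff hr.wide.1).1 hrI)
    obtain ⟨a'', ha''⟩ := hr.exists_preimage hr₃ hd₃
    obtain rfl := hr₂.injective ha'' hc₃
    have hm := hr.move ha'' hd₃.symm
    have hle : r.trans r₃.symm ≤ g.trans g₃.symm := trans_le_trans hrg (symm_le_symm hrg₃)
    have hdom : dom (r.trans r₃.symm) = dom r := dom_trans hd₃.superset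
    refine ⟨_, hL.comp_symm g hg g₃ hg₃, ?_, hdom ▸ dom_mono hle, ?_⟩
    · rintro c ⟨d, hd⟩
      exact trans_eq_some.2 ⟨d, hpg _ _ hd, symm_eq_some.2 (hpg₃ _ _ hd)⟩
    · convert hm using 1
      exact eq_of_le_of_dom (res_le _ _) hle (by rw [dom_res (hdom ▸ dom_mono hle), hdom])
  · rintro ⟨f, hf, hfp, hrf, hm⟩
    have hK : f.symm.trans g ∈ L.K := hL.comp_left g hg _ (hL.symm₁ f hf)
    have hle : (res f (dom r)).symm.trans r ≤ f.symm.trans g :=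
      trans_le_trans (symm_le_symm (res_le _ _)) hrg
    have hfd : dom (res f (dom r)) = dom r := dom_res hrf
    have hd : dom ((res f (dom r)).symm.trans r) = dom (res f (dom r)).symm :=
      dom_trans (by rw [PEquiv.symm_symm, hfd])
    obtain ⟨y, h₁, h₂⟩ := hm.exists_sim (L.restrict _ hK _ hle) hd
    rw [trans_cancel hfd.superset] at h₂
    obtain rfl := hr.unique h₂ (comp_self hr.wide.1)
    refine ⟨_, ?_, ⟨_, hK, ?_, hle⟩, h₁⟩
    · rw [dom_mem_iff h₁.wide.1, dom_trans_symm (by rw [PEquiv.symm_symm, hfd])]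
      exact (dom_mem_iff hr.wide.1).1 hrI
    · intro c d hcd
      exact trans_eq_some.2 ⟨c, symm_eq_some.2 (hfp c ⟨d, hcd⟩), hpg _ _ hcd⟩

/-- The relation `Corr n p` is total on both sets because supports are narrow and fit next to `p`.
It is difunctional with fibres that are orbits, and corresponding orbits have equal size. -/
theorem encard_eq_of_sim (hL : L.Compat Y₁ Y₂) {s : ℕ} (hs : s ≤ L.s)
    (hP : Sys.PreservesClasses Y₁ Y₂ L.K s) {p : M₁ ≃. M₂} (hpK : p ∈ L.K)
    (hp : dom p ∈ unions L.I₁ s) {X₁ : Set (HF M₁)} {X₂ : Set (HF M₂)}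
    (h₁ : ∀ a ∈ X₁, ∃ r b, dom r ∈ L.I₁ ∧ L.Sim n r a b)
    (h₂ : ∀ b ∈ X₂, ∃ r a, dom r ∈ L.I₁ ∧ L.Sim n r a b)
    (h : ∀ g ∈ L.K, p ≤ g → ∀ r ≤ g, dom r ∈ L.I₁ → ∀ a b, L.Sim n r a b → (a ∈ X₁ ↔ b ∈ X₂)) :
    X₁.encard = X₂.encard := by
  have hp' := unions_mono L.empty₁ hs hp
  refine encard_eq_of_difunctional (L.Corr n p) ?_ ?_ ?_ ?_ ?_
  · intro a ha
    obtain ⟨r, b, hrI, hr⟩ := h₁ a ha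
    obtain ⟨q, hq, hqd, hpq, -⟩ := exists_comp (comp_self hpK) hp' hp' hrI
    obtain ⟨b', hb'⟩ := hr.exists_image hq hqd
    exact ⟨b', q, hqd ▸ hrI, hpq, hb'⟩
  · intro b hb
    obtain ⟨r, a, hrI, hr⟩ := h₂ b hb
    obtain ⟨q, hq, hqd, hpq, -⟩ := exists_comp_symm (comp_self hpK) hp' hp'
      ((dom_mem_iff hr.wide.1).1 hrI)
    obtain ⟨a', ha'⟩ := hr.exists_preimage hq hqd
    exact ⟨a', q, (dom_mem_iff hq).2 (hqd ▸ (dom_mem_iff hr.wide.1).1 hrI), hpq, ha'⟩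
  · rintro a b ⟨r, hrI, ⟨g, hg, hpg, hrg⟩, hr⟩
    exact h g hg hpg r hrg hrI a b hr
  · rintro a b a' b' ⟨r, hrI, hpr, hr⟩ h' ⟨r', hrI', hpr', hr'⟩
    rw [corr_iff hL hp' hr' hrI' hpr']
    obtain ⟨r₂, -, hpr₂, hr₂⟩ := h'
    -- Both fibres must be written as orbits over one support, so `r₂` is traded for a map `q` with
    -- the domain of `r'`.
    obtain ⟨q, hq, hqd, hpq, hrq⟩ := exists_comp hpr₂ hp' hr₂.wide.2 hrI'
    obtain ⟨y, hy⟩ := hr'.exists_image hq hqd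
    obtain rfl := hr₂.unique hy hrq
    rw [← hqd, ← corr_iff hL hp' hy (hqd ▸ hrI') hpq]
    exact ⟨r, hrI, hpr, hr⟩
  · rintro a b ⟨r, hrI, hpr, hr⟩
    have e₁ : {a' | L.Corr n p a' b} = L.orbitSet Y₁ n (dom p) (dom r) a := by
      ext a'
      exact corr_iff hL hp' hr hrI hpr
    have e₂ : {b' | L.Corr n p a b'} = L.flip.orbitSet Y₂ n (dom p.symm) (dom r.symm) b := by
      ext b'
      change L.Corr n p a b' ↔ _
      rw [← corr_flip]
      exact corr_iff hL.flip (dom_symm_mem_unions hpK hp') hr.flip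
        ((dom_mem_iff hr.wide.1).1 hrI) (comp_flip.2 hpr)
    obtain ⟨m₁, k₁, hk₁⟩ := exists_range_eq (dom r)
    obtain ⟨m₂, k₂, hk₂⟩ := exists_range_eq (dom r.symm)
    rw [e₁, e₂]
    refine ⟨?_, ?_, encard_orbitSet_eq hL hP hp hr hrI hpr⟩
    · rw [← hk₁]
      exact finite_orbitSet hL hr hk₁.symm
    · rw [← hk₂]
      exact finite_orbitSet hL.flip hr.flip hk₂.symm

end Count

end Link

/-! ### Formulas -/

section Formula

variable {τ : FirstOrder.Language.{u, v}} {m : ℕ}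

theorem Formula.Fits.card_le {k s : ℕ} (hs : s ≤ k) {φ : Formula τ m} (h : φ.Fits k s) :
    φ.freeVars.card ≤ k := by
  induction φ with
  | eq | mem | pred | rel | graph => exact h
  | neg φ ih => exact ih h
  | and φ ψ => exact h.2.2
  | ex x φ ih => exact Finset.card_erase_le.trans (ih h)
  | cardEq x θ z => exact h.2.2
  | cardGT t x θ => exact h.2.trans hs

end Formula

/-! ### Successors -/

section Succ

variable {τ : FirstOrder.Language.{u, v}} {M : Type w} [τ.Structure M]

/-- The set defined by `ψ(x; ȳ)` in a state. -/
def State.definable {m : ℕ} (S : State M m) (ψ : Formula τ m) (v : ℕ → HF M) : Set (HF M) :=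
  {a | a ∈ S.N ∧ S.Realize ψ (Function.update v 0 a)}

theorem Scheme.mem_succ {Υ : Scheme τ} {b : ℕ∞} {S : State M Υ.m₁} {x : HF M} :
    x ∈ (Υ.succ b S).N ↔
      x ∈ S.N ∨ ∃ l, x ∈ S.family (Υ.ψ l) ∧ (S.family (Υ.ψ l)).encard ≤ b := Iff.rfl

theorem Scheme.succ_c_eq_some {Υ : Scheme τ} {b : ℕ∞} {S : State M Υ.m₁} {x : HF M}
    {l : Fin Υ.m₁} : (Υ.succ b S).c l = some x ↔
      x ∈ (Υ.succ b S).N ∧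
        HF.IsSetOf x {a | a ∈ S.N ∧ S.Realize (Υ.φ l) fun _ => a} := by
  classical
  change (if h : ∃ x ∈ (Υ.succ b S).N, HF.IsSetOf x {a | a ∈ S.N ∧ S.Realize (Υ.φ l) fun _ => a}
      then some h.choose else none) = some x ↔ _
  split_ifs with h
  · rw [Option.some_inj]
    constructor
    · rintro rfl
      exact h.choose_spec
    · exact fun hx => h.choose_spec.2.unique hx.2
  · exact ⟨fun h' => absurd h' (by simp), fun hx => absurd ⟨x, hx⟩ h⟩

end Succ

namespace Link

variable {τ : FirstOrder.Language.{u, v}} {M₁ : Type w} {M₂ : Type w'} [τ.Structure M₁]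
  [τ.Structure M₂]

/-- A link by partial isomorphisms between systems that preserves the numbers of classes. -/
structure Super (τ : FirstOrder.Language.{u, v}) [τ.Structure M₁] [τ.Structure M₂]
    (L : Link M₁ M₂) (Y₁ : Sys M₁) (Y₂ : Sys M₂) (s : ℕ) : Prop where
  compat : L.Compat Y₁ Y₂
  le : s ≤ L.s
  preserves : Sys.PreservesClasses Y₁ Y₂ L.K s
  partialIso : ∀ g ∈ L.K, IsPartialIso τ g

variable {L : Link M₁ M₂} {Y₁ : Sys M₁} {Y₂ : Sys M₂} {s : ℕ}

theorem isPartialIso_symm {g : M₁ ≃. M₂} (h : IsPartialIso τ g) : IsPartialIso τ g.symm where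
  rel R x y hxy := (h.rel R y x fun i => symm_eq_some.1 (hxy i)).symm
  graph F x y a b hxy hab := (h.graph F y x b a (fun i => symm_eq_some.1 (hxy i))
    (symm_eq_some.1 hab)).symm

theorem Super.flip (h : L.Super τ Y₁ Y₂ s) : L.flip.Super τ Y₂ Y₁ s where
  compat := h.compat.flip
  le := h.le
  preserves := by
    intro m A₂ A₁ h₂ h₁ E₂ E₁ hA₂ hA₁ hh₂ hh₁ hE₂ hE₁ g hg hgd hgA hgh hmap
    refine (h.preserves m A₁ A₂ h₁ h₂ E₁ E₂ hA₁ hA₂ hh₁ hh₂ hE₁ hE₂ g.symm hg ?_ ?_ ?_ ?_).symm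
    · rw [← hgA]
      exact img_subset_dom_symm _ _
    · rw [← hgA, img_symm_img hgd]
    · exact fun i => symm_eq_some.2 (hgh i)
    · intro g' hg' hgg' x y x' y' hx hy
      refine (hmap g'.symm (symm_mem_flip.2 hg') (fun c hc => ?_) x' y' x y
        (fun i => symm_eq_some.2 (hx i)) (fun i => symm_eq_some.2 (hy i))).symm
      obtain ⟨d, hd⟩ := hgd hc
      rw [hd]
      have hdA : d ∈ A₁ := hgA ▸ ⟨c, hc, hd⟩
      refine symm_eq_some.2 ?_
      rw [hgg' d hdA]
      exact symm_eq_some.2 hd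
  partialIso g hg := by
    have := isPartialIso_symm (h.partialIso _ hg)
    rwa [PEquiv.symm_symm] at this

/-! ### Similar states -/

/-- The action of the link takes one state to the other. -/
structure Similar {m : ℕ} (L : Link M₁ M₂) (n : ℕ) (S₁ : State M₁ m) (S₂ : State M₂ m) : Prop where
  supp₁ : ∀ a ∈ S₁.N, ∃ r b, dom r ∈ L.I₁ ∧ L.Sim n r a b
  supp₂ : ∀ b ∈ S₂.N, ∃ r a, dom r ∈ L.I₁ ∧ L.Sim n r a b
  mem_iff : ∀ p a b, L.Sim n p a b → (a ∈ S₁.N ↔ b ∈ S₂.N)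
  c_iff : ∀ p a b l, L.Sim n p a b → (S₁.c l = some a ↔ S₂.c l = some b)

/-- The values of `v` at `J` are mapped to those of `w` by `g`. -/
def Val (L : Link M₁ M₂) (n : ℕ) (g : M₁ ≃. M₂) (J : Finset ℕ) (v : ℕ → HF M₁) (w : ℕ → HF M₂) :
    Prop := ∀ j ∈ J, ∃ r ≤ g, dom r ∈ L.I₁ ∧ L.Sim n r (v j) (w j)

variable {n m : ℕ} {S₁ : State M₁ m} {S₂ : State M₂ m}

theorem Similar.flip (h : L.Similar n S₁ S₂) : L.flip.Similar n S₂ S₁ where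
  supp₁ b hb :=
    let ⟨r, a, hr, hs⟩ := h.supp₂ b hb
    ⟨r.symm, a, (dom_mem_iff hs.wide.1).1 hr, hs.flip⟩
  supp₂ a ha :=
    let ⟨r, b, hr, hs⟩ := h.supp₁ a ha
    ⟨r.symm, b, (dom_mem_iff hs.wide.1).1 hr, hs.flip⟩
  mem_iff _ _ _ hp := (h.mem_iff _ _ _ hp.unflip).symm
  c_iff _ _ _ l hp := (h.c_iff _ _ _ l hp.unflip).symm

theorem Val.mono {g g' : M₁ ≃. M₂} {J : Finset ℕ} {v : ℕ → HF M₁} {w : ℕ → HF M₂}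
    (h : L.Val n g J v w) (hg : g ≤ g') : L.Val n g' J v w := fun j hj =>
  let ⟨r, hr, hs⟩ := h j hj
  ⟨r, hr.trans hg, hs⟩

theorem Val.flip {g : M₁ ≃. M₂} {J : Finset ℕ} {v : ℕ → HF M₁} {w : ℕ → HF M₂}
    (h : L.Val n g J v w) : L.flip.Val n g.symm J w v := fun j hj =>
  let ⟨r, hr, hI, hs⟩ := h j hj
  ⟨r.symm, symm_le_symm hr, (dom_mem_iff hs.wide.1).1 hI, hs.flip⟩

/-- Only the supports of the values need to be kept, which leaves room for extending the map
further. -/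
theorem Val.exists_le {g : M₁ ≃. M₂} {J : Finset ℕ} {v : ℕ → HF M₁} {w : ℕ → HF M₂}
    (h : L.Val n g J v w) {i : ℕ} (hi : J.card ≤ i) :
    ∃ p ≤ g, dom p ∈ unions L.I₁ i ∧ L.Val n p J v w := by
  have : ∀ j, ∃ r ≤ g, j ∈ J → dom r ∈ L.I₁ ∧ L.Sim n r (v j) (w j) := fun j => by
    by_cases hj : j ∈ J
    · obtain ⟨r, hr, hs⟩ := h j hj
      exact ⟨r, hr, fun _ => hs⟩
    · exact ⟨g, le_rfl, fun hj' => absurd hj' hj⟩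
  choose r hr hs using this
  refine ⟨res g (⋃ j ∈ J, dom (r j)), res_le _ _, ?_, fun j hj =>
    ⟨r j, le_res (hr j) (Set.subset_biUnion_of_mem (u := fun j => dom (r j)) hj), hs j hj⟩⟩
  rw [dom_res (Set.iUnion₂_subset fun j _ => dom_mono (hr j))]
  exact biUnion_mem_unions L.empty₁ J (fun j hj => (hs j hj).1) hi

theorem Val.update {g g' r : M₁ ≃. M₂} {J : Finset ℕ} {v : ℕ → HF M₁} {w : ℕ → HF M₂} {x : ℕ}
    {a : HF M₁} {b : HF M₂} (h : L.Val n g (J.erase x) v w) (hg : g ≤ g') (hr : r ≤ g')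
    (hrI : dom r ∈ L.I₁) (hab : L.Sim n r a b) :
    L.Val n g' J (Function.update v x a) (Function.update w x b) := by
  intro j hj
  by_cases hjx : j = x
  · subst hjx
    exact ⟨r, hr, hrI, by simpa using hab⟩
  · simpa [hjx] using h.mono hg j (Finset.mem_erase.2 ⟨hjx, hj⟩)

/-! ### Preservation of formulas under the action. -/

section Elementary

variable [Finite M₁] [Finite M₂]

theorem relHF_of_sim {l : ℕ} (R : τ.Relations l) {g : M₁ ≃. M₂} (hg : IsPartialIso τ g)
    {x : Fin l → HF M₁} {y : Fin l → HF M₂} (h : ∀ i, ∃ r ≤ g, L.Sim n r (x i) (y i))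
    (hx : relHF R x) : relHF R y := by
  obtain ⟨a, ha, hR⟩ := hx
  have : ∀ i, ∃ b, y i = HF.atom b ∧ g (a i) = some b := fun i => by
    obtain ⟨r, hr, hs⟩ := h i
    rw [ha i] at hs
    obtain ⟨b, hb, hrb⟩ := hs.exists_atom
    exact ⟨b, hb, hr _ _ hrb⟩
  choose b hb hgb using this
  exact ⟨b, hb, (hg.rel R a b hgb).1 hR⟩

theorem relHF_iff {l : ℕ} (R : τ.Relations l) {g : M₁ ≃. M₂} (hg : IsPartialIso τ g)
    {x : Fin l → HF M₁} {y : Fin l → HF M₂} (h : ∀ i, ∃ r ≤ g, L.Sim n r (x i) (y i)) :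
    relHF R x ↔ relHF R y := by
  refine ⟨relHF_of_sim R hg h, relHF_of_sim (L := L.flip) (n := n) R (isPartialIso_symm hg) ?_⟩
  intro i
  obtain ⟨r, hr, hs⟩ := h i
  exact ⟨r.symm, symm_le_symm hr, hs.flip⟩

theorem graphHF_of_sim {l : ℕ} (F : τ.Functions l) {g : M₁ ≃. M₂} (hg : IsPartialIso τ g)
    {x : Fin l → HF M₁} {y : Fin l → HF M₂} {c : HF M₁} {d : HF M₂}
    (h : ∀ i, ∃ r ≤ g, L.Sim n r (x i) (y i)) (h' : ∃ r ≤ g, L.Sim n r c d)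
    (hx : graphHF F x c) : graphHF F y d := by
  obtain ⟨a, ha, hF⟩ := hx
  have : ∀ i, ∃ b, y i = HF.atom b ∧ g (a i) = some b := fun i => by
    obtain ⟨r, hr, hs⟩ := h i
    rw [ha i] at hs
    obtain ⟨b, hb, hrb⟩ := hs.exists_atom
    exact ⟨b, hb, hr _ _ hrb⟩
  choose b hb hgb using this
  obtain ⟨r, hr, hs⟩ := h'
  rw [hF] at hs
  obtain ⟨e, he, hre⟩ := hs.exists_atom
  exact ⟨b, hb, by rw [he, (hg.graph F a b _ _ hgb (hr _ _ hre)).1 rfl]⟩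

theorem graphHF_iff {l : ℕ} (F : τ.Functions l) {g : M₁ ≃. M₂} (hg : IsPartialIso τ g)
    {x : Fin l → HF M₁} {y : Fin l → HF M₂} {c : HF M₁} {d : HF M₂}
    (h : ∀ i, ∃ r ≤ g, L.Sim n r (x i) (y i)) (h' : ∃ r ≤ g, L.Sim n r c d) :
    graphHF F x c ↔ graphHF F y d := by
  refine ⟨graphHF_of_sim F hg h h', graphHF_of_sim (L := L.flip) (n := n) F
    (isPartialIso_symm hg) ?_ ?_⟩
  · intro i
    obtain ⟨r, hr, hs⟩ := h i
    exact ⟨r.symm, symm_le_symm hr, hs.flip⟩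
  · obtain ⟨r, hr, hs⟩ := h'
    exact ⟨r.symm, symm_le_symm hr, hs.flip⟩

/-- The map carrying the element is made compatible with a further `q`, so that several elements can
be compared at once. -/
theorem Sim.exists_mem {p q : M₁ ≃. M₂} {x a : HF M₁} {y : HF M₂} (h : L.Sim n p x y)
    (ha : HF.Mem a x) (hpq : L.Comp p q) (hq : dom q ∈ unions L.I₁ L.s) :
    ∃ r b, dom r ∈ L.I₁ ∧ L.Comp p r ∧ L.Comp q r ∧ HF.Mem b y ∧ L.Sim n r a b := by
  cases n with
  | zero => exact h.elim
  | succ n =>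
    rcases h.2 with ⟨c, d, rfl, -⟩ | ⟨-, -, h₁, -⟩
    · exact absurd ha (HF.not_mem_atom _ _)
    · obtain ⟨C, hC, h₂⟩ := h₁ a ha
      obtain ⟨r, hr, hrC, hpr, hqr⟩ := exists_comp hpq h.1.2 hq hC
      obtain ⟨b, hb, hab⟩ := h₂ r hr hrC hpr
      exact ⟨r, b, hrC ▸ hC, hpr, hqr, hb, hab.succ⟩

theorem Sim.exists_mem_symm {p q : M₁ ≃. M₂} {x : HF M₁} {y b : HF M₂} (h : L.Sim n p x y)
    (hb : HF.Mem b y) (hpq : L.Comp p q) (hq : L.Wide q) :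
    ∃ r a, dom r ∈ L.I₁ ∧ L.Comp p r ∧ L.Comp q r ∧ HF.Mem a x ∧ L.Sim n r a b := by
  obtain ⟨r, a, h₁, h₂, h₃, h₄, h₅⟩ := h.flip.exists_mem hb (comp_flip.2 hpq) hq.flip.2
  rw [← PEquiv.symm_symm r, comp_flip] at h₂ h₃
  exact ⟨r.symm, a, (dom_mem_iff h₅.unflip.wide.1).2 h₁, h₂, h₃, h₄, h₅.unflip⟩

/-- By induction on `l`: the predecessor is an element and has an image, and the remaining elements
are compared through maps compatible with the one carrying the predecessor. -/
theorem isNumeral_of_sim {l : ℕ} {p : M₁ ≃. M₂} {x : HF M₁} {y : HF M₂} (h : L.Sim n p x y)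
    (hx : HF.IsNumeral l x) : HF.IsNumeral l y := by
  have hpp := comp_self h.wide.1
  induction l generalizing p x y with
  | zero =>
    refine ⟨h.isSet_iff.1 hx.1, fun b => ⟨fun hb => ?_, fun hb => hb.elim⟩⟩
    obtain ⟨r, a, -, -, -, ha, -⟩ := h.exists_mem_symm hb hpp h.wide
    exact (hx.2 a).1 ha
  | succ l ih =>
    obtain ⟨c, hc, hx⟩ := hx
    obtain ⟨r, d, -, hpr, -, hd, hr⟩ := h.exists_mem ((hx.2 c).2 (Or.inr rfl)) hpp h.wide.2
    refine ⟨d, ih hr hc (comp_self hr.wide.1), h.isSet_iff.1 hx.1, fun b => ⟨fun hb => ?_, ?_⟩⟩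
    · obtain ⟨q, a, -, -, hrq, ha, hq⟩ := h.exists_mem_symm hb hpr hr.wide
      rcases (hx.2 a).1 ha with ha | rfl
      · exact Or.inl ((hr.mem_iff hq hrq).1 ha)
      · exact Or.inr (hq.unique hr hrq.symm)
    · rintro (hb | rfl)
      · obtain ⟨q, a, -, -, hpq, ha, hq⟩ := hr.exists_mem_symm hb hpr.symm h.wide
        exact (h.mem_iff hq hpq).1 ((hx.2 a).2 (Or.inl ha))
      · exact hd

theorem isNumeral_iff {l : ℕ} {p : M₁ ≃. M₂} {x : HF M₁} {y : HF M₂} (h : L.Sim n p x y) :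
    HF.IsNumeral l x ↔ HF.IsNumeral l y :=
  ⟨isNumeral_of_sim h, isNumeral_of_sim h.flip⟩

theorem exists_sim_atom (a : M₁) : ∃ r b, dom r ∈ L.I₁ ∧ L.Sim 1 r (HF.atom a) b := by
  obtain ⟨r, hr, hd⟩ := exists_dom_eq (L := L) (B := {a}) (unions_mono L.empty₁
    (by have := L.two_mul_lt; omega) (mem_unions_one.2 (L.singleton₁ a)))
  obtain ⟨b, hb⟩ := hd.superset rfl
  have hI : dom r ∈ L.I₁ := hd ▸ L.singleton₁ a
  exact ⟨r, HF.atom b, hI, wide_of_narrow hr hI, Or.inl ⟨a, b, rfl, rfl, hb⟩⟩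

theorem exists_sim_atom_symm (b : M₂) : ∃ r a, dom r ∈ L.I₁ ∧ L.Sim 1 r a (HF.atom b) := by
  obtain ⟨r, a, hr, hs⟩ := exists_sim_atom (L := L.flip) b
  exact ⟨r.symm, a, (dom_mem_iff hs.unflip.wide.1).2 hr, hs.unflip⟩

theorem Sim.atom_iff {p : M₁ ≃. M₂} {x : HF M₁} {y : HF M₂} (h : L.Sim n p x y) :
    x ∈ Set.range HF.atom ↔ y ∈ Set.range HF.atom := by
  constructor
  · rintro ⟨a, rfl⟩
    obtain ⟨b, rfl, -⟩ := h.exists_atom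
    exact ⟨b, rfl⟩
  · rintro ⟨b, rfl⟩
    obtain ⟨a, rfl, -⟩ := h.flip.exists_atom
    exact ⟨a, rfl⟩

/-- The urelements form an invariant set, so counting over the empty map applies. The equality is
needed for `cardGT`, whose threshold depends on the size of the structure. -/
theorem Super.card_eq (hS : L.Super τ Y₁ Y₂ s) : Nat.card M₁ = Nat.card M₂ := by
  obtain ⟨g, hg⟩ := L.nonempty
  have hd0 : dom (res g ∅) = ∅ := dom_res (Set.empty_subset _)
  have := encard_eq_of_sim hS.compat (n := 1) hS.le hS.preserves
    (L.restrict g hg _ (res_le g ∅))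
    (unions_mono L.empty₁ (Nat.zero_le s) (by rw [hd0, unions_zero]; rfl))
    (X₁ := Set.range HF.atom) (X₂ := Set.range HF.atom) ?_ ?_ ?_
  · rw [← Set.image_univ, ← Set.image_univ, HF.atom_injective.encard_image,
      HF.atom_injective.encard_image, Set.encard_univ, Set.encard_univ] at this
    rw [ENat.card_eq_coe_natCard, ENat.card_eq_coe_natCard] at this
    exact_mod_cast this
  · rintro _ ⟨a, rfl⟩
    exact exists_sim_atom a
  · rintro _ ⟨b, rfl⟩
    exact exists_sim_atom_symm b
  · exact fun _ _ _ _ _ _ _ _ hr => hr.atom_iff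

/-- Extension of `p` to an element of the first state. -/
theorem Similar.exists_ext (h : L.Similar n S₁ S₂) {p g : M₁ ≃. M₂} (hg : g ∈ L.K) (hpg : p ≤ g)
    {i : ℕ} (hp : dom p ∈ unions L.I₁ i) (hi : i + 1 ≤ L.k) {a : HF M₁} (ha : a ∈ S₁.N) :
    ∃ g' ∈ L.K, p ≤ g' ∧ ∃ r ≤ g', dom r ∈ L.I₁ ∧ ∃ b ∈ S₂.N, L.Sim n r a b := by
  obtain ⟨r, b, hrI, hr⟩ := h.supp₁ a ha
  obtain ⟨g', hg', hpg', hrg'⟩ := Link.exists_ext hg hpg hp (mem_unions_one.2 hrI) hi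
  obtain ⟨b', hb'⟩ := hr.exists_image (L.restrict g' hg' _ (res_le g' _)) (dom_res hrg')
  exact ⟨g', hg', hpg', _, res_le _ _, by rwa [dom_res hrg'], b', (h.mem_iff _ _ _ hb').1 ha, hb'⟩

theorem Similar.exists_ext_symm (h : L.Similar n S₁ S₂) {p g : M₁ ≃. M₂} (hg : g ∈ L.K)
    (hpg : p ≤ g) {i : ℕ} (hp : dom p ∈ unions L.I₁ i) (hi : i + 1 ≤ L.k) {b : HF M₂}
    (hb : b ∈ S₂.N) :
    ∃ g' ∈ L.K, p ≤ g' ∧ ∃ r ≤ g', dom r ∈ L.I₁ ∧ ∃ a ∈ S₁.N, L.Sim n r a b := by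
  obtain ⟨g', hg', hpg', r, hr, hrI, a, ha, hs⟩ := h.flip.exists_ext (symm_mem_flip.2 hg)
    (symm_le_symm hpg) (dom_symm_mem_unions (L.restrict g hg _ hpg) hp) hi hb
  refine ⟨g'.symm, hg', ?_, r.symm, symm_le_symm hr, (dom_mem_iff hs.unflip.wide.1).2 hrI, a, ha,
    hs.unflip⟩
  have := symm_le_symm hpg'
  rwa [PEquiv.symm_symm] at this

theorem realize_ex_iff (h : L.Similar n S₁ S₂) {φ : Formula τ m} {x : ℕ}
    (hφ : φ.freeVars.card ≤ L.k)
    (ih : ∀ {g : M₁ ≃. M₂}, g ∈ L.K → ∀ {v : ℕ → HF M₁} {w : ℕ → HF M₂},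
      L.Val n g φ.freeVars v w → (S₁.Realize φ v ↔ S₂.Realize φ w)) {g : M₁ ≃. M₂}
    (hg : g ∈ L.K) {v : ℕ → HF M₁} {w : ℕ → HF M₂}
    (hv : L.Val n g (φ.freeVars.erase x) v w) :
    (∃ a ∈ S₁.N, S₁.Realize φ (Function.update v x a)) ↔
      ∃ b ∈ S₂.N, S₂.Realize φ (Function.update w x b) := by
  by_cases hx : x ∈ φ.freeVars
  · have hc : (φ.freeVars.erase x).card ≤ L.k - 1 := by
      rw [Finset.card_erase_of_mem hx]
      omega
    have hk : L.k - 1 + 1 ≤ L.k := by have := L.two_mul_lt; omega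
    obtain ⟨p, hpg, hp, hpv⟩ := hv.exists_le hc
    constructor
    · rintro ⟨a, ha, hav⟩
      obtain ⟨g', hg', hpg', r, hr, hrI, b, hb, hs⟩ := h.exists_ext hg hpg hp hk ha
      exact ⟨b, hb, (ih hg' (hpv.update hpg' hr hrI hs)).1 hav⟩
    · rintro ⟨b, hb, hbv⟩
      obtain ⟨g', hg', hpg', r, hr, hrI, a, ha, hs⟩ := h.exists_ext_symm hg hpg hp hk hb
      exact ⟨a, ha, (ih hg' (hpv.update hpg' hr hrI hs)).2 hbv⟩
  -- If `x` is not free there may be `k` parameters and no room for another support. The value at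
  -- `x` is then irrelevant, and any element of the other collection will do.
  · have key : ∀ a b, L.Val n g φ.freeVars (Function.update v x a) (Function.update w x b) := by
      intro a b j hj
      have hjx : j ≠ x := fun e => hx (e ▸ hj)
      simpa [hjx] using hv j (Finset.mem_erase.2 ⟨hjx, hj⟩)
    constructor
    · rintro ⟨a, ha, hav⟩
      obtain ⟨r, b, -, hr⟩ := h.supp₁ a ha
      exact ⟨b, (h.mem_iff _ _ _ hr).1 ha, (ih hg (key a b)).1 hav⟩
    · rintro ⟨b, hb, hbv⟩
      obtain ⟨r, a, -, hr⟩ := h.supp₂ b hb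
      exact ⟨a, (h.mem_iff _ _ _ hr).2 hb, (ih hg (key a b)).2 hbv⟩

/-- The at most `s` parameters are handled by one wide `p`. The two solution sets correspond under
all extensions of `p`, which is what counting requires. -/
theorem encard_realize_eq (hS : L.Super τ Y₁ Y₂ s) (h : L.Similar n S₁ S₂) {θ : Formula τ m}
    {x : ℕ} (hθ : (θ.freeVars.erase x).card ≤ s)
    (ih : ∀ {g : M₁ ≃. M₂}, g ∈ L.K → ∀ {v : ℕ → HF M₁} {w : ℕ → HF M₂},
      L.Val n g θ.freeVars v w → (S₁.Realize θ v ↔ S₂.Realize θ w)) {g : M₁ ≃. M₂}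
    (hg : g ∈ L.K) {v : ℕ → HF M₁} {w : ℕ → HF M₂}
    (hv : L.Val n g (θ.freeVars.erase x) v w) :
    {a | a ∈ S₁.N ∧ S₁.Realize θ (Function.update v x a)}.encard =
      {b | b ∈ S₂.N ∧ S₂.Realize θ (Function.update w x b)}.encard := by
  obtain ⟨p, hpg, hp, hpv⟩ := hv.exists_le hθ
  refine encard_eq_of_sim hS.compat hS.le hS.preserves (L.restrict g hg _ hpg) hp
    (fun a ha => h.supp₁ a ha.1) (fun b hb => h.supp₂ b hb.1) ?_
  intro g' hg' hpg' r hr hrI a b hs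
  exact and_congr (h.mem_iff _ _ _ hs) (ih hg' (hpv.update hpg' hr hrI hs))

/-- Formulas that fit are preserved by the action of the link. -/
theorem realize_iff (hS : L.Super τ Y₁ Y₂ s) (h : L.Similar n S₁ S₂) {φ : Formula τ m}
    (hφ : φ.Fits L.k s) {g : M₁ ≃. M₂} (hg : g ∈ L.K) {v : ℕ → HF M₁} {w : ℕ → HF M₂}
    (hv : L.Val n g φ.freeVars v w) : S₁.Realize φ v ↔ S₂.Realize φ w := by
  have hsk : s ≤ L.k := by have := hS.le; have := L.two_mul_lt; omega
  induction φ generalizing g v w with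
  | eq x y =>
    obtain ⟨r, hr, -, h₁⟩ := hv x (by simp [Formula.freeVars])
    obtain ⟨q, hq, -, h₂⟩ := hv y (by simp [Formula.freeVars])
    have hc : L.Comp r q := ⟨g, hg, hr, hq⟩
    constructor
    · intro e
      change v x = v y at e
      rw [e] at h₁
      exact h₁.unique h₂ hc
    · intro e
      change w x = w y at e
      rw [e] at h₁
      exact h₁.injective h₂ hc
  | mem x y =>
    obtain ⟨r, hr, -, h₁⟩ := hv x (by simp [Formula.freeVars])
    obtain ⟨q, hq, -, h₂⟩ := hv y (by simp [Formula.freeVars])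
    exact h₂.mem_iff h₁ ⟨g, hg, hq, hr⟩
  | pred l x =>
    obtain ⟨r, hr, -, h₁⟩ := hv x (by simp [Formula.freeVars])
    exact h.c_iff _ _ _ l h₁
  | rel R xs =>
    refine relHF_iff (L := L) (n := n) R (hS.partialIso g hg) fun i => ?_
    obtain ⟨r, hr, -, h₁⟩ := hv (xs i) (by simp [Formula.freeVars])
    exact ⟨r, hr, h₁⟩
  | graph F xs y =>
    refine graphHF_iff (L := L) (n := n) F (hS.partialIso g hg) (fun i => ?_) ?_
    · obtain ⟨r, hr, -, h₁⟩ := hv (xs i) (by simp [Formula.freeVars])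
      exact ⟨r, hr, h₁⟩
    · obtain ⟨r, hr, -, h₁⟩ := hv y (by simp [Formula.freeVars])
      exact ⟨r, hr, h₁⟩
  | neg φ ih => exact not_congr (ih hφ hg hv)
  | and φ ψ ih₁ ih₂ =>
    exact and_congr (ih₁ hφ.1 hg fun j hj => hv j (Finset.mem_union_left _ hj))
      (ih₂ hφ.2.1 hg fun j hj => hv j (Finset.mem_union_right _ hj))
  | ex x φ ih =>
    exact realize_ex_iff h (Formula.Fits.card_le hsk (φ := φ) hφ) (fun hg _ _ hv => ih hφ hg hv) hg hv
  | cardEq x θ z ih =>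
    have e := encard_realize_eq hS h (x := x) hφ.2.1 (fun hg _ _ hv => ih hφ.1 hg hv) hg
      (v := v) (w := w) fun j hj => hv j (Finset.mem_insert_of_mem hj)
    obtain ⟨r, -, -, hz⟩ := hv z (Finset.mem_insert_self _ _)
    simp only [State.Realize]
    rw [e]
    exact exists_congr fun l => and_congr_right fun _ => isNumeral_iff hz
  | cardGT t x θ ih =>
    have e := encard_realize_eq hS h (x := x) hφ.2 (fun hg _ _ hv => ih hφ.1 hg hv) hg hv
    simp only [State.Realize]
    rw [e, hS.card_eq]

end Elementary

end Link

namespace Link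

variable {τ : FirstOrder.Language.{u, v}} {M₁ : Type w} {M₂ : Type w'} [τ.Structure M₁]
  [τ.Structure M₂] [Finite M₁] [Finite M₂] {L : Link M₁ M₂} {Y₁ : Sys M₁} {Y₂ : Sys M₂} {s n m : ℕ}
  {S₁ : State M₁ m} {S₂ : State M₂ m}

/-! ### Families of definable sets -/

theorem Similar.mem_definable_iff (hS : L.Super τ Y₁ Y₂ s) (h : L.Similar n S₁ S₂)
    {ψ : Formula τ m} (hψ : ψ.Fits L.k s) {g r : M₁ ≃. M₂} (hg : g ∈ L.K) {v : ℕ → HF M₁}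
    {w : ℕ → HF M₂} (hv : L.Val n g (ψ.freeVars.erase 0) v w) (hr : r ≤ g) (hrI : dom r ∈ L.I₁)
    {a : HF M₁} {b : HF M₂} (hab : L.Sim n r a b) :
    a ∈ S₁.definable ψ v ↔ b ∈ S₂.definable ψ w :=
  and_congr (h.mem_iff _ _ _ hab) (realize_iff hS h hψ hg (hv.update le_rfl hr hrI hab))

/-- A definable set inherits the supports of its elements from the state, and the defining formula
is preserved by every map extending `p`. -/
theorem Similar.sim_definable (hS : L.Super τ Y₁ Y₂ s) (h : L.Similar n S₁ S₂)
    {ψ : Formula τ m} (hψ : ψ.Fits L.k s) {p : M₁ ≃. M₂} (hp : L.Wide p) {v : ℕ → HF M₁}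
    {w : ℕ → HF M₂} (hv : L.Val n p (ψ.freeVars.erase 0) v w) {x : HF M₁} {y : HF M₂}
    (hx : HF.IsSetOf x (S₁.definable ψ v)) (hy : HF.IsSetOf y (S₂.definable ψ w)) :
    L.Sim (n + 1) p x y := by
  refine ⟨hp, Or.inr ⟨hx.1, hy.1, fun a ha => ?_, fun b hb => ?_⟩⟩
  · have ha := (hx.2 a).1 ha
    obtain ⟨r, b, hrI, hr⟩ := h.supp₁ a ha.1
    refine ⟨dom r, hrI, ?_⟩
    rintro q hq hqr ⟨g, hg, hpg, hqg⟩
    obtain ⟨b', hb'⟩ := hr.exists_image hq hqr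
    exact ⟨b', (hy.2 _).2
      ((h.mem_definable_iff hS hψ hg (hv.mono hpg) hqg (hqr ▸ hrI) hb').1 ha), hb'⟩
  · have hb := (hy.2 b).1 hb
    obtain ⟨r, a, hrI, hr⟩ := h.supp₂ b hb.1
    have hrI' := (dom_mem_iff hr.wide.1).1 hrI
    refine ⟨dom r.symm, hrI', ?_⟩
    rintro q hq hqr ⟨g, hg, hpg, hqg⟩
    obtain ⟨a', ha'⟩ := hr.exists_preimage hq hqr
    exact ⟨a', (hx.2 _).2 ((h.mem_definable_iff hS hψ hg (hv.mono hpg) hqg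
      ((dom_mem_iff hq).2 (hqr ▸ hrI')) ha').2 hb), ha'⟩

/-- Only finiteness is at stake: every element of the second set is the image of an element of `x`.
-/
theorem Similar.exists_definable (hS : L.Super τ Y₁ Y₂ s) (h : L.Similar n S₁ S₂)
    {ψ : Formula τ m} (hψ : ψ.Fits L.k s) {p : M₁ ≃. M₂} (hp : L.Wide p) {v : ℕ → HF M₁}
    {w : ℕ → HF M₂} (hv : L.Val n p (ψ.freeVars.erase 0) v w) {x : HF M₁}
    (hx : HF.IsSetOf x (S₁.definable ψ v)) : ∃ y, HF.IsSetOf y (S₂.definable ψ w) := by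
  refine HF.exists_isSetOf ((finite_images (L := L) n x).subset fun b hb => ?_)
  obtain ⟨r, a, hrI, hr⟩ := h.supp₂ b hb.1
  have hrI' := (dom_mem_iff hr.wide.1).1 hrI
  obtain ⟨q, hq, hqr, ⟨g, hg, hpg, hqg⟩, -⟩ := exists_comp_symm (comp_self hp.1) hp.2 hp.2 hrI'
  obtain ⟨a', ha'⟩ := hr.exists_preimage hq hqr
  exact ⟨a', (hx.2 _).2 ((h.mem_definable_iff hS hψ hg (hv.mono hpg) hqg
      ((dom_mem_iff hq).2 (hqr ▸ hrI')) ha').2 hb), q, ha'⟩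

/-- A member of a family is supported by the union of supports of the parameters. -/
theorem Similar.exists_sim_family (hS : L.Super τ Y₁ Y₂ s) (h : L.Similar n S₁ S₂)
    {ψ : Formula τ m} (hψ : ψ.Fits L.k s) (hs : (ψ.freeVars.erase 0).card ≤ s) {p : M₁ ≃. M₂}
    (hp : L.Wide p) {x : HF M₁} (hx : x ∈ S₁.family ψ) :
    ∃ q y, L.Comp p q ∧ dom q ∈ unions L.I₁ s ∧ L.Sim (n + 1) q x y ∧ y ∈ S₂.family ψ := by
  obtain ⟨v, hv, hx⟩ := hx
  choose r b hrI hr using fun j => h.supp₁ (v j) (hv j)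
  have hU : (⋃ j ∈ ψ.freeVars.erase 0, dom (r j)) ∈ unions L.I₁ s :=
    biUnion_mem_unions L.empty₁ _ (fun j _ => hrI j) hs
  obtain ⟨g, hg, hpg, hUg⟩ := Link.exists_ext hp.1 le_rfl hp.2 (unions_mono L.empty₁ hS.le hU)
    (by have := L.two_mul_lt; omega)
  -- A family asks for values in `N` at all variables. Those that are not parameters receive the
  -- default `b j`.
  have : ∀ j, ∃ c ∈ S₂.N, j ∈ ψ.freeVars.erase 0 → L.Sim n (res g (dom (r j))) (v j) c := by
    intro j
    by_cases hj : j ∈ ψ.freeVars.erase 0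
    · have hd : dom (r j) ⊆ dom g :=
        (Set.subset_biUnion_of_mem (u := fun j => dom (r j)) hj).trans hUg
      obtain ⟨c, hc⟩ := (hr j).exists_image (L.restrict g hg _ (res_le _ _)) (dom_res hd)
      exact ⟨c, (h.mem_iff _ _ _ hc).1 (hv j), fun _ => hc⟩
    · exact ⟨b j, (h.mem_iff _ _ _ (hr j)).1 (hv j), fun hj' => absurd hj' hj⟩
  choose w hw hvw using this
  have hd := dom_res hUg
  have hqw : L.Wide (res g (⋃ j ∈ ψ.freeVars.erase 0, dom (r j))) :=
    ⟨L.restrict g hg _ (res_le _ _), by rw [hd]; exact unions_mono L.empty₁ hS.le hU⟩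
  have hval : L.Val n (res g (⋃ j ∈ ψ.freeVars.erase 0, dom (r j))) (ψ.freeVars.erase 0) v w := by
    intro j hj
    have hsub := Set.subset_biUnion_of_mem (u := fun j => dom (r j)) hj
    have hdj : dom (res g (dom (r j))) = dom (r j) := dom_res (hsub.trans hUg)
    exact ⟨_, le_res (res_le _ _) (hdj.subset.trans hsub), by rw [hdj]; exact hrI j, hvw j hj⟩
  obtain ⟨y, hy⟩ := h.exists_definable hS hψ hqw hval hx
  exact ⟨_, y, ⟨g, hg, hpg, res_le _ _⟩, by rwa [hd], h.sim_definable hS hψ hqw hval hx hy,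
    w, hw, hy⟩

/-- Some image of `x` under a map compatible with `p` lies in the second family, and by uniqueness
that image is `y`. -/
theorem Similar.mem_family (hS : L.Super τ Y₁ Y₂ s) (h : L.Similar n S₁ S₂)
    {ψ : Formula τ m} (hψ : ψ.Fits L.k s) (hs : (ψ.freeVars.erase 0).card ≤ s) {p : M₁ ≃. M₂}
    {x : HF M₁} {y : HF M₂} (hp : L.Sim (n + 1) p x y) (hx : x ∈ S₁.family ψ) :
    y ∈ S₂.family ψ := by
  obtain ⟨q, y', hpq, -, hq, hy'⟩ := h.exists_sim_family hS hψ hs hp.wide hx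
  rwa [hp.unique hq hpq]

theorem Similar.mem_family_iff (hS : L.Super τ Y₁ Y₂ s) (h : L.Similar n S₁ S₂)
    {ψ : Formula τ m} (hψ : ψ.Fits L.k s) (hs : (ψ.freeVars.erase 0).card ≤ s) {p : M₁ ≃. M₂}
    {x : HF M₁} {y : HF M₂} (hp : L.Sim (n + 1) p x y) :
    x ∈ S₁.family ψ ↔ y ∈ S₂.family ψ :=
  ⟨h.mem_family hS hψ hs hp, h.flip.mem_family hS.flip hψ hs hp.flip⟩

theorem exists_wide : ∃ p, L.Wide p ∧ dom p = ∅ := by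
  obtain ⟨p, hp, hd⟩ := exists_dom_eq (L := L) (B := ∅)
    (unions_mono L.empty₁ (Nat.zero_le _) (by rw [unions_zero]; rfl))
  exact ⟨p, wide_of_narrow hp (hd ▸ L.empty₁), hd⟩

/-- The members of a small family have supports. -/
theorem Similar.exists_narrow_family (hS : L.Super τ Y₁ Y₂ s) (h : L.Similar n S₁ S₂)
    {ψ : Formula τ m} (hψ : ψ.Fits L.k s) (hs : (ψ.freeVars.erase 0).card ≤ s) {b : ℕ∞}
    (hY : Y₁.IsDichotomical b s) (hb : (S₁.family ψ).encard ≤ b) {p : M₁ ≃. M₂} {x : HF M₁}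
    {y : HF M₂} (hp : L.Sim (n + 1) p x y) (hps : dom p ∈ unions L.I₁ s)
    (hx : x ∈ S₁.family ψ) : ∃ q ≤ p, dom q ∈ L.I₁ ∧ L.Sim (n + 1) q x y := by
  refine exists_narrow hS.compat hY hp ?_ hps ((Set.encard_le_encard ?_).trans hb)
  · obtain ⟨v, -, hx⟩ := hx
    exact hx.1
  -- The orbit of `x` stays inside the family, because `x` and `x'` correspond to the same `y'`; so
  -- the bound on the family bounds the orbit.
  · rintro x' ⟨f, -, -, -, q, -, -, y', h₁, h₂⟩
    exact (h.mem_family_iff hS hψ hs h₁).2 ((h.mem_family_iff hS hψ hs h₂).1 hx)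

theorem Similar.supp_family₁ (hS : L.Super τ Y₁ Y₂ s) (h : L.Similar n S₁ S₂)
    {ψ : Formula τ m} (hψ : ψ.Fits L.k s) (hs : (ψ.freeVars.erase 0).card ≤ s) {b : ℕ∞}
    (hY : Y₁.IsDichotomical b s) (hb : (S₁.family ψ).encard ≤ b) {x : HF M₁}
    (hx : x ∈ S₁.family ψ) : ∃ r y, dom r ∈ L.I₁ ∧ L.Sim (n + 1) r x y := by
  obtain ⟨p, hp, -⟩ := exists_wide (L := L)
  obtain ⟨q, y, -, hqs, hq, -⟩ := h.exists_sim_family hS hψ hs hp hx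
  obtain ⟨r, -, hrI, hr⟩ := h.exists_narrow_family hS hψ hs hY hb hq hqs hx
  exact ⟨r, y, hrI, hr⟩

/-- Smallness and dichotomy on the first side suffice: the member is pulled back, its support is
shrunk there, and the smaller map still reaches `y`. -/
theorem Similar.supp_family₂ (hS : L.Super τ Y₁ Y₂ s) (h : L.Similar n S₁ S₂)
    {ψ : Formula τ m} (hψ : ψ.Fits L.k s) (hs : (ψ.freeVars.erase 0).card ≤ s) {b : ℕ∞}
    (hY : Y₁.IsDichotomical b s) (hb : (S₁.family ψ).encard ≤ b) {y : HF M₂}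
    (hy : y ∈ S₂.family ψ) : ∃ r x, dom r ∈ L.I₁ ∧ L.Sim (n + 1) r x y := by
  obtain ⟨p, hp, -⟩ := exists_wide (L := L.flip)
  obtain ⟨q, x, -, hqs, hq, hx⟩ := h.flip.exists_sim_family hS.flip hψ hs hp hy
  have hq' := hq.unflip
  obtain ⟨r, -, hrI, hr⟩ := h.exists_narrow_family hS hψ hs hY hb hq'
    ((dom_mem_unions_iff hq'.wide.1).1 hqs) hx
  exact ⟨r, x, hrI, hr⟩

theorem Similar.encard_family_eq (hS : L.Super τ Y₁ Y₂ s) (h : L.Similar n S₁ S₂)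
    {ψ : Formula τ m} (hψ : ψ.Fits L.k s) (hs : (ψ.freeVars.erase 0).card ≤ s) {b : ℕ∞}
    (hY : Y₁.IsDichotomical b s) (hb : (S₁.family ψ).encard ≤ b) :
    (S₁.family ψ).encard = (S₂.family ψ).encard := by
  obtain ⟨p, hp, hd⟩ := exists_wide (L := L)
  exact encard_eq_of_sim hS.compat hS.le hS.preserves hp.1
    (unions_mono L.empty₁ (Nat.zero_le s) (by rw [hd, unions_zero]; rfl))
    (fun _ => h.supp_family₁ hS hψ hs hY hb) (fun _ => h.supp_family₂ hS hψ hs hY hb)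
    fun _ _ _ _ _ _ _ _ => h.mem_family_iff hS hψ hs

/-! ### The induction on stages -/

theorem Similar.exists_sim_of_mem (h : L.Similar n S₁ S₂) {p : M₁ ≃. M₂} (hp : L.Wide p)
    {x : HF M₁} (hx : x ∈ S₁.N) : ∃ q y, L.Comp p q ∧ L.Sim n q x y := by
  obtain ⟨r, y, hrI, hr⟩ := h.supp₁ x hx
  obtain ⟨q, hq, hqr, hpq, -⟩ := exists_comp (comp_self hp.1) hp.2 hp.2 hrI
  obtain ⟨y', hy'⟩ := hr.exists_image hq hqr
  exact ⟨q, y', hpq, hy'⟩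

/-- An old element has an image already at level `n`; uniqueness identifies it with the image at
level `n + 1`. -/
theorem Similar.mem_succ (h : L.Similar n S₁ S₂) {p : M₁ ≃. M₂} {x : HF M₁} {y : HF M₂}
    (hp : L.Sim (n + 1) p x y) (hx : x ∈ S₁.N) : y ∈ S₂.N := by
  obtain ⟨q, y', hpq, hq⟩ := h.exists_sim_of_mem hp.wide hx
  rw [hp.unique hq.succ hpq]
  exact (h.mem_iff _ _ _ hq).1 hx

theorem Similar.isSetOf (hS : L.Super τ Y₁ Y₂ s) (h : L.Similar n S₁ S₂) {φ : Formula τ m}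
    (hφ : φ.Fits L.k s) {p : M₁ ≃. M₂} {x : HF M₁} {y : HF M₂}
    (hp : L.Sim (n + 1) p x y)
    (hx : HF.IsSetOf x {a | a ∈ S₁.N ∧ S₁.Realize φ fun _ => a}) :
    HF.IsSetOf y {b | b ∈ S₂.N ∧ S₂.Realize φ fun _ => b} := by
  have key : ∀ r a b, dom r ∈ L.I₁ → L.Sim n r a b →
      ((a ∈ S₁.N ∧ S₁.Realize φ fun _ => a) ↔ (b ∈ S₂.N ∧ S₂.Realize φ fun _ => b)) :=
    fun r a b hrI hr => and_congr (h.mem_iff _ _ _ hr)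
      (realize_iff hS h hφ hr.wide.1 fun _ _ => ⟨r, le_rfl, hrI, hr⟩)
  refine ⟨hp.isSet_iff.1 hx.1, fun b => ⟨fun hb => ?_, fun hb => ?_⟩⟩
  · rcases hp.2 with ⟨c, d, -, rfl, -⟩ | ⟨-, -, -, h₂⟩
    · exact absurd hb (HF.not_mem_atom _ _)
    obtain ⟨C, hC, h₃⟩ := h₂ b hb
    obtain ⟨r, hr, hrC, hpr, -⟩ := exists_comp_symm (comp_self hp.1.1) hp.1.2 hp.1.2 hC
    obtain ⟨a, ha, hab⟩ := h₃ r hr hrC hpr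
    exact (key r a b ((dom_mem_iff hr).2 (hrC ▸ hC)) hab).1 ((hx.2 a).1 ha)
  · obtain ⟨r, a, hrI, hr⟩ := h.supp₂ b hb.1
    have hrI' := (dom_mem_iff hr.wide.1).1 hrI
    obtain ⟨q, hq, hqr, hpq, -⟩ := exists_comp_symm (comp_self hp.1.1) hp.1.2 hp.1.2 hrI'
    obtain ⟨a', ha'⟩ := hr.exists_preimage hq hqr
    exact (hp.mem_iff' ha' hpq).1 ((hx.2 a').2
      ((key q a' b ((dom_mem_iff hq).2 (hqr ▸ hrI')) ha').2 hb))

theorem Similar.step (hS : L.Super τ Y₁ Y₂ s) {Υ : Scheme τ} (hΥ : Υ.Fits L.k s)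
    {S₁ : State M₁ Υ.m₁} {S₂ : State M₂ Υ.m₁} (h : L.Similar n S₁ S₂) {b : ℕ∞}
    (hY : Y₁.IsDichotomical b s) {β₁ β₂ : ℕ∞}
    (hβ : ∀ l, ((S₁.family (Υ.ψ l)).encard ≤ β₁ ↔ (S₂.family (Υ.ψ l)).encard ≤ β₂) ∧
      ((S₁.family (Υ.ψ l)).encard ≤ β₁ → (S₁.family (Υ.ψ l)).encard ≤ b)) :
    L.Similar (n + 1) (Υ.succ β₁ S₁) (Υ.succ β₂ S₂) := by
  have hN : ∀ p x y, L.Sim (n + 1) p x y →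
      (x ∈ (Υ.succ β₁ S₁).N ↔ y ∈ (Υ.succ β₂ S₂).N) := by
    intro p x y hp
    rw [Scheme.mem_succ, Scheme.mem_succ]
    refine or_congr ⟨h.mem_succ hp, h.flip.mem_succ hp.flip⟩ (exists_congr fun l => ?_)
    exact and_congr (h.mem_family_iff hS (hΥ.ψ_fits l) (hΥ.card_params l) hp) (hβ l).1
  refine ⟨?_, ?_, hN, ?_⟩
  · rintro x (hx | ⟨l, hx, hl⟩)
    · obtain ⟨r, y, hrI, hr⟩ := h.supp₁ x hx
      exact ⟨r, y, hrI, hr.succ⟩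
    · exact h.supp_family₁ hS (hΥ.ψ_fits l) (hΥ.card_params l) hY ((hβ l).2 hl) hx
  · rintro y (hy | ⟨l, hy, hl⟩)
    · obtain ⟨r, x, hrI, hr⟩ := h.supp₂ y hy
      exact ⟨r, x, hrI, hr.succ⟩
    · exact h.supp_family₂ hS (hΥ.ψ_fits l) (hΥ.card_params l) hY
        ((hβ l).2 ((hβ l).1.2 hl)) hy
  · intro p x y l hp
    rw [Scheme.succ_c_eq_some, Scheme.succ_c_eq_some]
    exact and_congr (hN p x y hp) ⟨h.isSetOf hS (hΥ.φ_fits l) hp,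
      h.flip.isSetOf hS.flip (hΥ.φ_fits l) hp.flip⟩

theorem similar_run_zero {Υ : Scheme τ} {β₁ β₂ : ℕ∞} :
    L.Similar 1 (Υ.run M₁ β₁ 0) (Υ.run M₂ β₂ 0) where
  supp₁ := by
    rintro _ ⟨a, rfl⟩
    exact exists_sim_atom a
  supp₂ := by
    rintro _ ⟨b, rfl⟩
    exact exists_sim_atom_symm b
  mem_iff _ _ _ hp := hp.atom_iff
  c_iff _ _ _ _ _ := by simp [Scheme.run]

theorem Similar.sat_iff (hS : L.Super τ Y₁ Y₂ s) (h : L.Similar n S₁ S₂) {χ : Formula τ m}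
    (hf : χ.freeVars = ∅) (hχ : χ.Fits L.k s) : S₁.Sat χ ↔ S₂.Sat χ := by
  obtain ⟨g, hg⟩ := L.nonempty
  exact realize_iff hS h hχ hg fun j hj => absurd (hf ▸ hj) (Finset.notMem_empty j)

/-- The unbounded runs are similar as long as no family is too large. -/
theorem similar_run_top (hS : L.Super τ Y₁ Y₂ s) {Υ : Scheme τ} (hΥ : Υ.Fits L.k s) {b : ℕ∞}
    (hY : Y₁.IsDichotomical b s) {t : ℕ}
    (ht : ∀ i < t, ∀ l, ((Υ.run M₁ ⊤ i).family (Υ.ψ l)).encard ≤ b) :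
    L.Similar (t + 1) (Υ.run M₁ ⊤ t) (Υ.run M₂ ⊤ t) := by
  induction t with
  | zero => exact similar_run_zero
  | succ t ih =>
    exact (ih fun i hi => ht i (by omega)).step hS hΥ hY fun l =>
      ⟨iff_of_true le_top le_top, fun _ => ht t (by omega) l⟩

/-- The bounded runs are similar if they are well defined, or if the bounds agree. -/
theorem similar_run (hS : L.Super τ Y₁ Y₂ s) {Υ : Scheme τ} (hΥ : Υ.Fits L.k s) {b₁ b₂ : ℕ∞}
    (hY₁ : Y₁.IsDichotomical b₁ s) (hY₂ : Y₂.IsDichotomical b₂ s) {t : ℕ}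
    (ht : Υ.WellDefined M₁ b₁ t ∧ Υ.WellDefined M₂ b₂ t ∨ b₁ = b₂) :
    L.Similar (t + 1) (Υ.run M₁ b₁ t) (Υ.run M₂ b₂ t) := by
  induction t with
  | zero => exact similar_run_zero
  | succ t ih =>
    have h := ih (ht.imp_left fun h => ⟨fun i hi => h.1 i (by omega), fun i hi => h.2 i (by omega)⟩)
    refine h.step hS hΥ hY₁ fun l => ⟨?_, id⟩
    rcases ht with ⟨h₁, h₂⟩ | rfl
    · exact iff_of_true (h₁ t (by omega) l) (h₂ t (by omega) l)
    -- Sizes can be compared only after one family is known to be small, so each direction starts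
    -- from its own side.
    · constructor
      · intro hb
        rwa [← h.encard_family_eq hS (hΥ.ψ_fits l) (hΥ.card_params l) hY₁ hb]
      · intro hb
        rwa [← h.flip.encard_family_eq hS.flip (hΥ.ψ_fits l) (hΥ.card_params l) hY₂ hb]

end Link

/-! ### Links from witnesses -/

section Witness

variable {τ : FirstOrder.Language.{u, v}} {M₁ : Type w} {M₂ : Type w'} [τ.Structure M₁]
  [τ.Structure M₂] [Finite M₁] [Finite M₂] [Nonempty M₁] [Nonempty M₂] {Y₁ : Sys M₁}
  {Y₂ : Sys M₂} {H : Set (M₁ ≃. M₂)} {k s : ℕ}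

theorem Sys.IsSystem.empty_mem {M : Type w} [τ.Structure M] [Nonempty M] {Y : Sys M}
    (h : Y.IsSystem τ k) : ∅ ∈ Y.I :=
  h.subset_mem _ (h.singleton_mem (Classical.arbitrary M)) _ (Set.empty_subset _)

/-- The link given by a witness. -/
def Sys.IsWitness.link (h : Sys.IsWitness τ Y₁ Y₂ H k) (s : ℕ) (hk : 3 ≤ k)
    (hs : 2 * s + 1 ≤ k) : Link M₁ M₂ where
  I₁ := Y₁.I
  I₂ := Y₂.I
  K := H
  k := k
  -- With `s = 0` narrow supports would not count as wide ones; `3 ≤ k` leaves room for the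
  -- replacement by `1`.
  s := max s 1
  one_le := le_max_right _ _
  two_mul_lt := by omega
  down₁ := h.system₁.subset_mem
  down₂ := h.system₂.subset_mem
  empty₁ := h.system₁.empty_mem
  empty₂ := h.system₂.empty_mem
  singleton₁ := h.system₁.singleton_mem
  singleton₂ := h.system₂.singleton_mem
  nonempty := h.nonempty
  restrict p hp q hq := by
    have hid : q.trans q.symm ∈ Y₁.F := h.system₁.restrict_mem _ (h.comp_symm p hp p hp) _
      (trans_le_trans hq (symm_le_symm hq))
    -- Closure under restriction is not assumed for `ℋ`; it follows by composing `p` with an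
    -- identity taken from `ℱ₁`.
    have : (q.trans q.symm).trans p = q := by
      refine pequiv_ext fun a b => ⟨fun hb => ?_, fun hb => ?_⟩
      · obtain ⟨a', h₁, h₂⟩ := trans_eq_some.1 hb
        obtain ⟨b', h₃, h₄⟩ := trans_eq_some.1 h₁
        obtain rfl := pequiv_inj h₃ (symm_eq_some.1 h₄)
        rwa [pequiv_fun h₂ (hq _ _ h₃)]
      · exact trans_eq_some.2 ⟨a, trans_eq_some.2 ⟨b, hb, symm_eq_some.2 hb⟩, hq _ _ hb⟩
    rw [← this]
    exact h.comp_left p hp _ hid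
  zig_mem p hp q hq r hr := by
    rw [zig, ← PEquiv.trans_assoc]
    exact h.comp_left r hr _ (h.comp_symm p hp q hq)
  img_iff := h.img_mem
  forth := h.forth
  back := h.back

theorem Sys.IsWitness.super (h : Sys.IsWitness τ Y₁ Y₂ H k) (hk : 3 ≤ k) (hs : 2 * s + 1 ≤ k)
    (hP : Sys.PreservesClasses Y₁ Y₂ H s) : (h.link s hk hs).Super τ Y₁ Y₂ s where
  compat :=
    { I₁_eq := rfl
      I₂_eq := rfl
      comp_left := h.comp_left
      comp_right := h.comp_right
      comp_symm := h.comp_symm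
      symm_comp := h.symm_comp
      restrict₁ := h.system₁.restrict_mem
      restrict₂ := h.system₂.restrict_mem
      symm₁ := h.system₁.symm_mem
      symm₂ := h.system₂.symm_mem }
  le := le_max_left _ _
  preserves := hP
  partialIso := h.partialIso

/-- The partial automorphisms of a system are a witness to its equivalence with itself. -/
theorem Sys.IsSystem.isWitness {Y : Sys M₁} (h : Y.IsSystem τ k) :
    Sys.IsWitness τ Y Y Y.F k where
  system₁ := h
  system₂ := h
  nonempty := h.nonempty
  partialIso := h.partialIso
  dom_mem := h.dom_mem
  ran_mem g hg := h.dom_mem _ (h.symm_mem g hg)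
  img_mem g hg A hA := by
    refine ⟨fun hI => h.img_mem g hg A hI hA, fun hI => ?_⟩
    rw [← img_symm_img hA]
    exact h.img_mem _ (h.symm_mem g hg) _ hI (img_subset_dom_symm g A)
  comp_left g hg f hf := h.trans_mem f hf g hg
  comp_right g hg f hf := h.trans_mem g hg f hf
  comp_symm g hg g' hg' := h.trans_mem _ hg _ (h.symm_mem _ hg')
  symm_comp g hg g' hg' := h.trans_mem _ (h.symm_mem _ hg) _ hg'
  forth g hg A hA hAg B hB := h.extend g hg A hA hAg B hB
  back g hg A hA hAg B hB := by
    obtain ⟨g', hg', h₁, h₂⟩ := h.extend _ (h.symm_mem g hg) A hA hAg B hB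
    exact ⟨g'.symm, h.symm_mem _ hg', by simpa using h₁, by simpa using h₂⟩

end Witness

/-! ### Runs and candidates -/

section Candidate

variable {τ : FirstOrder.Language.{u, v}} {M : Type w} [τ.Structure M]

theorem Scheme.isCandidate_run (Υ : Scheme τ) (b : ℕ∞) (t : ℕ) : (Υ.run M b t).IsCandidate := by
  induction t with
  | zero =>
    refine ⟨?_, fun a => ⟨a, rfl⟩, ?_⟩
    · rintro _ ⟨a, rfl⟩ x hx
      exact absurd hx (HF.not_mem_atom _ _)
    · intro l x hx
      simp [Scheme.run] at hx
  | succ t ih =>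
    refine ⟨?_, fun a => Or.inl (ih.atom_mem a), ?_⟩
    · rintro y (hy | ⟨l, ⟨v, -, hy⟩, -⟩) x hx
      · exact Or.inl (ih.transitive y hy x hx)
      · exact Or.inl ((hy.2 x).1 hx).1
    · intro l x hx
      exact (Scheme.succ_c_eq_some.1 hx).1

end Candidate

/-! ### Liftings from links -/

namespace Link

variable {τ : FirstOrder.Language.{u, v}} {M : Type w} [τ.Structure M] [Finite M] {L : Link M M}
  {Y : Sys M} {s n m : ℕ} {S : State M m}

theorem flip_eq_self (hL : L.Compat Y Y) (hK : L.K = Y.F) : L.flip = L := by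
  have h₁ := hL.I₁_eq
  have h₂ := hL.I₂_eq
  have h₃ : {p : M ≃. M | p.symm ∈ L.K} = L.K := by
    ext p
    rw [hK]
    refine ⟨fun h => ?_, hL.symm₁ p⟩
    have := hL.symm₁ _ h
    rwa [PEquiv.symm_symm] at this
  cases L
  simp only [flip] at *
  subst h₁ h₂
  simp only [mk.injEq, true_and, and_true]
  exact h₃

theorem Sim.symm_self (hL : L.Compat Y Y) (hK : L.K = Y.F) {p : M ≃. M} {x y : HF M}
    (h : L.Sim n p x y) : L.Sim n p.symm y x := by
  have := h.flip
  rwa [flip_eq_self hL hK] at this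

/-- Identities act as identities. -/
theorem Sim.eq_of_le_refl (hL : L.Compat Y Y) (hK : L.K = Y.F) {p : M ≃. M} {x y : HF M}
    (h : L.Sim n p x y) (hp : p ≤ PEquiv.refl M) : x = y := by
  -- Among the maps tested in `Sim` there is always an identity: any compatible `q` followed by its
  -- inverse has the prescribed domain, and its range equals this domain.
  have hid : ∀ p ∈ L.K, p ≤ PEquiv.refl M → ∀ C ∈ L.I₁, dom p ∈ unions L.I₁ L.s →
      ∃ q ∈ L.K, dom q = C ∧ dom q.symm = C ∧ L.Comp p q ∧ q ≤ PEquiv.refl M := by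
    intro p hp hpr C hC hps
    obtain ⟨q, hq, hqC, ⟨g, hg, hpg, hqg⟩, -⟩ := exists_comp (comp_self hp) hps hps hC
    have hle : ∀ r : M ≃. M, r.trans r.symm ≤ PEquiv.refl M := by
      intro r a b hab
      obtain ⟨c, h₁, h₂⟩ := trans_eq_some.1 hab
      rw [pequiv_inj h₁ (symm_eq_some.1 h₂)]
      rfl
    have hqq : dom (q.trans q.symm) = C := by rw [← hqC]; exact dom_trans subset_rfl
    have hmem : ∀ r ∈ L.K, r.trans r.symm ∈ L.K := fun r hr => hK ▸ hL.comp_symm r hr r hr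
    refine ⟨q.trans q.symm, hmem q hq, hqq, ?_, ⟨g.trans g.symm, hmem g hg, ?_, ?_⟩, hle q⟩
    · rw [trans_symm_eq, PEquiv.symm_symm, hqq]
    · intro a b hab
      have : a = b := Option.some.inj (hpr _ _ hab)
      subst this
      exact trans_eq_some.2 ⟨a, hpg _ _ hab, symm_eq_some.2 (hpg _ _ hab)⟩
    · exact trans_le_trans hqg (symm_le_symm hqg)
  induction n generalizing p x y with
  | zero => exact h.elim
  | succ n ih =>
    rcases h.2 with ⟨a, b, rfl, rfl, hab⟩ | ⟨hx, hy, h₁, h₂⟩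
    · rw [Option.some.inj (hp _ _ hab)]
    · refine HF.ext hx hy fun a => ⟨fun ha => ?_, fun ha => ?_⟩
      · obtain ⟨C, hC, h₃⟩ := h₁ a ha
        obtain ⟨q, hq, hqC, -, hpq, hqr⟩ := hid p h.1.1 hp C hC h.1.2
        obtain ⟨b, hb, hab⟩ := h₃ q hq hqC hpq
        rwa [ih hab hqr]
      · obtain ⟨C, hC, h₃⟩ := h₂ a ha
        obtain ⟨q, hq, -, hqC, hpq, hqr⟩ := hid p h.1.1 hp C
          (by rw [hL.I₁_eq, ← hL.I₂_eq]; exact hC) h.1.2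
        obtain ⟨b, hb, hab⟩ := h₃ q hq hqC hpq
        rwa [← ih hab hqr]

/-- The graph of the lifted map. -/
def Lifts (L : Link M M) (n : ℕ) (N : Set (HF M)) (f : M ≃. M) (x y : HF M) : Prop :=
  f ∈ L.K ∧ x ∈ N ∧ y ∈ N ∧ ∃ p ≤ f, L.Sim n p x y

open Classical in
theorem dite_choose_eq_some {α : Type u} {β : Type v} {R : α → β → Prop}
    (h₁ : ∀ a b b', R a b → R a b' → b = b') (a : α) (b : β) :
    (if h : ∃ b, R a b then some h.choose else none) = some b ↔ R a b := by
  split_ifs with h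
  · rw [Option.some_inj]
    exact ⟨fun e => e ▸ h.choose_spec, h₁ _ _ _ h.choose_spec⟩
  · exact ⟨fun e => absurd e (by simp), fun e => absurd ⟨b, e⟩ h⟩

open Classical in
theorem exists_pequiv {α : Type u} {β : Type v} (R : α → β → Prop)
    (h₁ : ∀ a b b', R a b → R a b' → b = b') (h₂ : ∀ a a' b, R a b → R a' b → a = a') :
    ∃ f : α ≃. β, ∀ a b, f a = some b ↔ R a b :=
  ⟨{ toFun := fun a => if h : ∃ b, R a b then some h.choose else none
     invFun := fun b => if h : ∃ a, R a b then some h.choose else none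
     inv := fun a b => (dite_choose_eq_some (R := fun b a => R a b)
       (fun b a a' => h₂ a a' b) b a).trans (dite_choose_eq_some h₁ a b).symm },
    dite_choose_eq_some h₁⟩

theorem exists_lift (L : Link M M) (n : ℕ) (N : Set (HF M)) :
    ∃ G : (M ≃. M) → (HF M ≃. HF M), ∀ f x y, G f x = some y ↔ L.Lifts n N f x y := by
  choose G hG using fun f => exists_pequiv (L.Lifts n N f)
    (fun _ _ _ ⟨hf, _, _, p, hp, h⟩ ⟨_, _, _, q, hq, h'⟩ => h.unique h' ⟨f, hf, hp, hq⟩)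
    (fun _ _ _ ⟨hf, _, _, p, hp, h⟩ ⟨_, _, _, q, hq, h'⟩ => h.injective h' ⟨f, hf, hp, hq⟩)
  exact ⟨G, hG⟩

/-- If a state is similar to itself, then the action of the system is a lifting. -/
theorem Similar.exists_lifting (hS : L.Super τ Y Y s) (hK : L.K = Y.F) (hc : S.IsCandidate)
    (h : L.Similar (n + 1) S S) :
    ∃ (G : (M ≃. M) → (HF M ≃. HF M)) (R : Set M → HF M → Prop), IsLifting τ Y S G R := by
  obtain ⟨G, hG⟩ := exists_lift L (n + 1) S.N
  have hL := hS.compat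
  have hI := hL.I₁_eq
  -- A support is a narrow set that is the domain of some map acting on `y`; every map defined on it
  -- then acts as well.
  refine ⟨G, fun A y => A ∈ L.I₁ ∧ y ∈ S.N ∧ ∃ p z, dom p = A ∧ L.Sim (n + 1) p y z, ?_⟩
  have hdef : ∀ {A y f}, (∃ p z, dom p = A ∧ L.Sim (n + 1) p y z) → f ∈ L.K → A ⊆ dom f →
      ∃ z, L.Sim (n + 1) (res f A) y z := by
    rintro A y f ⟨p, z, hp, hs⟩ hf hA
    exact hs.exists_image (L.restrict f hf _ (res_le f A)) ((dom_res hA).trans hp.symm)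
  have himg : ∀ {f A y y'}, f ∈ L.K → A ∈ L.I₁ → A ⊆ dom f → L.Lifts (n + 1) S.N f y y' →
      (∃ p z, dom p = A ∧ L.Sim (n + 1) p y z) →
      img f A ∈ L.I₁ ∧ ∃ p z, dom p = img f A ∧ L.Sim (n + 1) p y' z := by
    rintro f A y y' hf hA hAf ⟨-, -, -, p, hpf, hp⟩ hsupp
    obtain ⟨z, hz⟩ := hdef hsupp hf hAf
    obtain rfl := hp.unique hz ⟨f, hf, hpf, res_le _ _⟩
    refine ⟨?_, _, y, dom_res_symm f A, hz.symm_self hL hK⟩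
    rw [hI, ← hL.I₂_eq]
    exact (L.img_iff f hf A hAf).1 hA
  have hsymm : ∀ {f x y}, L.Lifts (n + 1) S.N f x y → L.Lifts (n + 1) S.N f.symm y x := by
    rintro f x y ⟨hf, hx, hy, p, hpf, hp⟩
    exact ⟨hK ▸ hL.symm₁ f (hK ▸ hf), hy, hx, p.symm, symm_le_symm hpf, hp.symm_self hL hK⟩
  constructor
  · exact hc
  · intro f hf
    have hf' : f ∈ L.K := hK ▸ hf
    refine ⟨fun x y hxy => ⟨((hG f x y).1 hxy).2.1, ((hG f x y).1 hxy).2.2.1⟩, ?_, ?_, ?_⟩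
    · intro x x' y y' hx hy
      obtain ⟨-, -, -, p, hp, h₁⟩ := (hG _ _ _).1 hx
      obtain ⟨-, -, -, q, hq, h₂⟩ := (hG _ _ _).1 hy
      exact h₂.mem_iff h₁ ⟨f, hf', hq, hp⟩
    · intro l R x y hxy
      refine relHF_iff (L := L) (n := n + 1) R (hS.partialIso f hf') fun i => ?_
      obtain ⟨-, -, -, hp⟩ := (hG _ _ _).1 (hxy i)
      exact hp
    · intro l F x y a b hxy hab
      refine graphHF_iff (L := L) (n := n + 1) F (hS.partialIso f hf') (fun i => ?_) ?_
      · obtain ⟨-, -, -, hp⟩ := (hG _ _ _).1 (hxy i)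
        exact hp
      · obtain ⟨-, -, -, hp⟩ := (hG _ _ _).1 hab
        exact hp
  · intro f hf a b hab
    have hf' : f ∈ L.K := hK ▸ hf
    have hsub : {a} ⊆ dom f := by
      rintro _ rfl
      exact ⟨b, hab⟩
    have hd := dom_res hsub
    exact (hG _ _ _).2 ⟨hf', hc.atom_mem a, hc.atom_mem b, res f {a}, res_le _ _,
      wide_of_narrow (L.restrict f hf' _ (res_le _ _)) (by rw [hd]; exact L.singleton₁ a),
      Or.inl ⟨a, b, rfl, rfl, res_eq_some.2 ⟨rfl, hab⟩⟩⟩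
  · intro f hf g hg hfg x y hxy
    obtain ⟨-, hx, hy, p, hp, h₁⟩ := (hG _ _ _).1 hxy
    exact (hG _ _ _).2 ⟨hK ▸ hg, hx, hy, p, hp.trans hfg, h₁⟩
  · exact fun A y hR => ⟨hI ▸ hR.1, hR.2.1⟩
  · rintro A y ⟨hA, hy, hsupp⟩ f hf hAf
    obtain ⟨z, hz⟩ := hdef hsupp (hK ▸ hf) hAf
    exact ⟨z, (hG _ _ _).2 ⟨hK ▸ hf, hy, (h.mem_iff _ _ _ hz).1 hy, _, res_le _ _, hz⟩⟩
  · rintro A y ⟨hA, hy, hsupp⟩ f hf hAf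
    obtain ⟨z, hz⟩ := hdef hsupp (hK ▸ hf) fun a ha => ⟨a, hAf a ha⟩
    obtain rfl := hz.eq_of_le_refl hL hK fun a b hab => by
      obtain ⟨ha, hb⟩ := res_eq_some.1 hab
      exact (hAf a ha).symm.trans hb
    exact (hG _ _ _).2 ⟨hK ▸ hf, hy, hy, _, res_le _ _, hz⟩
  · intro y hy
    obtain ⟨r, b, hrI, hr⟩ := h.supp₁ y hy
    exact ⟨dom r, hI ▸ hrI, hrI, hy, r, b, rfl, hr⟩
  · intro f hf A hA hAf y y' hyy'
    have hf' : f ∈ L.K := hK ▸ hf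
    have hA' : A ∈ L.I₁ := hI ▸ hA
    have hlift := (hG _ _ _).1 hyy'
    constructor
    · rintro ⟨-, -, hsupp⟩
      obtain ⟨h₁, h₂⟩ := himg hf' hA' hAf hlift hsupp
      exact ⟨h₁, hlift.2.2.1, h₂⟩
    · rintro ⟨h₁, -, hsupp⟩
      have := himg (hK ▸ hL.symm₁ f hf) h₁ (img_subset_dom_symm f A) (hsymm hlift) hsupp
      rw [img_symm_img hAf] at this
      exact ⟨hA', hlift.2.1, this.2⟩
  · intro f hf
    refine pequiv_ext fun y x => ?_
    rw [symm_eq_some, hG, hG]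
    refine ⟨fun h => ?_, hsymm⟩
    simpa using hsymm h
  · intro f₁ hf₁ f₂ hf₂ x z hxz
    obtain ⟨-, hx, hz, p, hp, hs⟩ := (hG _ _ _).1 hxz
    have hpf : dom p ⊆ dom f₁ := by
      rintro a ⟨c, hc⟩
      obtain ⟨b, hb, -⟩ := trans_eq_some.1 (hp _ _ hc)
      exact ⟨b, hb⟩
    obtain ⟨y, hy⟩ := hs.exists_image (L.restrict f₁ (hK ▸ hf₁) _ (res_le f₁ (dom p)))
      (dom_res hpf)
    have hyN := (h.mem_iff _ _ _ hy).1 hx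
    have hle : p.trans p.symm ≤ PEquiv.refl M := by
      intro a b hab
      obtain ⟨c, h₁, h₂⟩ := trans_eq_some.1 hab
      rw [pequiv_inj h₁ (symm_eq_some.1 h₂)]
      rfl
    have hpp : dom (p.trans p.symm) = dom p := dom_trans subset_rfl
    -- The second factor should act as the inverse of the first followed by `p`. Composition is
    -- available only for three maps, so the identity on `dom p` is put in the middle.
    obtain ⟨x', hx'⟩ := hs.exists_image (hK ▸ hL.comp_symm p hs.wide.1 p hs.wide.1) hpp
    obtain rfl := hx'.eq_of_le_refl hL hK hle
    refine trans_eq_some.2 ⟨y, (hG _ _ _).2 ⟨hK ▸ hf₁, hx, hyN, _, res_le _ _, hy⟩,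
      (hG _ _ _).2 ⟨hK ▸ hf₂, hyN, hz, _, ?_, (hy.symm_self hL hK).zig hx' hs ?_ hpp⟩⟩
    · intro b c hbc
      obtain ⟨a, a', h₁, h₂, h₃⟩ := zig_eq_some.1 hbc
      obtain rfl : a' = a := Option.some.inj (hle _ _ h₂)
      obtain ⟨b', h₄, h₅⟩ := trans_eq_some.1 (hp _ _ h₃)
      rwa [pequiv_fun (res_le _ _ _ _ (symm_eq_some.1 h₁)) h₄]
    · rw [PEquiv.symm_symm, dom_res hpf, trans_symm_eq, PEquiv.symm_symm, hpp]
  · intro f hf l x y hx hxy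
    obtain ⟨-, -, -, p, -, hs⟩ := (hG _ _ _).1 hxy
    exact Option.some.inj (((h.c_iff _ _ _ l hs).1 hx).symm.trans hx)

end Link

/-! ### Stopping times -/

section Stop

variable {τ : FirstOrder.Language.{u, v}} {M : Type w} [τ.Structure M] {Υ : Scheme τ} {b : ℕ∞}
  {ι : Clock} {t : ℕ}

/-- The run halts or exhausts its resources at stage `t`. -/
def Scheme.Stops (Υ : Scheme τ) (M : Type w) [τ.Structure M] (b : ℕ∞) (ι : Clock) (t : ℕ) : Prop :=
  Υ.Exhausted M b ι t ∨ Υ.Halted M t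

theorem Scheme.stopTime_le (h : Υ.Stops M b ι t) : Υ.stopTime M b ι ≤ t := sInf_le ⟨t, rfl, h⟩

theorem Scheme.not_stops (h : (t : ℕ∞) < Υ.stopTime M b ι) : ¬ Υ.Stops M b ι t :=
  fun h' => (Scheme.stopTime_le h').not_gt h

/-- In the unbounded run every family is included in the next collection. Hence the two clocks that
measure size also control the families. -/
theorem Scheme.family_le_of_not_stops (h : ¬ Υ.Stops M b ι t) (l : Fin Υ.m₀) :
    ((Υ.run M ⊤ t).family (Υ.ψ l)).encard ≤ b := by
  have hE : ¬ Υ.Exhausted M b ι t := fun h' => h (Or.inl h')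
  have hle : ((Υ.run M ⊤ t).family (Υ.ψ l)).encard ≤ (Υ.run M ⊤ (t + 1)).N.encard :=
    Set.encard_le_encard fun x hx => Or.inr ⟨l, hx, le_top⟩
  cases ι with
  | sizeTime => exact hle.trans (le_self_add.trans (not_lt.1 hE))
  | size => exact hle.trans (not_lt.1 hE)
  | families => exact not_lt.1 fun h' => hE ⟨l, h'⟩

theorem Scheme.family_le_of_le_stopTime (h : (t : ℕ∞) ≤ Υ.stopTime M b ι) (i : ℕ) (hi : i < t)
    (l : Fin Υ.m₀) : ((Υ.run M ⊤ i).family (Υ.ψ l)).encard ≤ b :=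
  Scheme.family_le_of_not_stops (Scheme.not_stops ((Nat.cast_lt.2 hi).trans_le h)) l

theorem Scheme.truthValue_eq_some {χ : Formula τ Υ.m₁} (h : Υ.stopTime M b ι = t)
    (h' : Υ.Halted M t) : Υ.truthValue M χ b ι = some ((Υ.run M ⊤ t).Sat χ) := by
  have hex : ∃ t : ℕ, Υ.stopTime M b ι = t ∧ Υ.Halted M t := ⟨t, h, h'⟩
  have : hex.choose = t := Nat.cast_injective (hex.choose_spec.1.symm.trans h)
  rw [Scheme.truthValue, dif_pos hex, this]

theorem Scheme.truthValue_eq_none {χ : Formula τ Υ.m₁}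
    (h : ∀ t : ℕ, Υ.stopTime M b ι = t → ¬ Υ.Halted M t) : Υ.truthValue M χ b ι = none :=
  dif_neg fun ⟨t, ht, ht'⟩ => h t ht ht'

end Stop

/-! ### Comparison of stopping times and truth values. -/

namespace Link

variable {τ : FirstOrder.Language.{u, v}} {M₁ : Type w} {M₂ : Type w'} [τ.Structure M₁]
  [τ.Structure M₂] [Finite M₁] [Finite M₂] {L : Link M₁ M₂} {Y₁ : Sys M₁} {Y₂ : Sys M₂} {s n : ℕ}

theorem Similar.halted {Υ : Scheme τ} {t : ℕ}
    (h : L.Similar n (Υ.run M₁ ⊤ t) (Υ.run M₂ ⊤ t)) (hc : (Υ.run M₁ ⊤ t).IsCandidate)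
    (h₁ : Υ.Halted M₁ t) : Υ.Halted M₂ t := by
  obtain ⟨h₀, h₁, x, hx₀, hx₁⟩ := h₁
  obtain ⟨r, y, -, hr⟩ := h.supp₁ x (hc.c_mem _ _ hx₀)
  exact ⟨h₀, h₁, y, (h.c_iff _ _ _ _ hr).1 hx₀, (h.c_iff _ _ _ _ hr).1 hx₁⟩

theorem similar_of_le_stopTime (hS : L.Super τ Y₁ Y₂ s) {Υ : Scheme τ} (hΥ : Υ.Fits L.k s)
    {b : ℕ∞} (hY : Y₁.IsDichotomical b s) {ι : Clock} {t : ℕ}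
    (ht : (t : ℕ∞) ≤ Υ.stopTime M₁ b ι) :
    L.Similar (t + 1) (Υ.run M₁ ⊤ t) (Υ.run M₂ ⊤ t) :=
  similar_run_top hS hΥ hY (Scheme.family_le_of_le_stopTime ht)

/-- If the second run stops later, then the first one has not halted. -/
theorem truthValue_eq_none_of_lt (hS : L.Super τ Y₁ Y₂ s) {Υ : Scheme τ} (hΥ : Υ.Fits L.k s)
    {b₁ b₂ : ℕ∞} (hY : Y₁.IsDichotomical b₁ s) {ι : Clock} {χ : Formula τ Υ.m₁}
    (h : Υ.stopTime M₁ b₁ ι < Υ.stopTime M₂ b₂ ι) : Υ.truthValue M₁ χ b₁ ι = none := by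
  refine Scheme.truthValue_eq_none fun t ht hh => ?_
  -- Were the first run halted at its stopping time, similarity at that stage would make the second
  -- one halt there, earlier than it stops.
  have hsim := similar_of_le_stopTime hS hΥ hY ht.ge
  exact Scheme.not_stops (ht ▸ h) (Or.inr (hsim.halted (Υ.isCandidate_run ⊤ t) hh))

theorem truthValue_eq_of_eq (hS : L.Super τ Y₁ Y₂ s) {Υ : Scheme τ} (hΥ : Υ.Fits L.k s)
    {b₁ b₂ : ℕ∞} (hY : Y₁.IsDichotomical b₁ s) {ι : Clock} {χ : Formula τ Υ.m₁}
    (hf : χ.freeVars = ∅) (hχ : χ.Fits L.k s)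
    (h : Υ.stopTime M₁ b₁ ι = Υ.stopTime M₂ b₂ ι) :
    Υ.truthValue M₁ χ b₁ ι = Υ.truthValue M₂ χ b₂ ι := by
  by_cases hh : ∃ t : ℕ, Υ.stopTime M₁ b₁ ι = t ∧ Υ.Halted M₁ t
  · obtain ⟨t, ht, hh⟩ := hh
    have hsim := similar_of_le_stopTime hS hΥ hY ht.ge
    rw [Scheme.truthValue_eq_some ht hh, Scheme.truthValue_eq_some (h.symm.trans ht)
      (hsim.halted (Υ.isCandidate_run ⊤ t) hh), propext (hsim.sat_iff hS hf hχ)]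
  · have hn : ∀ t : ℕ, Υ.stopTime M₁ b₁ ι = t → ¬ Υ.Halted M₁ t := fun t ht h' => hh ⟨t, ht, h'⟩
    rw [Scheme.truthValue_eq_none hn, Scheme.truthValue_eq_none fun t ht h' => ?_]
    have hsim := similar_of_le_stopTime hS hΥ hY (h.trans ht).ge
    exact hn t (h.trans ht) (hsim.flip.halted (Υ.isCandidate_run ⊤ t) h')

end Link

end Choiceless

theorem mainTheorem6 (τ : FirstOrder.Language) [Finite τ.Symbols] (k s : ℕ)
    (Υ : Choiceless.Scheme τ) (hΥ : Υ.Fits k s) :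
    (∀ (M : Type*) [τ.Structure M] [Finite M] [Nonempty M] (t : ℕ → ℕ∞) (Y : Choiceless.Sys M),
      Y.IsSuper τ t k s →
      ∀ i : ℕ, ∃ (G : (M ≃. M) → (Choiceless.HF M ≃. Choiceless.HF M))
        (R : Set M → Choiceless.HF M → Prop),
        Choiceless.IsLifting τ Y (Υ.run M (t (Nat.card M)) i) G R) ∧
    (∀ (M₁ M₂ : Type*) [τ.Structure M₁] [τ.Structure M₂] [Finite M₁] [Finite M₂]
      [Nonempty M₁] [Nonempty M₂] (t₁ t₂ : ℕ → ℕ∞)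
      (Y₁ : Choiceless.Sys M₁) (Y₂ : Choiceless.Sys M₂) (H : Set (M₁ ≃. M₂)),
      Choiceless.Sys.IsSuperWitness τ Y₁ t₁ Y₂ t₂ H k s →
      ∀ χ : Choiceless.Formula τ Υ.m₁, χ.freeVars = ∅ → χ.Fits k s →
        (∀ ι : Choiceless.Clock,
          Υ.truthValue M₁ χ (t₁ (Nat.card M₁)) ι = Υ.truthValue M₂ χ (t₂ (Nat.card M₂)) ι ∨
          (Υ.truthValue M₁ χ (t₁ (Nat.card M₁)) ι = none ∧
            Υ.truthValue M₂ χ (t₂ (Nat.card M₂)) ι ≠ none ∧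
            Υ.stopTime M₁ (t₁ (Nat.card M₁)) ι < Υ.stopTime M₂ (t₂ (Nat.card M₂)) ι) ∨
          (Υ.truthValue M₂ χ (t₂ (Nat.card M₂)) ι = none ∧
            Υ.truthValue M₁ χ (t₁ (Nat.card M₁)) ι ≠ none ∧
            Υ.stopTime M₂ (t₂ (Nat.card M₂)) ι < Υ.stopTime M₁ (t₁ (Nat.card M₁)) ι)) ∧
        (∀ i : ℕ,
          (Υ.WellDefined M₁ (t₁ (Nat.card M₁)) i ∧ Υ.WellDefined M₂ (t₂ (Nat.card M₂)) i) ∨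
            t₁ (Nat.card M₁) = t₂ (Nat.card M₂) →
          ((Υ.run M₁ (t₁ (Nat.card M₁)) i).Sat χ ↔ (Υ.run M₂ (t₂ (Nat.card M₂)) i).Sat χ))) := by

  have h3 := hΥ.three_le
  have hk := hΥ.two_mul_lt
  refine ⟨?_, ?_⟩
  · intro M _ _ _ t Y hY i
    have hW := hY.system.isWitness
    have hS := hW.super h3 hk hY.preserves
    -- The run is compared with itself along `ℱ`; the bounds coincide, so it need not be well
    -- defined.
    exact (Choiceless.Link.similar_run hS hΥ hY.dichotomical hY.dichotomical
      (Or.inr rfl)).exists_lifting hS rfl (Υ.isCandidate_run _ _)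
  · intro M₁ M₂ _ _ _ _ _ _ t₁ t₂ Y₁ Y₂ H hH χ hf hχ
    have hS := hH.witness.super h3 hk hH.preserves
    have hD₁ := hH.super₁.dichotomical
    have hD₂ := hH.super₂.dichotomical
    refine ⟨fun ι => ?_, fun i hi =>
      (Choiceless.Link.similar_run hS hΥ hD₁ hD₂ hi).sat_iff hS hf hχ⟩
    rcases lt_trichotomy (Υ.stopTime M₁ (t₁ (Nat.card M₁)) ι)
      (Υ.stopTime M₂ (t₂ (Nat.card M₂)) ι) with h | h | h
    · have hn := Choiceless.Link.truthValue_eq_none_of_lt hS hΥ hD₁ (χ := χ) h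
      by_cases h₂ : Υ.truthValue M₂ χ (t₂ (Nat.card M₂)) ι = none
      · exact Or.inl (hn.trans h₂.symm)
      · exact Or.inr (Or.inl ⟨hn, h₂, h⟩)
    · exact Or.inl (Choiceless.Link.truthValue_eq_of_eq hS hΥ hD₁ hf hχ h)
    -- The inverse link exchanges the roles of the two structures.
    · have hn := Choiceless.Link.truthValue_eq_none_of_lt hS.flip hΥ hD₂ (χ := χ) h
      by_cases h₁ : Υ.truthValue M₁ χ (t₁ (Nat.card M₁)) ι = none
      · exact Or.inl (h₁.trans hn.symm)
      · exact Or.inr (Or.inr ⟨hn, h₁, h⟩)
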